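/- **Setting.** There are $n$ agents, $A=[n]$, a budget $B>0$, and a valuation $v:2^A\to\mathbb Q_{\ge 0}$ that is normalized ($v(\emptyset)=0$) and submodular, but not necessarily monotone. Agent $i$ has a private cost $c_i\ge 0$. Write $v(i\mid S)=v(S\cup\{i\})-v(S)$. For $D\subseteq A$ let $\mathrm{OPT}(D,B)=\max\{v(S): S\subseteq D,\ \sum_{i\in S}c_i\le B\}$ and $\mathrm{OPT}(D,\infty)=\max\{v(S):S\subseteq D\}$. **Auxiliary algorithms.** For a constant $\varepsilon>0$, let $\mathrm{ALG}_1$ be any (possibly randomized) algorithm for submodular maximization under a knapsack constraint: on $(D,v,\mathbf c_D,B)$ it always returns a set $S\subseteq D$ with $\sum_{i\in S}c_i\le B$, and with probability at least $1-\varepsilon$ it has $v(S)\ge(\frac1e-\varepsilon)\,\mathrm{OPT}(D,B)$. The number of its fair coin flips depends only on $n$. In particular, any deterministic $e$-approximation algorithm is allowed. Let $\mathrm{ALG}_2$ be any deterministic $2$-approximation algorithm for unconstrained submodular maximization: on $(D,v)$ it returns $T\subseteq D$ with $2v(T)\ge\mathrm{OPT}(D,\infty)$. **Mechanism GenSm-Main.**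 Remove all agents whose declared cost exceeds $B$; let $A$ denote the remaining agents and $\mathbf c$ the declared costs. With probability $p=0.201$, return $\{i^*\}$ for some $i^*\in\arg\max_{i\in A}v(\{i\})$ (the empty set if $A=\emptyset$). With probability $1-p$, put each agent of $A$ independently with probability $\frac12$ into $A_1$ or $A_2$, let $x=v(\mathrm{ALG}_1(A_1,v,\mathbf c_{A_1},B))$, and return the result of Simultaneous Greedy on $(A_2,v,\mathbf c_{A_2},B,x)$. With $\beta=9.185$, Simultaneous Greedy on $(D,v,\mathbf c_D,B,x)$ starts from $S_1=S_2=\emptyset$, $B_1=B_2=B$, $U=D$. While $\max_{i\in U,\,j\in\{1,2\}}v(i\mid S_j)>0$, it takes a maximizing pair $(i,j)$ and sets $\pi=\frac{\beta B}{x}v(i\mid S_j)$ (with $\pi=+\infty$ if $x=0$). If $c_i\le\pi\le B_j$, it adds $i$ to $S_j$ and decreases $B_j$ by $\pi$. In either case it removes $i$ from $U$. At the end it returns a set of largest value among $S_1$, $S_2$, $\mathrm{ALG}_2(S_1,v)$, $\mathrm{ALG}_2(S_2,v)$. All ties are broken lexicographically. For every fixed outcome $\omega$ of the random choices (including those of $\mathrm{ALG}_1$),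 this is an outcome rule $f_\omega$, and the payments are the threshold payments: an agent $i\in f_\omega(\mathbf b)$ receives $\sup\{t\ge b_i: i\in f_\omega(t,\mathbf b_{-i})\}$, and all other agents receive $0$. **Theorem.** There is an absolute constant $\varepsilon>0$ such that for all $\mathrm{ALG}_1$ (with this $\varepsilon$) and $\mathrm{ALG}_2$ as above, the following hold. 1. For every $n$, $v$ and $B$ as above, GenSm-Main is universally truthful: for every $\omega$, reporting the true cost is a dominant strategy for every agent in the deterministic mechanism. It is individually rational: for every $\omega$ and every vector of declared costs, all payments are non-negative and each selected agent is paid at least the declared cost. It is budget-feasible: for every $\omega$ and every vector of declared costs, the payments sum to at most $B$. 2. For every cost vector $\mathbf c\ge 0$, the selected set $S$ satisfies $505\cdot\mathbb E[v(S)]\ge\mathrm{OPT}(A,B)$, where $A=[n]$. So GenSm-Main is an $O(1)$-approximation. 3. If $\mathrm{ALG}_1$ and $\mathrm{ALG}_2$ run in polynomial time in the value-query model, then so does GenSm-Main: on rational inputs, one program with a value oracle for $v$ computes the selected set and all payments, for every outcome of the random choices, in time polynomial in $n$ and in the bit lengths of $B$, of the costs and of the values of $v$. -/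

import Mathlib

namespace GenSm

noncomputable section

/-! ## Valuations and optimal values -/

/-- The marginal value `v(i | S) = v(S ∪ {i}) - v(S)`. -/
def marginal {n : ℕ} (v : Finset (Fin n) → ℚ) (S : Finset (Fin n)) (i : Fin n) : ℚ :=
  v (insert i S) - v S

/-- Non-negative, normalized, submodular (possibly non-monotone) valuations. -/
structure IsValuation {n : ℕ} (v : Finset (Fin n) → ℚ) : Prop where
  nonneg : ∀ S, 0 ≤ v S
  normalized : v ∅ = 0
  submodular : ∀ S T : Finset (Fin n), S ⊆ T → ∀ i, i ∉ T → marginal v T i ≤ marginal v S i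

/-- The optimal value over the subsets of `D` whose total cost is at most `B`. -/
def opt {n : ℕ} (D : Finset (Fin n)) (v : Finset (Fin n) → ℚ) (c : Fin n → ℝ) (B : ℝ) : ℝ :=
  sSup {y : ℝ | ∃ S : Finset (Fin n), S ⊆ D ∧ ∑ i ∈ S, c i ≤ B ∧ y = (v S : ℝ)}

/-- The optimal value over all the subsets of `D`, with no budget constraint. -/
def optUnconstrained {n : ℕ} (D : Finset (Fin n)) (v : Finset (Fin n) → ℚ) : ℝ :=
  sSup {y : ℝ | ∃ S : Finset (Fin n), S ⊆ D ∧ y = (v S : ℝ)}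

/-- The projection of a vector to the coordinates in `D` (the other coordinates become `0`). -/
def proj {n : ℕ} {K : Type*} [Zero K] (D : Finset (Fin n)) (c : Fin n → K) : Fin n → K :=
  fun i => if i ∈ D then c i else 0

/-! ## Mechanisms -/

/-- A deterministic mechanism: an outcome rule and a payment rule. -/
structure Mechanism (n : ℕ) where
  outcome : (Fin n → ℝ) → Finset (Fin n)
  payment : (Fin n → ℝ) → Fin n → ℝ

/-- The utility of agent `i` with true cost `t` when the declared costs are `b`; the cost is
incurred only by an agent who is selected. -/
def Mechanism.utility {n : ℕ} (M : Mechanism n) (i : Fin n) (t : ℝ) (b : Fin n → ℝ) : ℝ :=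
  M.payment b i - if i ∈ M.outcome b then t else 0

/-- Reporting the true cost is a dominant strategy for every agent. -/
def Mechanism.Truthful {n : ℕ} (M : Mechanism n) : Prop :=
  ∀ (i : Fin n) (t : ℝ) (b : Fin n → ℝ), 0 ≤ t → (∀ k, 0 ≤ b k) →
    M.utility i t b ≤ M.utility i t (Function.update b i t)

def Mechanism.IndividuallyRational {n : ℕ} (M : Mechanism n) : Prop :=
  ∀ b : Fin n → ℝ, (∀ k, 0 ≤ b k) →
    ∀ i, 0 ≤ M.payment b i ∧ (i ∈ M.outcome b → b i ≤ M.payment b i)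

def Mechanism.BudgetFeasible {n : ℕ} (M : Mechanism n) (B : ℝ) : Prop :=
  ∀ b : Fin n → ℝ, (∀ k, 0 ≤ b k) → ∑ i, M.payment b i ≤ B

/-- The threshold payments of an outcome rule `f`. -/
def thresholdPayment {n : ℕ} (f : (Fin n → ℝ) → Finset (Fin n)) (b : Fin n → ℝ) (i : Fin n) : ℝ :=
  if i ∈ f b then sSup {t : ℝ | b i ≤ t ∧ i ∈ f (Function.update b i t)} else 0

/-- A randomized mechanism: a deterministic mechanism for every value of a random seed, which is
drawn uniformly from `Ω`, independently of the declared costs. -/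
abbrev RandomizedMechanism (n : ℕ) (Ω : Type) := Ω → Mechanism n

/-- Universal truthfulness: a distribution over truthful deterministic mechanisms. -/
def RandomizedMechanism.UniversallyTruthful {n : ℕ} {Ω : Type} (M : RandomizedMechanism n Ω) :
    Prop :=
  ∀ ω, (M ω).Truthful

/-- The expected value of the selected set when the costs are `c`. -/
def RandomizedMechanism.expectedValue {n : ℕ} {Ω : Type} [Fintype Ω]
    (M : RandomizedMechanism n Ω) (v : Finset (Fin n) → ℚ) (c : Fin n → ℝ) : ℝ :=
  (∑ ω, (v ((M ω).outcome c) : ℝ)) / Fintype.card Ω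

/-! ## The two auxiliary algorithms -/

/-- A randomized algorithm for submodular maximization under a knapsack constraint. On an instance
with `n` agents it uses `bits n` fair coin flips (none if it is deterministic), and
`run v D c B r` is the set that it returns on the instance `(D, v, c, B)` with coin flips `r`. -/
structure KnapsackAlg where
  bits : ℕ → ℕ
  run : {n : ℕ} → (Finset (Fin n) → ℚ) → Finset (Fin n) → (Fin n → ℝ) → ℝ →
    (Fin (bits n) → Bool) → Finset (Fin n)

/-- The algorithm always returns a feasible set, and with probability at least `1 - ε` its value is
at least `1/e - ε` times the optimum. A deterministic `e`-approximation algorithm satisfies this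
for every `ε ≥ 0`. -/
def KnapsackAlg.IsApprox (alg : KnapsackAlg) (ε : ℝ) : Prop :=
  ∀ (n : ℕ) (v : Finset (Fin n) → ℚ) (D : Finset (Fin n)) (c : Fin n → ℝ) (B : ℝ),
    IsValuation v → (∀ i, 0 ≤ c i) → 0 < B →
      (∀ r, alg.run v D c B r ⊆ D ∧ ∑ i ∈ alg.run v D c B r, c i ≤ B) ∧
      (1 - ε) * Fintype.card (Fin (alg.bits n) → Bool) ≤
        (Nat.card {r // (1 / Real.exp 1 - ε) * opt D v c B ≤ (v (alg.run v D c B r) : ℝ)} : ℝ)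

/-- A deterministic algorithm for unconstrained submodular maximization: `run v D` is the set that it
returns on the instance `(D, v)`. -/
structure UnconstrainedAlg where
  run : {n : ℕ} → (Finset (Fin n) → ℚ) → Finset (Fin n) → Finset (Fin n)

/-- The algorithm is a `2`-approximation. -/
def UnconstrainedAlg.IsTwoApprox (alg : UnconstrainedAlg) : Prop :=
  ∀ (n : ℕ) (v : Finset (Fin n) → ℚ) (D : Finset (Fin n)), IsValuation v →
    alg.run v D ⊆ D ∧ optUnconstrained D v ≤ 2 * (v (alg.run v D) : ℝ)

/-! ## The mechanism -/

/-- The constant `β`. -/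
def beta : ℝ := 9.185

/-- The state of the simultaneous greedy algorithm: the two solutions, their remaining budgets and
the agents that have not been examined yet. -/
structure GreedyState (n : ℕ) where
  sol : Fin 2 → Finset (Fin n)
  budget : Fin 2 → ℝ
  rest : Finset (Fin n)

/-- The pairs (agent of `U`, index of a solution), in lexicographic order. -/
def candidates {n : ℕ} (U : Finset (Fin n)) : List (Fin n × Fin 2) :=
  ((List.finRange n).filter (· ∈ U)) ×ˢ [0, 1]

open Classical in
/-- One iteration of the loop; the state does not change once no candidate pair has a positive
marginal value. `List.argmax` returns the first maximizer in the list, so that ties are broken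
lexicographically. The price `β B v(i | S_j) / x` is infinite when `x = 0`: then everybody is
rejected. -/
def greedyStep {n : ℕ} (v : Finset (Fin n) → ℚ) (c : Fin n → ℝ) (B x : ℝ) (s : GreedyState n) :
    GreedyState n :=
  match (candidates s.rest).argmax (fun q => marginal v (s.sol q.2) q.1) with
  | none => s
  | some (i, j) =>
    let m : ℚ := marginal v (s.sol j) i
    let price : ℝ := beta * B / x * m
    if 0 < m then
      if 0 < x ∧ c i ≤ price ∧ price ≤ s.budget j then
        { sol := Function.update s.sol j (insert i (s.sol j))
          budget := Function.update s.budget j (s.budget j - price)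
          rest := s.rest.erase i }
      else { s with rest := s.rest.erase i }
    else s

/-- Simultaneous Greedy. Every iteration of the loop removes an agent from the set of unexamined
agents, so the loop ends after at most `D.card` iterations. -/
def simultaneousGreedy {n : ℕ} (alg₂ : UnconstrainedAlg) (D : Finset (Fin n))
    (v : Finset (Fin n) → ℚ) (c : Fin n → ℝ) (B x : ℝ) : Finset (Fin n) :=
  let s := (greedyStep v c B x)^[D.card] { sol := fun _ => ∅, budget := fun _ => B, rest := D }
  (List.argmax v [s.sol 0, s.sol 1, alg₂.run v (s.sol 0), alg₂.run v (s.sol 1)]).getD ∅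

/-- The random seed: a uniform number among 1000 (it is below 201 with probability `p = 0.201`), a
uniform set of agents (every agent is in it independently with probability `1/2`), and `m` fair coin
flips for the knapsack algorithm. -/
abbrev Seed (n m : ℕ) := Fin 1000 × Finset (Fin n) × (Fin m → Bool)

open Classical in
/-- The outcome rule of GenSm-Main for a fixed seed, including the preprocessing that removes the
agents whose declared cost exceeds `B`. -/
def genSmOutcome {n : ℕ} (alg₁ : KnapsackAlg) (alg₂ : UnconstrainedAlg) (v : Finset (Fin n) → ℚ)
    (B : ℝ) (ω : Seed n (alg₁.bits n)) (b : Fin n → ℝ) : Finset (Fin n) :=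
  let A : Finset (Fin n) := Finset.univ.filter (fun i => b i ≤ B)
  if ω.1.val < 201 then
    match ((List.finRange n).filter (· ∈ A)).argmax (fun i => v {i}) with
    | none => ∅
    | some i => {i}
  else
    let A₁ := A ∩ ω.2.1
    let A₂ := A \ ω.2.1
    let x : ℚ := v (alg₁.run v A₁ (proj A₁ b) B ω.2.2)
    simultaneousGreedy alg₂ A₂ v (proj A₂ b) B x

/-- The randomized mechanism GenSm-Main, with threshold payments for every seed. -/
def genSmMain {n : ℕ} (alg₁ : KnapsackAlg) (alg₂ : UnconstrainedAlg) (v : Finset (Fin n) → ℚ)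
    (B : ℝ) : RandomizedMechanism n (Seed n (alg₁.bits n)) :=
  fun ω =>
    { outcome := genSmOutcome alg₁ alg₂ v B ω
      payment := thresholdPayment (genSmOutcome alg₁ alg₂ v B ω) }

/-! ## The computational model

Programs act on a memory of arrays of rational numbers, have access to a value oracle, and are
charged the bit lengths of all the numbers that they handle. -/

/-- The number of bits of a rational number. -/
def bitSize (q : ℚ) : ℕ := Nat.size q.num.natAbs + Nat.size q.den

/-- `σ a k` is the entry with index `k` of the array with name `a`. -/
abbrev Memory := ℕ → ℕ → ℚ

def Memory.write (σ : Memory) (a k : ℕ) (q : ℚ) : Memory :=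
  Function.update σ a (Function.update (σ a) k q)

/-- Arithmetic expressions. In `get a e` the value of `e`, rounded down, is the index. -/
inductive Expr where
  | lit (q : ℚ)
  | numAgents
  | get (a : ℕ) (e : Expr)
  | plus (e₁ e₂ : Expr)
  | minus (e₁ e₂ : Expr)
  | times (e₁ e₂ : Expr)
  | quot (e₁ e₂ : Expr)

def Expr.eval (n : ℕ) (σ : Memory) : Expr → ℚ
  | lit q => q
  | numAgents => n
  | get a e => σ a ⌊e.eval n σ⌋₊
  | plus e₁ e₂ => e₁.eval n σ + e₂.eval n σ
  | minus e₁ e₂ => e₁.eval n σ - e₂.eval n σ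
  | times e₁ e₂ => e₁.eval n σ * e₂.eval n σ
  | quot e₁ e₂ => e₁.eval n σ / e₂.eval n σ

/-- The cost of evaluating an expression: one unit and the bit length of the value for every
subexpression. -/
def Expr.cost (n : ℕ) (σ : Memory) : Expr → ℕ
  | lit q => 1 + bitSize q
  | numAgents => 1 + bitSize n
  | get a e => 1 + bitSize ((get a e).eval n σ) + e.cost n σ
  | plus e₁ e₂ => 1 + bitSize ((plus e₁ e₂).eval n σ) + e₁.cost n σ + e₂.cost n σ
  | minus e₁ e₂ => 1 + bitSize ((minus e₁ e₂).eval n σ) + e₁.cost n σ + e₂.cost n σ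
  | times e₁ e₂ => 1 + bitSize ((times e₁ e₂).eval n σ) + e₁.cost n σ + e₂.cost n σ
  | quot e₁ e₂ => 1 + bitSize ((quot e₁ e₂).eval n σ) + e₁.cost n σ + e₂.cost n σ

/-- Programs.
* `assign a k e` writes the value of `e` to the entry `k` of the array `a`;
* `query a k s` asks the value oracle for the value of the set stored in the array `s` and writes
  the answer to the entry `k` of the array `a`;
* `branch e₁ e₂ P Q` runs `P` if `e₁ ≤ e₂`, and `Q` otherwise;
* `loop e₁ e₂ P` repeats `P` as long as `e₁ ≤ e₂`;
* `call P args out` runs the subroutine `P` in a memory of its own, whose first arrays are the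
  caller's arrays listed in `args` and which is zero otherwise, and stores the array `0` of the
  subroutine as the caller's array `out`; the other arrays of the caller do not change (arrays are
  persistent, so that passing one takes constant time). -/
inductive Program where
  | skip
  | assign (a : ℕ) (k e : Expr)
  | query (a : ℕ) (k : Expr) (s : ℕ)
  | seq (P Q : Program)
  | branch (e₁ e₂ : Expr) (P Q : Program)
  | loop (e₁ e₂ : Expr) (P : Program)
  | call (P : Program) (args : List ℕ) (out : ℕ)

/-- The set of agents stored in an array: those with a nonzero entry. -/
def toSet (n : ℕ) (f : ℕ → ℚ) : Finset (Fin n) := Finset.univ.filter (fun i => f i ≠ 0)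

/-- The memory whose first arrays are those in the list `l`, and which is zero otherwise. -/
def memoryOf (l : List (ℕ → ℚ)) : Memory := fun a => l.getD a (fun _ => 0)

/-- `Exec v P σ σ' t`: with the value oracle `v`, the program `P` started in the memory `σ` halts in
the memory `σ'` after time `t`. -/
inductive Exec {n : ℕ} (v : Finset (Fin n) → ℚ) : Program → Memory → Memory → ℕ → Prop where
  | skip (σ : Memory) : Exec v .skip σ σ 1
  | assign (σ : Memory) (a : ℕ) (k e : Expr) :
      Exec v (.assign a k e) σ (σ.write a ⌊k.eval n σ⌋₊ (e.eval n σ)) (1 + k.cost n σ + e.cost n σ)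
  | query (σ : Memory) (a : ℕ) (k : Expr) (s : ℕ) :
      Exec v (.query a k s) σ (σ.write a ⌊k.eval n σ⌋₊ (v (toSet n (σ s))))
        (1 + k.cost n σ + n + bitSize (v (toSet n (σ s))))
  | seq {P Q : Program} {σ σ' σ'' : Memory} {t t' : ℕ} :
      Exec v P σ σ' t → Exec v Q σ' σ'' t' → Exec v (.seq P Q) σ σ'' (1 + t + t')
  | branchTrue {e₁ e₂ : Expr} {P Q : Program} {σ σ' : Memory} {t : ℕ} :
      e₁.eval n σ ≤ e₂.eval n σ → Exec v P σ σ' t →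
      Exec v (.branch e₁ e₂ P Q) σ σ' (1 + e₁.cost n σ + e₂.cost n σ + t)
  | branchFalse {e₁ e₂ : Expr} {P Q : Program} {σ σ' : Memory} {t : ℕ} :
      ¬ e₁.eval n σ ≤ e₂.eval n σ → Exec v Q σ σ' t →
      Exec v (.branch e₁ e₂ P Q) σ σ' (1 + e₁.cost n σ + e₂.cost n σ + t)
  | loopTrue {e₁ e₂ : Expr} {P : Program} {σ σ' σ'' : Memory} {t t' : ℕ} :
      e₁.eval n σ ≤ e₂.eval n σ → Exec v P σ σ' t → Exec v (.loop e₁ e₂ P) σ' σ'' t' →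
      Exec v (.loop e₁ e₂ P) σ σ'' (1 + e₁.cost n σ + e₂.cost n σ + t + t')
  | loopFalse {e₁ e₂ : Expr} {P : Program} {σ : Memory} :
      ¬ e₁.eval n σ ≤ e₂.eval n σ →
      Exec v (.loop e₁ e₂ P) σ σ (1 + e₁.cost n σ + e₂.cost n σ)
  | call {P : Program} {args : List ℕ} {out : ℕ} {σ σ' : Memory} {t : ℕ} :
      Exec v P (memoryOf (args.map σ)) σ' t →
      Exec v (.call P args out) σ (Function.update σ out (σ' 0)) (1 + args.length + t)

/-! ### Encoding of the inputs -/

/-- The array with the single entry `q`. -/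
def ofNumber (q : ℚ) : ℕ → ℚ := fun k => if k = 0 then q else 0

/-- The array with the entries of a vector. -/
def ofVector {n : ℕ} (c : Fin n → ℚ) : ℕ → ℚ := fun k => if h : k < n then c ⟨k, h⟩ else 0

/-- The array with the indicator vector of a set of agents. -/
def ofSet {n : ℕ} (S : Finset (Fin n)) : ℕ → ℚ := ofVector (fun i => if i ∈ S then 1 else 0)

/-- The array with a sequence of coin flips. -/
def ofBits {m : ℕ} (r : Fin m → Bool) : ℕ → ℚ := ofVector (fun i => if r i then 1 else 0)

/-- The largest bit length of a value of `v`. -/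
def valueSize {n : ℕ} (v : Finset (Fin n) → ℚ) : ℕ := Finset.univ.sup (fun S => bitSize (v S))

/-- The size of an instance: the number of agents and the bit lengths of the budget, of the costs
and of the answers of the value oracle. -/
def instanceSize {n : ℕ} (v : Finset (Fin n) → ℚ) (c : Fin n → ℚ) (B : ℚ) : ℕ :=
  n + bitSize B + ∑ i, bitSize (c i) + valueSize v

/-! ### Polynomial running time in the value query model -/

/-- One program implements the algorithm on all the rational instances, with all the coin flips, in
time polynomial in the size of the instance. -/
def KnapsackAlg.PolyTime (alg : KnapsackAlg) : Prop :=
  ∃ (P : Program) (p : Polynomial ℕ), ∀ (n : ℕ) (v : Finset (Fin n) → ℚ) (D : Finset (Fin n))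
    (c : Fin n → ℚ) (B : ℚ) (r : Fin (alg.bits n) → Bool),
    IsValuation v → (∀ i, 0 ≤ c i) → 0 < B →
      ∃ (σ : Memory) (t : ℕ),
        Exec v P (memoryOf [ofNumber B, ofVector c, ofSet D, ofBits r]) σ t ∧
        toSet n (σ 0) = alg.run v D (fun i => (c i : ℝ)) B r ∧
        t ≤ p.eval (instanceSize v c B)

/-- One program implements the algorithm in time polynomial in the number of agents and the bit
length of the values. -/
def UnconstrainedAlg.PolyTime (alg : UnconstrainedAlg) : Prop :=
  ∃ (P : Program) (p : Polynomial ℕ), ∀ (n : ℕ) (v : Finset (Fin n) → ℚ) (D : Finset (Fin n)),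
    IsValuation v →
      ∃ (σ : Memory) (t : ℕ),
        Exec v P (memoryOf [ofSet D]) σ t ∧ toSet n (σ 0) = alg.run v D ∧
        t ≤ p.eval (n + valueSize v)

/-- One program computes the outcome and all the payments of a family of randomized mechanisms, on
all the rational instances and for all the seeds, in time polynomial in the size of the
instance. -/
def MechanismPolyTime {bits : ℕ → ℕ}
    (M : (n : ℕ) → (Finset (Fin n) → ℚ) → ℝ → RandomizedMechanism n (Seed n (bits n))) : Prop :=
  ∃ (P : Program) (p : Polynomial ℕ), ∀ (n : ℕ) (v : Finset (Fin n) → ℚ) (b : Fin n → ℚ) (B : ℚ)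
    (ω : Seed n (bits n)),
    IsValuation v → (∀ i, 0 ≤ b i) → 0 < B →
      ∃ (σ : Memory) (t : ℕ),
        Exec v P (memoryOf
          [ofNumber B, ofVector b, ofNumber ω.1.val, ofSet ω.2.1, ofBits ω.2.2]) σ t ∧
        toSet n (σ 0) = (M n v B ω).outcome (fun i => (b i : ℝ)) ∧
        (∀ i : Fin n, (σ 1 i : ℝ) = (M n v B ω).payment (fun k => (b k : ℝ)) i) ∧
        t ≤ p.eval (instanceSize v b B)

end

end GenSm

/-! Incentives. Fix the seed. With the other declarations fixed, an agent either never wins or wins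
exactly up to a threshold. In the lottery the threshold is `B`. In the greedy branch the sample
value `x` is computed from agents that cannot win, and a run reads the cost of an agent only when
the agent is examined, in the comparison with the offered price; the later course of an accepting
run and the choice among the four sets ignore that cost. So the threshold of a winner is its
recorded price (`iterate_pricedStep_threshold`, `greedyRun_threshold`, `greedy_threshold`).
Truthfulness and individual rationality are then the usual consequences of threshold payments. The
prices in `S_j` add up to `B - B_j ≤ B`, and the output lies inside one `S_j`, which gives budget
feasibility.

Approximation. Let `V` be the optimum, attained by `S`, and `m` the largest value of an eligible
singleton. The lottery earns `m`. The set `S` splits into `T` and `S \ T`, each worth at least `(V -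
m) / 2`; for every sample `R`, one of `R` and `R ∆ T` leaves at least `q = (V - m) / 4` on both
sides, so half of the samples are balanced (`IsValuation.card_balanced_samples`). On a balanced
sample, a successful run of `ALG₁` gives `(1/e - ε) q ≤ x ≤ V`. If Simultaneous Greedy refuses an
agent for lack of budget, some `S_j` is worth at least `x / β - m`. Otherwise, for a feasible set
`O` of remaining agents, the refused agents have marginals of total at most `x / β`, and the agents
that went to the other solution are charged to its value by the greedy order. Both `v (S_j ∪ O)` are
then at most `v S_1 + v S_2 + x / β`; since the solutions are disjoint, submodularity bounds `v O`
by their sum (`greedyRun_value`). Averaging over the seeds gives 505 (`expectedValue_ge`,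
`genSmMain_approximation`).

Running time. An explicit program is verified in a calculus of polynomial-time triples. The danger
is that numbers grow from iteration to iteration. It is avoided because the remaining budgets need
not be stored: `B_j = B - β B v(S_j) / x`, so the tests and the prices involve only inputs and
oracle answers (`accepts_iff`, `bitSize_price_le`), and every loop body preserves one fixed bound
(`PolyTriple.forLoop`). The payments are read off from the recorded prices of a single run. -/

namespace GenSm

open Function

/-! ## Simultaneous Greedy with recorded prices -/

section Greedy

variable {n : ℕ} {v : Finset (Fin n) → ℚ} {c : Fin n → ℝ} {B x : ℝ}

/-- The pair (agent, solution) that is examined next. -/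
def nextPair (v : Finset (Fin n) → ℚ) (s : GreedyState n) : Option (Fin n × Fin 2) :=
  (candidates s.rest).argmax (fun q => marginal v (s.sol q.2) q.1)

theorem mem_candidates {U : Finset (Fin n)} {q : Fin n × Fin 2} :
    q ∈ candidates U ↔ q.1 ∈ U := by
  have hj : ∀ j : Fin 2, j = 0 ∨ j = 1 := by decide
  have h1 : q ∈ candidates U ↔ ∃ a ∈ U, q.1 = a ∧ q.2 = 0 ∨ q.1 = a ∧ q.2 = 1 := by
    simp [candidates, SProd.sprod, List.product, Prod.ext_iff]
  rw [h1]
  constructor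
  · rintro ⟨a, ha, ⟨h, -⟩ | ⟨h, -⟩⟩ <;> rwa [h]
  · exact fun h => ⟨q.1, h, (hj q.2).imp (fun h => ⟨rfl, h⟩) fun h => ⟨rfl, h⟩⟩

theorem nextPair_mem {s : GreedyState n} {i : Fin n} {j : Fin 2} (h : nextPair v s = some (i, j)) :
    i ∈ s.rest :=
  mem_candidates.1 (List.argmax_mem (Option.mem_def.2 h))

theorem nextPair_max {s : GreedyState n} {i : Fin n} {j : Fin 2} (h : nextPair v s = some (i, j))
    {i' : Fin n} (hi' : i' ∈ s.rest) (j' : Fin 2) :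
    marginal v (s.sol j') i' ≤ marginal v (s.sol j) i := by
  have hmem : (i', j') ∈ candidates s.rest := mem_candidates.2 hi'
  have hmax : (i, j) ∈
      (candidates s.rest).argmax (fun q => marginal v (s.sol q.2) q.1) := h
  generalize candidates s.rest = l at hmem hmax
  simpa only using List.le_of_mem_argmax hmem hmax

theorem nextPair_none {s : GreedyState n} (h : nextPair v s = none) : s.rest = ∅ := by
  rw [nextPair, List.argmax_eq_none] at h
  refine Finset.eq_empty_of_forall_notMem fun i hi => ?_
  have : (i, (0 : Fin 2)) ∈ candidates s.rest := mem_candidates.2 hi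
  simp [h] at this

/-- The price that is offered to agent `i` for joining the solution `j`. -/
noncomputable def offer (v : Finset (Fin n) → ℚ) (B x : ℝ) (s : GreedyState n) (i : Fin n)
    (j : Fin 2) : ℝ :=
  beta * B / x * marginal v (s.sol j) i

/-- The pair `(i, j)` passes the tests of Simultaneous Greedy. -/
def Accepts (v : Finset (Fin n) → ℚ) (c : Fin n → ℝ) (B x : ℝ) (s : GreedyState n) (i : Fin n)
    (j : Fin 2) : Prop :=
  0 < x ∧ c i ≤ offer v B x s i j ∧ offer v B x s i j ≤ s.budget j

/-- The state after agent `i` has joined the solution `j`. -/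
noncomputable def acceptState (v : Finset (Fin n) → ℚ) (B x : ℝ) (s : GreedyState n) (i : Fin n)
    (j : Fin 2) : GreedyState n where
  sol := update s.sol j (insert i (s.sol j))
  budget := update s.budget j (s.budget j - offer v B x s i j)
  rest := s.rest.erase i

open Classical in
/-- One iteration of the loop, together with the prices of the accepted agents. -/
noncomputable def pricedStep (v : Finset (Fin n) → ℚ) (c : Fin n → ℝ) (B x : ℝ)
    (p : GreedyState n × (Fin n → ℝ)) : GreedyState n × (Fin n → ℝ) :=
  match nextPair v p.1 with
  | none => p
  | some (i, j) =>
    if 0 < marginal v (p.1.sol j) i then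
      if Accepts v c B x p.1 i j then
        (acceptState v B x p.1 i j, update p.2 i (offer v B x p.1 i j))
      else ({ p.1 with rest := p.1.rest.erase i }, p.2)
    else p

theorem pricedStep_none {p : GreedyState n × (Fin n → ℝ)} (h : nextPair v p.1 = none) :
    pricedStep v c B x p = p := by
  simp [pricedStep, h]

theorem pricedStep_nonpos {p : GreedyState n × (Fin n → ℝ)} {i : Fin n} {j : Fin 2}
    (h : nextPair v p.1 = some (i, j)) (hm : ¬ 0 < marginal v (p.1.sol j) i) :
    pricedStep v c B x p = p := by
  simp [pricedStep, h, hm]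

theorem pricedStep_accept {p : GreedyState n × (Fin n → ℝ)} {i : Fin n} {j : Fin 2}
    (h : nextPair v p.1 = some (i, j)) (hm : 0 < marginal v (p.1.sol j) i)
    (ha : Accepts v c B x p.1 i j) :
    pricedStep v c B x p = (acceptState v B x p.1 i j, update p.2 i (offer v B x p.1 i j)) := by
  simp [pricedStep, h, hm, ha]

theorem pricedStep_reject {p : GreedyState n × (Fin n → ℝ)} {i : Fin n} {j : Fin 2}
    (h : nextPair v p.1 = some (i, j)) (hm : 0 < marginal v (p.1.sol j) i)
    (ha : ¬ Accepts v c B x p.1 i j) :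
    pricedStep v c B x p = ({ p.1 with rest := p.1.rest.erase i }, p.2) := by
  simp [pricedStep, h, hm, ha]

/-- No step reads the recorded prices, so forgetting them gives back the run in the definition of
the mechanism. They are carried along because they turn out to be the threshold payments. -/
theorem pricedStep_fst (p : GreedyState n × (Fin n → ℝ)) :
    (pricedStep v c B x p).1 = greedyStep v c B x p.1 := by
  rcases h : nextPair v p.1 with _ | ⟨i, j⟩
  · rw [pricedStep_none h]
    simp only [nextPair] at h
    simp only [greedyStep, h]
  · have h' := h
    simp only [nextPair] at h'
    simp only [greedyStep, h']
    by_cases hm : 0 < marginal v (p.1.sol j) i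
    · by_cases ha : Accepts v c B x p.1 i j
      · rw [pricedStep_accept h hm ha, if_pos hm]
        exact (if_pos ha).symm
      · rw [pricedStep_reject h hm ha, if_pos hm]
        exact (if_neg ha).symm
    · rw [pricedStep_nonpos h hm, if_neg hm]

theorem iterate_pricedStep_fst (k : ℕ) (p : GreedyState n × (Fin n → ℝ)) :
    ((pricedStep v c B x)^[k] p).1 = (greedyStep v c B x)^[k] p.1 :=
  Semiconj.iterate_right (f := Prod.fst) (fun p => pricedStep_fst p) k p

/-- The choice of the pair depends on values only, so a step reads the costs at the examined agent
and nowhere else. Truthfulness rests on this. -/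
theorem pricedStep_congr {c' : Fin n → ℝ} {p : GreedyState n × (Fin n → ℝ)}
    (hc : ∀ i j, nextPair v p.1 = some (i, j) → c i = c' i) :
    pricedStep v c B x p = pricedStep v c' B x p := by
  rcases h : nextPair v p.1 with _ | ⟨i, j⟩
  · rw [pricedStep_none h, pricedStep_none h]
  · have hacc : Accepts v c B x p.1 i j ↔ Accepts v c' B x p.1 i j := by
      rw [Accepts, Accepts, hc i j h]
    by_cases hm : 0 < marginal v (p.1.sol j) i
    · by_cases ha : Accepts v c B x p.1 i j
      · rw [pricedStep_accept h hm ha, pricedStep_accept h hm (hacc.1 ha)]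
      · rw [pricedStep_reject h hm ha, pricedStep_reject h hm (mt hacc.2 ha)]
    · rw [pricedStep_nonpos h hm, pricedStep_nonpos h hm]

/-- Case analysis for one iteration. -/
theorem pricedStep_induction {motive : GreedyState n × (Fin n → ℝ) → Prop}
    (p : GreedyState n × (Fin n → ℝ))
    (stuck : (∀ i ∈ p.1.rest, ∀ j, marginal v (p.1.sol j) i ≤ 0) → motive p)
    (accept : ∀ i j, nextPair v p.1 = some (i, j) → 0 < marginal v (p.1.sol j) i →
      Accepts v c B x p.1 i j →
      motive (acceptState v B x p.1 i j, update p.2 i (offer v B x p.1 i j)))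
    (reject : ∀ i j, nextPair v p.1 = some (i, j) → 0 < marginal v (p.1.sol j) i →
      ¬ Accepts v c B x p.1 i j → motive ({ p.1 with rest := p.1.rest.erase i }, p.2)) :
    motive (pricedStep v c B x p) := by
  rcases h : nextPair v p.1 with _ | ⟨i, j⟩
  · rw [pricedStep_none h]
    exact stuck (by simp [nextPair_none h])
  · by_cases hm : 0 < marginal v (p.1.sol j) i
    · by_cases ha : Accepts v c B x p.1 i j
      · rw [pricedStep_accept h hm ha]
        exact accept i j h hm ha
      · rw [pricedStep_reject h hm ha]
        exact reject i j h hm ha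
    · rw [pricedStep_nonpos h hm]
      exact stuck fun i' hi' j' => (nextPair_max h hi' j').trans (not_lt.1 hm)

theorem mem_update_insert {S : Fin 2 → Finset (Fin n)} {i i' : Fin n} {j j' : Fin 2} (h : i ≠ i') :
    i ∈ update S j (insert i' (S j)) j' ↔ i ∈ S j' := by
  rcases eq_or_ne j' j with rfl | hj
  · simp [h]
  · simp [hj]

/-- An agent that is not examined by an iteration keeps its status and its price. -/
theorem pricedStep_notMem_rest {p : GreedyState n × (Fin n → ℝ)} {i : Fin n} (hi : i ∉ p.1.rest) :
    i ∉ (pricedStep v c B x p).1.rest ∧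
      (∀ j, i ∈ (pricedStep v c B x p).1.sol j ↔ i ∈ p.1.sol j) ∧
      (pricedStep v c B x p).2 i = p.2 i := by
  refine pricedStep_induction (v := v) (c := c) (B := B) (x := x) (motive := fun q =>
    i ∉ q.1.rest ∧ (∀ j, i ∈ q.1.sol j ↔ i ∈ p.1.sol j) ∧ q.2 i = p.2 i) p ?_ ?_ ?_
  · exact fun _ => ⟨hi, fun _ => Iff.rfl, rfl⟩
  · intro i' j h hm ha
    have hne : i ≠ i' := by rintro rfl; exact hi (nextPair_mem h)
    exact ⟨fun h' => hi (Finset.mem_of_mem_erase h'), fun j' => mem_update_insert hne,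
      update_of_ne hne _ _⟩
  · intro i' j h hm ha
    exact ⟨fun h' => hi (Finset.mem_of_mem_erase h'), fun _ => Iff.rfl, rfl⟩

/-- The declared cost of an agent that has been examined is irrelevant. -/
theorem pricedStep_update_of_notMem_rest {p : GreedyState n × (Fin n → ℝ)} {i : Fin n}
    (hi : i ∉ p.1.rest) (t : ℝ) :
    pricedStep v (update c i t) B x p = pricedStep v c B x p := by
  refine pricedStep_congr fun i' j h => ?_
  have hne : i' ≠ i := by rintro rfl; exact hi (nextPair_mem h)
  exact update_of_ne hne _ _

theorem iterate_pricedStep_notMem_rest (k : ℕ) {p : GreedyState n × (Fin n → ℝ)} {i : Fin n}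
    (hi : i ∉ p.1.rest) :
    i ∉ ((pricedStep v c B x)^[k] p).1.rest ∧
      (∀ j, i ∈ ((pricedStep v c B x)^[k] p).1.sol j ↔ i ∈ p.1.sol j) ∧
      ((pricedStep v c B x)^[k] p).2 i = p.2 i := by
  induction k generalizing p with
  | zero => exact ⟨hi, fun _ => Iff.rfl, rfl⟩
  | succ k ih =>
    obtain ⟨h1, h2, h3⟩ := pricedStep_notMem_rest (v := v) (c := c) (B := B) (x := x) hi
    obtain ⟨h1', h2', h3'⟩ := ih h1
    rw [iterate_succ_apply]
    exact ⟨h1', fun j => (h2' j).trans (h2 j), h3'.trans h3⟩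

theorem iterate_pricedStep_update_of_notMem_rest (k : ℕ) {p : GreedyState n × (Fin n → ℝ)}
    {i : Fin n} (hi : i ∉ p.1.rest) (t : ℝ) :
    (pricedStep v (update c i t) B x)^[k] p = (pricedStep v c B x)^[k] p := by
  induction k generalizing p with
  | zero => rfl
  | succ k ih =>
    rw [iterate_succ_apply, iterate_succ_apply, pricedStep_update_of_notMem_rest hi]
    exact ih (pricedStep_notMem_rest hi).1

/-- Either agent `i` is never selected, or there is a threshold such that the run does not depend on
the declared cost of `i` as long as that is at most the threshold, and `i` is not selected if it
is larger. The threshold is the recorded price. -/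
theorem iterate_pricedStep_threshold (k : ℕ) {p : GreedyState n × (Fin n → ℝ)} {i : Fin n}
    (hi : i ∈ p.1.rest) (hsol : ∀ j, i ∉ p.1.sol j) :
    (∀ t j, i ∉ ((pricedStep v (update c i t) B x)^[k] p).1.sol j) ∨
      ∃ F : GreedyState n × (Fin n → ℝ),
        (∀ t ≤ F.2 i, (pricedStep v (update c i t) B x)^[k] p = F) ∧
        ∀ t, F.2 i < t → ∀ j, i ∉ ((pricedStep v (update c i t) B x)^[k] p).1.sol j := by
  induction k generalizing p with
  | zero => exact Or.inl fun _ => hsol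
  | succ k ih =>
    simp only [iterate_succ_apply]
    rcases h : nextPair v p.1 with _ | ⟨i', j⟩
    · simp only [pricedStep_none h]
      exact ih hi hsol
    by_cases hm : 0 < marginal v (p.1.sol j) i'
    swap
    · simp only [pricedStep_nonpos h hm]
      exact ih hi hsol
    -- Until `i` is examined the run does not see `t`; when it is examined, one comparison of `t`
    -- with the offer decides; afterwards its cost is never read again.
    rcases eq_or_ne i' i with rfl | hne
    · have hrej : ∀ t, ¬ Accepts v (update c i' t) B x p.1 i' j → ∀ j',
          i' ∉ ((pricedStep v (update c i' t) B x)^[k]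
            (pricedStep v (update c i' t) B x p)).1.sol j' := by
        intro t ht j'
        rw [pricedStep_reject h hm ht,
          (iterate_pricedStep_notMem_rest k (by simp)).2.1]
        exact hsol j'
      -- These are the tests that do not involve the cost. If one of them fails, `i` is refused
      -- whatever it declares.
      by_cases hother : 0 < x ∧ offer v B x p.1 i' j ≤ p.1.budget j
      · right
        set q : GreedyState n × (Fin n → ℝ) :=
          (acceptState v B x p.1 i' j, update p.2 i' (offer v B x p.1 i' j)) with hq
        have hq' : i' ∉ q.1.rest := by simp [hq, acceptState]
        have hprice : ((pricedStep v c B x)^[k] q).2 i' = offer v B x p.1 i' j := by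
          rw [(iterate_pricedStep_notMem_rest k hq').2.2, hq]
          simp
        -- Continuing with the original `c` is legitimate: `i` has left `rest`, so its coordinate of
        -- the cost vector no longer matters.
        refine ⟨(pricedStep v c B x)^[k] q, fun t ht => ?_, fun t ht j' => ?_⟩
        · rw [hprice] at ht
          rw [pricedStep_accept h hm ⟨hother.1, by simpa using ht, hother.2⟩,
            iterate_pricedStep_update_of_notMem_rest k hq']
        · rw [hprice] at ht
          refine hrej t (fun ha => ?_) j'
          have := ha.2.1
          rw [update_self] at this
          exact absurd this (not_le.2 ht)
      · left
        exact fun t => hrej t fun ha => hother ⟨ha.1, ha.2.2⟩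
    · have hstep : ∀ t, pricedStep v (update c i t) B x p = pricedStep v c B x p := by
        refine fun t => pricedStep_congr fun i'' j' h'' => ?_
        obtain ⟨rfl, -⟩ := Prod.mk.inj (Option.some.inj (h.symm.trans h''))
        exact update_of_ne hne _ _
      simp only [hstep]
      by_cases ha : Accepts v c B x p.1 i' j
      · rw [pricedStep_accept h hm ha]
        refine ih ?_ fun j' => ?_
        · simp [acceptState, hi, hne.symm]
        · have := hsol j'
          simpa only [acceptState, mem_update_insert hne.symm] using this
      · rw [pricedStep_reject h hm ha]
        exact ih (by simp [hi, hne.symm]) hsol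

end Greedy

/-! ## The budget -/

section Budget

variable {n : ℕ} {v : Finset (Fin n) → ℚ} {c : Fin n → ℝ} {B x : ℝ} {D : Finset (Fin n)}

/-- The initial state, with all the prices `0`. -/
def greedyInit (D : Finset (Fin n)) (B : ℝ) : GreedyState n × (Fin n → ℝ) :=
  ({ sol := fun _ => ∅, budget := fun _ => B, rest := D }, fun _ => 0)

/-- Bookkeeping properties of the states of Simultaneous Greedy. -/
structure BudgetInvariant (v : Finset (Fin n) → ℚ) (B x : ℝ) (D : Finset (Fin n))
    (p : GreedyState n × (Fin n → ℝ)) : Prop where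
  rest_subset : p.1.rest ⊆ D
  sol_subset : ∀ j, p.1.sol j ⊆ D
  disjoint_rest : ∀ j, Disjoint (p.1.sol j) p.1.rest
  disjoint_sol : ∀ j j', j ≠ j' → Disjoint (p.1.sol j) (p.1.sol j')
  sum_prices : ∀ j, ∑ i ∈ p.1.sol j, p.2 i = B - p.1.budget j
  budget_nonneg : ∀ j, 0 ≤ p.1.budget j
  budget_eq : ∀ j, p.1.budget j = B - beta * B / x * v (p.1.sol j)
  price_nonneg : ∀ i, 0 ≤ p.2 i

theorem beta_pos : 0 < beta := by norm_num [beta]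

theorem budgetInvariant_init (hv : IsValuation v) (hB : 0 < B) :
    BudgetInvariant v B x D (greedyInit D B) where
  rest_subset := subset_rfl
  sol_subset _ := by simp [greedyInit]
  disjoint_rest _ := by simp [greedyInit]
  disjoint_sol _ _ _ := by simp [greedyInit]
  sum_prices _ := by simp [greedyInit]
  budget_nonneg _ := hB.le
  budget_eq _ := by simp [greedyInit, hv.normalized]
  price_nonneg _ := le_rfl

theorem BudgetInvariant.step {p : GreedyState n × (Fin n → ℝ)} (hB : 0 < B)
    (hp : BudgetInvariant v B x D p) : BudgetInvariant v B x D (pricedStep v c B x p) := by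
  refine pricedStep_induction (motive := BudgetInvariant v B x D) p (fun _ => hp) ?_ ?_
  · intro i j h hm ha
    have hi := nextPair_mem h
    have hnot : ∀ j', i ∉ p.1.sol j' := fun j' hj' =>
      Finset.disjoint_left.1 (hp.disjoint_rest j') hj' hi
    have hoff : 0 ≤ offer v B x p.1 i j := by
      have := beta_pos
      have := ha.1
      have : (0 : ℝ) < marginal v (p.1.sol j) i := by exact_mod_cast hm
      unfold offer
      positivity
    constructor
    · exact (Finset.erase_subset _ _).trans hp.rest_subset
    · intro j'
      rcases eq_or_ne j' j with rfl | hj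
      · simpa [acceptState] using Finset.insert_subset (hp.rest_subset hi) (hp.sol_subset j')
      · simpa [acceptState, hj] using hp.sol_subset j'
    · intro j'
      rw [Finset.disjoint_left]
      intro a ha' har
      have har' := Finset.mem_erase.1 har
      rw [acceptState, mem_update_insert har'.1] at ha'
      exact Finset.disjoint_left.1 (hp.disjoint_rest j') ha' har'.2
    · intro j₁ j₂ hj
      simp only [acceptState]
      have h0 := hp.disjoint_sol j₁ j₂ hj
      rcases eq_or_ne j₁ j with rfl | h1
      · simp [hj.symm, h0, hnot j₂]
      · rcases eq_or_ne j₂ j with rfl | h2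
        · simp [hj, h0, hnot j₁]
        · simpa [h1, h2] using h0
    · intro j'
      have hsum : ∀ S : Finset (Fin n), i ∉ S →
          ∑ k ∈ S, update p.2 i (offer v B x p.1 i j) k = ∑ k ∈ S, p.2 k := by
        intro S hS
        refine Finset.sum_congr rfl fun k hk => update_of_ne ?_ _ _
        rintro rfl
        exact hS hk
      rcases eq_or_ne j' j with rfl | hj
      · simp only [acceptState, update_self]
        rw [Finset.sum_insert (hnot j'), hsum _ (hnot j'), hp.sum_prices, update_self]
        ring
      · simp only [acceptState, update_of_ne hj]
        rw [hsum _ (hnot j'), hp.sum_prices]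
    · intro j'
      rcases eq_or_ne j' j with rfl | hj
      · simpa [acceptState] using ha.2.2
      · simpa [acceptState, hj] using hp.budget_nonneg j'
    · intro j'
      rcases eq_or_ne j' j with rfl | hj
      -- Prices are a fixed multiple of the marginal values, and these telescope to `v (S_j)`.
      · simp only [acceptState, update_self, hp.budget_eq, offer, marginal]
        push_cast
        ring
      · simpa [acceptState, hj] using hp.budget_eq j'
    · intro k
      rcases eq_or_ne k i with rfl | hk
      · simpa using hoff
      · simpa [hk] using hp.price_nonneg k
  · intro i j h hm ha
    exact ⟨(Finset.erase_subset _ _).trans hp.rest_subset, hp.sol_subset,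
      fun j => (hp.disjoint_rest j).mono_right (Finset.erase_subset _ _), hp.disjoint_sol,
      hp.sum_prices, hp.budget_nonneg, hp.budget_eq, hp.price_nonneg⟩

theorem BudgetInvariant.iterate (hv : IsValuation v) (hB : 0 < B) (k : ℕ) :
    BudgetInvariant v B x D ((pricedStep v c B x)^[k] (greedyInit D B)) := by
  induction k with
  | zero => exact budgetInvariant_init hv hB
  | succ k ih =>
    rw [iterate_succ_apply']
    exact ih.step hB

/-- The final state of Simultaneous Greedy, with the prices. -/
noncomputable def greedyRun (D : Finset (Fin n)) (v : Finset (Fin n) → ℚ) (c : Fin n → ℝ)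
    (B x : ℝ) : GreedyState n × (Fin n → ℝ) :=
  (pricedStep v c B x)^[D.card] (greedyInit D B)

/-- The final choice among the four sets. -/
def bestOfFour (alg₂ : UnconstrainedAlg) (v : Finset (Fin n) → ℚ)
    (S : Fin 2 → Finset (Fin n)) : Finset (Fin n) :=
  (List.argmax v [S 0, S 1, alg₂.run v (S 0), alg₂.run v (S 1)]).getD ∅

theorem simultaneousGreedy_eq (alg₂ : UnconstrainedAlg) :
    simultaneousGreedy alg₂ D v c B x = bestOfFour alg₂ v (greedyRun D v c B x).1.sol := by
  rw [simultaneousGreedy, greedyRun, iterate_pricedStep_fst]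
  rfl

theorem bestOfFour_argmax (alg₂ : UnconstrainedAlg) (S : Fin 2 → Finset (Fin n)) :
    bestOfFour alg₂ v S ∈ List.argmax v [S 0, S 1, alg₂.run v (S 0), alg₂.run v (S 1)] := by
  rcases h : List.argmax v [S 0, S 1, alg₂.run v (S 0), alg₂.run v (S 1)] with _ | T
  · simp [List.argmax_eq_none] at h
  · simp [bestOfFour, h]

/-- The last selection can only drop agents from a solution. Hence a refused agent stays out, and
the bound for the prices of a solution passes to the output. -/
theorem bestOfFour_subset {alg₂ : UnconstrainedAlg} (h₂ : alg₂.IsTwoApprox) (hv : IsValuation v)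
    (S : Fin 2 → Finset (Fin n)) : ∃ j, bestOfFour alg₂ v S ⊆ S j := by
  have h := List.argmax_mem (bestOfFour_argmax (v := v) alg₂ S)
  simp only [List.mem_cons, List.not_mem_nil, or_false] at h
  rcases h with h | h | h | h
  · exact ⟨0, h.le⟩
  · exact ⟨1, h.le⟩
  · exact ⟨0, h.trans_le (h₂ n v (S 0) hv).1⟩
  · exact ⟨1, h.trans_le (h₂ n v (S 1) hv).1⟩

theorem le_bestOfFour (alg₂ : UnconstrainedAlg) (S : Fin 2 → Finset (Fin n)) (j : Fin 2) :
    v (S j) ≤ v (bestOfFour alg₂ v S) := by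
  refine List.le_of_mem_argmax (f := v) ?_ (bestOfFour_argmax alg₂ S)
  fin_cases j <;> simp

/-- Simultaneous Greedy has threshold prices. -/
theorem greedyRun_threshold {alg₂ : UnconstrainedAlg} (h₂ : alg₂.IsTwoApprox) (hv : IsValuation v)
    (hB : 0 < B) (c : Fin n → ℝ) (x : ℝ) {i : Fin n} (hi : i ∈ D) :
    (∀ t, i ∉ simultaneousGreedy alg₂ D v (update c i t) B x) ∨
      ∃ τ ≤ B, (∀ t, i ∈ simultaneousGreedy alg₂ D v (update c i t) B x ↔ t ≤ τ) ∧
        ∀ t ≤ τ, (greedyRun D v (update c i t) B x).2 i = τ := by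
  rcases iterate_pricedStep_threshold (v := v) (c := c) (B := B) (x := x) D.card
    (p := greedyInit D B) hi (by simp [greedyInit]) with h | ⟨F, hF, hF'⟩
  · left
    intro t ht
    rw [simultaneousGreedy_eq] at ht
    obtain ⟨j, hj⟩ := bestOfFour_subset h₂ hv (greedyRun D v (update c i t) B x).1.sol
    exact h t j (hj ht)
  · have hnot : ∀ t, F.2 i < t → i ∉ simultaneousGreedy alg₂ D v (update c i t) B x := by
      intro t ht hmem
      rw [simultaneousGreedy_eq] at hmem
      obtain ⟨j, hj⟩ := bestOfFour_subset h₂ hv (greedyRun D v (update c i t) B x).1.sol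
      exact hF' t ht j (hj hmem)
    have hF2 : ∀ t ≤ F.2 i, greedyRun D v (update c i t) B x = F := hF
    by_cases hmem : i ∈ bestOfFour alg₂ v F.1.sol
    · right
      -- For the declaration `F.2 i` the run ends in `F`, so `F` is reachable and satisfies the
      -- invariant.
      have hinv : BudgetInvariant v B x D F := by
        rw [← hF2 _ le_rfl]
        exact BudgetInvariant.iterate hv hB _
      refine ⟨F.2 i, ?_, fun t => ⟨fun h => ?_, fun h => ?_⟩, fun t ht => by rw [hF2 t ht]⟩
      -- One price is at most the sum over its solution, which is `B` minus a nonnegative rest. So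
      -- the threshold is at most `B`, and the preliminary removal of expensive agents does not
      -- interfere with it.
      · obtain ⟨j, hj⟩ := bestOfFour_subset h₂ hv F.1.sol
        have h1 := Finset.single_le_sum (fun k _ => hinv.price_nonneg k) (hj hmem)
        have h2 := hinv.sum_prices j
        have h3 := hinv.budget_nonneg j
        linarith
      · by_contra h'
        exact hnot t (not_le.1 h') h
      · rwa [simultaneousGreedy_eq, hF2 t h]
    · left
      intro t ht
      rcases le_or_gt t (F.2 i) with h | h
      · rw [simultaneousGreedy_eq, hF2 t h] at ht
        exact hmem ht
      · exact hnot t h ht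

end Budget

/-! ## Mechanisms with threshold payments -/

section Threshold

variable {n : ℕ} {f : (Fin n → ℝ) → Finset (Fin n)}

/-- Every agent either is never selected, or is selected if and only if the declared cost is at most
a threshold that depends on the declared costs of the others. -/
def HasThresholds (f : (Fin n → ℝ) → Finset (Fin n)) : Prop :=
  ∀ (b : Fin n → ℝ) (i : Fin n),
    (∀ t, i ∉ f (update b i t)) ∨ ∃ τ, ∀ t, i ∈ f (update b i t) ↔ t ≤ τ

theorem thresholdPayment_of_notMem {b : Fin n → ℝ} {i : Fin n} (h : i ∉ f b) :
    thresholdPayment f b i = 0 := by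
  simp [thresholdPayment, h]

theorem thresholdPayment_eq {b : Fin n → ℝ} {i : Fin n} {τ : ℝ}
    (hτ : ∀ t, i ∈ f (update b i t) ↔ t ≤ τ) (hb : b i ≤ τ) : thresholdPayment f b i = τ := by
  have hmem : i ∈ f b := by simpa using (hτ (b i)).2 hb
  have : {t : ℝ | b i ≤ t ∧ i ∈ f (update b i t)} = Set.Icc (b i) τ := by
    ext t
    simp [hτ]
  rw [thresholdPayment, if_pos hmem, this, csSup_Icc hb]

/-- Neither `τ` nor the payment of a winner depends on the agent's own declaration. Telling the
truth yields `max (τ - t) 0`, the better of the two utilities `τ - t` and `0` that any declaration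
can produce. -/
theorem HasThresholds.truthful (hf : HasThresholds f) :
    (Mechanism.mk f (thresholdPayment f)).Truthful := by
  intro i t b _ _
  simp only [Mechanism.utility]
  rcases hf b i with h | ⟨τ, hτ⟩
  · have h1 : i ∉ f b := by simpa using h (b i)
    have h2 := h t
    simp [thresholdPayment_of_notMem h1, thresholdPayment_of_notMem h2, h1, h2]
  · have hτ' : ∀ s, i ∈ f (update (update b i t) i s) ↔ s ≤ τ := by simpa using hτ
    have hb : i ∈ f b ↔ b i ≤ τ := by simpa using hτ (b i)
    have key : ∀ b' : Fin n → ℝ, (∀ s, i ∈ f (update b' i s) ↔ s ≤ τ) →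
        (i ∈ f b' → thresholdPayment f b' i = τ) := by
      intro b' h hmem
      exact thresholdPayment_eq h ((h (b' i)).1 (by simpa using hmem))
    by_cases h1 : i ∈ f b <;> by_cases h2 : i ∈ f (update b i t)
    · simp [h1, h2, key b hτ h1, key _ hτ' h2]
    · have := mt (hτ t).2 h2
      simp only [h1, h2, key b hτ h1, thresholdPayment_of_notMem h2, if_true, if_false]
      linarith
    · have := (hτ t).1 h2
      simp only [h1, h2, key _ hτ' h2, thresholdPayment_of_notMem h1, if_true, if_false]
      linarith
    · simp [h1, h2, thresholdPayment_of_notMem h1, thresholdPayment_of_notMem h2]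

theorem HasThresholds.individuallyRational (hf : HasThresholds f) :
    (Mechanism.mk f (thresholdPayment f)).IndividuallyRational := by
  intro b hb i
  by_cases h : i ∈ f b
  · rcases hf b i with h' | ⟨τ, hτ⟩
    · exact absurd h (by simpa using h' (b i))
    · have hle : b i ≤ τ := (hτ (b i)).1 (by simpa using h)
      simp only [thresholdPayment_eq hτ hle]
      exact ⟨(hb i).trans hle, fun _ => hle⟩
  · simp [thresholdPayment_of_notMem h, h]

end Threshold

end GenSm

namespace GenSm

open Function

/-! ## Truthfulness, individual rationality and budget feasibility -/

section MechanismProperties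

variable {n : ℕ} {v : Finset (Fin n) → ℚ} {B : ℝ} {alg₁ : KnapsackAlg} {alg₂ : UnconstrainedAlg}

open Classical in
/-- The agents whose declared cost is at most `B`. -/
noncomputable def eligible (B : ℝ) (b : Fin n → ℝ) : Finset (Fin n) :=
  Finset.univ.filter (fun i => b i ≤ B)

theorem mem_eligible {b : Fin n → ℝ} {i : Fin n} : i ∈ eligible B b ↔ b i ≤ B := by
  simp [eligible]

/-- The agent with the most valuable singleton. -/
def bestSingleton (v : Finset (Fin n) → ℚ) (A : Finset (Fin n)) : Option (Fin n) :=
  ((List.finRange n).filter (· ∈ A)).argmax (fun i => v {i})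

/-- The value of the set that the knapsack algorithm finds on the sample. -/
noncomputable def sampleValue (alg₁ : KnapsackAlg) (v : Finset (Fin n) → ℚ) (B : ℝ)
    (ω : Seed n (alg₁.bits n)) (b : Fin n → ℝ) : ℚ :=
  v (alg₁.run v (eligible B b ∩ ω.2.1) (proj (eligible B b ∩ ω.2.1) b) B ω.2.2)

/-- The run of Simultaneous Greedy within the mechanism. -/
noncomputable def mainRun (alg₁ : KnapsackAlg) (v : Finset (Fin n) → ℚ) (B : ℝ)
    (ω : Seed n (alg₁.bits n)) (b : Fin n → ℝ) : GreedyState n × (Fin n → ℝ) :=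
  greedyRun (eligible B b \ ω.2.1) v (proj (eligible B b \ ω.2.1) b) B
    (sampleValue alg₁ v B ω b : ℝ)

theorem genSmOutcome_lottery {ω : Seed n (alg₁.bits n)} (hω : ω.1.val < 201) (b : Fin n → ℝ) :
    genSmOutcome alg₁ alg₂ v B ω b =
      (bestSingleton v (eligible B b)).elim ∅ (fun i => {i}) := by
  unfold genSmOutcome
  simp only [if_pos hω]
  split
  · rename_i h
    have h' : bestSingleton v (eligible B b) = none := by
      unfold bestSingleton eligible
      convert h
    rw [h']
    rfl
  · rename_i k h
    have h' : bestSingleton v (eligible B b) = some k := by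
      unfold bestSingleton eligible
      convert h
    rw [h']
    rfl

theorem genSmOutcome_greedy {ω : Seed n (alg₁.bits n)} (hω : ¬ ω.1.val < 201) (b : Fin n → ℝ) :
    genSmOutcome alg₁ alg₂ v B ω b =
      simultaneousGreedy alg₂ (eligible B b \ ω.2.1) v (proj (eligible B b \ ω.2.1) b) B
        (sampleValue alg₁ v B ω b : ℝ) := by
  unfold genSmOutcome sampleValue eligible
  simp only [if_neg hω]

theorem genSmOutcome_mainRun {ω : Seed n (alg₁.bits n)} (hω : ¬ ω.1.val < 201)
    (b : Fin n → ℝ) :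
    genSmOutcome alg₁ alg₂ v B ω b = bestOfFour alg₂ v (mainRun alg₁ v B ω b).1.sol := by
  rw [genSmOutcome_greedy hω, simultaneousGreedy_eq]
  rfl

theorem mainRun_invariant (hv : IsValuation v) (hB : 0 < B) (ω : Seed n (alg₁.bits n))
    (b : Fin n → ℝ) :
    BudgetInvariant v B (sampleValue alg₁ v B ω b : ℝ) (eligible B b \ ω.2.1)
      (mainRun alg₁ v B ω b) :=
  BudgetInvariant.iterate hv hB _

theorem genSmOutcome_greedy_subset (h₂ : alg₂.IsTwoApprox) (hv : IsValuation v) (hB : 0 < B)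
    {ω : Seed n (alg₁.bits n)} (hω : ¬ ω.1.val < 201) (b : Fin n → ℝ) :
    genSmOutcome alg₁ alg₂ v B ω b ⊆ eligible B b \ ω.2.1 := by
  rw [genSmOutcome_mainRun hω]
  obtain ⟨j, hj⟩ := bestOfFour_subset h₂ hv (mainRun alg₁ v B ω b).1.sol
  exact hj.trans ((mainRun_invariant hv hB ω b).sol_subset j)

/-- Among declarations up to `B` the eligible set does not change, so the declaration `B` can serve
as a reference point for all of them. -/
theorem eligible_update {b : Fin n → ℝ} {i : Fin n} {t : ℝ} (ht : t ≤ B) :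
    eligible B (update b i t) = eligible B (update b i B) := by
  ext k
  rcases eq_or_ne k i with rfl | hk
  · simp [mem_eligible, ht]
  · simp [mem_eligible, hk]

theorem proj_update_of_notMem {D : Finset (Fin n)} {b : Fin n → ℝ} {i : Fin n} {t : ℝ}
    (hi : i ∉ D) : proj D (update b i t) = proj D b := by
  funext k
  rcases eq_or_ne k i with rfl | hk
  · simp [proj, hi]
  · simp [proj, hk]

theorem proj_update_of_mem {D : Finset (Fin n)} {b : Fin n → ℝ} {i : Fin n} {t : ℝ}
    (hi : i ∈ D) : proj D (update b i t) = update (proj D b) i t := by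
  funext k
  rcases eq_or_ne k i with rfl | hk
  · simp [proj, hi]
  · simp [proj, hk]

/-- The winner is determined by the eligible set and the values, so a declaration matters only
through eligibility. -/
theorem lottery_threshold {ω : Seed n (alg₁.bits n)} (hω : ω.1.val < 201) (b : Fin n → ℝ)
    (i : Fin n) :
    (∀ t, i ∉ genSmOutcome alg₁ alg₂ v B ω (update b i t)) ∨
      ∀ t, i ∈ genSmOutcome alg₁ alg₂ v B ω (update b i t) ↔ t ≤ B := by
  have hbig : ∀ t, i ∈ genSmOutcome alg₁ alg₂ v B ω (update b i t) → t ≤ B := by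
    intro t ht
    rw [genSmOutcome_lottery hω] at ht
    rcases h : bestSingleton v (eligible B (update b i t)) with _ | k
    · simp [h] at ht
    · rw [h] at ht
      obtain rfl : i = k := by simpa using ht
      have := List.argmax_mem (Option.mem_def.2 h)
      simpa [mem_eligible] using this
  by_cases hwin : bestSingleton v (eligible B (update b i B)) = some i
  · right
    refine fun t => ⟨hbig t, fun ht => ?_⟩
    rw [genSmOutcome_lottery hω, eligible_update ht, hwin]
    simp
  · left
    intro t ht
    have htB := hbig t ht
    rw [genSmOutcome_lottery hω, eligible_update htB] at ht
    rcases h : bestSingleton v (eligible B (update b i B)) with _ | k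
    · simp [h] at ht
    · rw [h] at ht hwin
      obtain rfl : i = k := by simpa using ht
      exact hwin rfl

/-- Agents of the sample never win. For any other agent the sample, its costs and hence `x` are the
same for all declarations up to `B`, which leaves the threshold of Simultaneous Greedy. The last
clause identifies it with the recorded price, as the payments require. -/
theorem greedy_threshold (h₂ : alg₂.IsTwoApprox) (hv : IsValuation v) (hB : 0 < B)
    {ω : Seed n (alg₁.bits n)} (hω : ¬ ω.1.val < 201) (b : Fin n → ℝ) (i : Fin n) :
    (∀ t, i ∉ genSmOutcome alg₁ alg₂ v B ω (update b i t)) ∨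
      ∃ τ, (∀ t, i ∈ genSmOutcome alg₁ alg₂ v B ω (update b i t) ↔ t ≤ τ) ∧
        ∀ t ≤ τ, (mainRun alg₁ v B ω (update b i t)).2 i = τ := by
  have hsub : ∀ t, i ∈ genSmOutcome alg₁ alg₂ v B ω (update b i t) → t ≤ B ∧ i ∉ ω.2.1 := by
    intro t ht
    have := genSmOutcome_greedy_subset h₂ hv hB hω _ ht
    simpa [mem_eligible] using this
  by_cases hR : i ∈ ω.2.1
  · exact Or.inl fun t ht => (hsub t ht).2 hR
  set A := eligible B (update b i B) with hA
  have hiA : i ∈ A \ ω.2.1 := by simp [hA, mem_eligible, hR]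
  have hx : ∀ t ≤ B, sampleValue alg₁ v B ω (update b i t) =
      v (alg₁.run v (A ∩ ω.2.1) (proj (A ∩ ω.2.1) b) B ω.2.2) := by
    intro t ht
    rw [sampleValue, eligible_update ht, proj_update_of_notMem (by simp [hR])]
  set x : ℚ := v (alg₁.run v (A ∩ ω.2.1) (proj (A ∩ ω.2.1) b) B ω.2.2)
  have hout : ∀ t ≤ B, genSmOutcome alg₁ alg₂ v B ω (update b i t) =
      simultaneousGreedy alg₂ (A \ ω.2.1) v (update (proj (A \ ω.2.1) b) i t) B x := by
    intro t ht
    rw [genSmOutcome_greedy hω, hx t ht, eligible_update ht, proj_update_of_mem hiA]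
  have hrun : ∀ t ≤ B, mainRun alg₁ v B ω (update b i t) =
      greedyRun (A \ ω.2.1) v (update (proj (A \ ω.2.1) b) i t) B x := by
    intro t ht
    rw [mainRun, hx t ht, eligible_update ht, proj_update_of_mem hiA]
  rcases greedyRun_threshold h₂ hv hB (proj (A \ ω.2.1) b) (x : ℝ) hiA with h | ⟨τ, hτB, h, h'⟩
  · left
    intro t ht
    have htB := (hsub t ht).1
    rw [hout t htB] at ht
    exact h t ht
  · right
    refine ⟨τ, fun t => ⟨fun ht => ?_, fun ht => ?_⟩, fun t ht => ?_⟩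
    · rw [hout t (hsub t ht).1] at ht
      exact (h t).1 ht
    · rw [hout t (ht.trans hτB)]
      exact (h t).2 ht
    · rw [hrun t (ht.trans hτB)]
      exact h' t ht

theorem genSmOutcome_hasThresholds (h₂ : alg₂.IsTwoApprox) (hv : IsValuation v) (hB : 0 < B)
    (ω : Seed n (alg₁.bits n)) : HasThresholds (genSmOutcome alg₁ alg₂ v B ω) := by
  intro b i
  by_cases hω : ω.1.val < 201
  · exact (lottery_threshold hω b i).imp_right fun h => ⟨B, h⟩
  · exact (greedy_threshold h₂ hv hB hω b i).imp_right fun ⟨τ, h, _⟩ => ⟨τ, h⟩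

theorem lottery_payment {ω : Seed n (alg₁.bits n)} (hω : ω.1.val < 201) (b : Fin n → ℝ)
    (i : Fin n) :
    thresholdPayment (genSmOutcome alg₁ alg₂ v B ω) b i =
      if i ∈ genSmOutcome alg₁ alg₂ v B ω b then B else 0 := by
  split_ifs with hi
  · rcases lottery_threshold hω b i with h | h
    · exact absurd hi (by simpa using h (b i))
    · exact thresholdPayment_eq h ((h (b i)).1 (by simpa using hi))
  · exact thresholdPayment_of_notMem hi

/-- This replaces a supremum over hypothetical declarations by a number recorded in the actual run.
Budget feasibility and the program that computes the payments both depend on it. -/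
theorem greedy_payment (h₂ : alg₂.IsTwoApprox) (hv : IsValuation v) (hB : 0 < B)
    {ω : Seed n (alg₁.bits n)} (hω : ¬ ω.1.val < 201) (b : Fin n → ℝ) (i : Fin n) :
    thresholdPayment (genSmOutcome alg₁ alg₂ v B ω) b i =
      if i ∈ genSmOutcome alg₁ alg₂ v B ω b then (mainRun alg₁ v B ω b).2 i else 0 := by
  split_ifs with hi
  · rcases greedy_threshold h₂ hv hB hω b i with h | ⟨τ, h, h'⟩
    · exact absurd hi (by simpa using h (b i))
    · have hle : b i ≤ τ := (h (b i)).1 (by simpa using hi)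
      have := h' (b i) hle
      rw [update_eq_self] at this
      rw [this]
      exact thresholdPayment_eq h hle
  · exact thresholdPayment_of_notMem hi

/-- The lottery pays `B` to at most one agent. In the greedy branch the winners lie in one `S_j`,
whose prices sum to `B - B_j`. -/
theorem genSmMain_budgetFeasible (h₂ : alg₂.IsTwoApprox) (hv : IsValuation v) (hB : 0 < B)
    (ω : Seed n (alg₁.bits n)) : (genSmMain alg₁ alg₂ v B ω).BudgetFeasible B := by
  intro b _
  simp only [genSmMain]
  by_cases hω : ω.1.val < 201
  · simp only [lottery_payment hω, Finset.sum_ite_mem, Finset.univ_inter]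
    rw [genSmOutcome_lottery hω]
    rcases bestSingleton v (eligible B b) with _ | k <;> simp [hB.le]
  · simp only [greedy_payment h₂ hv hB hω, Finset.sum_ite_mem, Finset.univ_inter]
    have hinv := mainRun_invariant (alg₁ := alg₁) hv hB ω b
    rw [genSmOutcome_mainRun hω]
    obtain ⟨j, hj⟩ := bestOfFour_subset h₂ hv (mainRun alg₁ v B ω b).1.sol
    have h1 := Finset.sum_le_sum_of_subset_of_nonneg hj
      (fun k _ _ => hinv.price_nonneg k)
    have h2 := hinv.sum_prices j
    have h3 := hinv.budget_nonneg j
    linarith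

end MechanismProperties

end GenSm

/-! ### Approximation: submodular inequalities, balanced samples and the value of the greedy
solutions. -/

namespace GenSm

open Function

/-! ## Submodular functions -/

section Submodular

variable {n : ℕ} {v : Finset (Fin n) → ℚ}

theorem marginal_of_mem {S : Finset (Fin n)} {i : Fin n} (h : i ∈ S) : marginal v S i = 0 := by
  simp [marginal, Finset.insert_eq_of_mem h]

theorem marginal_empty (hv : IsValuation v) (i : Fin n) : marginal v ∅ i = v {i} := by
  simp [marginal, hv.normalized]

/-- Add the elements of `W` one at a time and sum the diminishing returns. -/
theorem IsValuation.union_sub_le (hv : IsValuation v) {I S W : Finset (Fin n)} (hI : I ⊆ S)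
    (hW : Disjoint W S) : v (S ∪ W) - v S ≤ v (I ∪ W) - v I := by
  induction W using Finset.induction_on with
  | empty => simp
  | insert a W ha ih =>
    rw [Finset.disjoint_insert_left] at hW
    have h := hv.submodular (I ∪ W) (S ∪ W) (Finset.union_subset_union_left hI) a
      (by simp [hW.1, ha])
    have := ih hW.2
    simp only [marginal] at h
    rw [Finset.union_insert, Finset.union_insert]
    linarith

theorem IsValuation.union_add_inter_le (hv : IsValuation v) (S T : Finset (Fin n)) :
    v (S ∪ T) + v (S ∩ T) ≤ v S + v T := by
  have h := hv.union_sub_le (I := S ∩ T) (S := S) (W := T \ S) Finset.inter_subset_left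
    Finset.sdiff_disjoint
  have h1 : S ∪ T \ S = S ∪ T := Finset.union_sdiff_self_eq_union
  have h2 : S ∩ T ∪ T \ S = T := by
    rw [Finset.inter_comm, Finset.union_comm, Finset.sdiff_union_inter]
  rw [h1, h2] at h
  linarith

theorem IsValuation.union_le (hv : IsValuation v) (S T : Finset (Fin n)) :
    v (S ∪ T) ≤ v S + v T := by
  have := hv.union_add_inter_le S T
  have := hv.nonneg (S ∩ T)
  linarith

/-- Adding `W` element by element, each gain is at most the marginal with respect to `S`. Truncation
at zero covers the elements that are already present, and later permits charging to sums over larger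
sets. -/
theorem IsValuation.union_le_sum (hv : IsValuation v) (S W : Finset (Fin n)) :
    v (S ∪ W) ≤ v S + ∑ i ∈ W, max 0 (marginal v S i) := by
  induction W using Finset.induction_on with
  | empty => simp
  | insert a W ha ih =>
    rw [Finset.sum_insert ha, Finset.union_insert]
    have h0 := le_max_left 0 (marginal v S a)
    by_cases hm : a ∈ S ∪ W
    · rw [Finset.insert_eq_of_mem hm]
      linarith
    · have h1 := hv.submodular S (S ∪ W) Finset.subset_union_left a hm
      have h2 := le_max_right 0 (marginal v S a)
      simp only [marginal] at h1 h2 h0 ih ⊢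
      linarith

/-- A set without valuable singletons can be divided into two valuable parts. -/
theorem IsValuation.exists_balanced_partition (hv : IsValuation v) (S : Finset (Fin n)) {m : ℚ}
    (hm0 : 0 ≤ m) (hm : ∀ i ∈ S, v {i} ≤ m) :
    ∃ T ⊆ S, (v S - m) / 2 ≤ v T ∧ (v S - m) / 2 ≤ v (S \ T) := by
  rcases le_or_gt (v S - m) 0 with h0 | h0
  · exact ⟨∅, by simp, by linarith [hv.nonneg ∅], by linarith [hv.nonneg (S \ ∅)]⟩
  -- Take `T` of minimal cardinality among the subsets worth at least `(v S - m) / 2`. Without one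
  -- of its elements it falls below that value, and the element is worth at most `m`, so `v T < (v S
  -- + m) / 2`. Subadditivity leaves at least `(v S - m) / 2` for the complement.
  obtain ⟨T, hT, hmin⟩ := (Finset.univ.filter
    (fun T : Finset (Fin n) => T ⊆ S ∧ (v S - m) / 2 ≤ v T)).exists_min_image Finset.card
    (by
      refine ⟨S, ?_⟩
      simp only [Finset.mem_filter, Finset.mem_univ, true_and, subset_rfl]
      linarith)
  simp only [Finset.mem_filter, Finset.mem_univ, true_and] at hT hmin
  refine ⟨T, hT.1, hT.2, ?_⟩
  obtain ⟨a, ha⟩ : T.Nonempty := by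
    rw [Finset.nonempty_iff_ne_empty]
    rintro rfl
    rw [hv.normalized] at hT
    linarith
  have hlt : v (T.erase a) < (v S - m) / 2 := by
    by_contra hcon
    have := hmin (T.erase a) ⟨(Finset.erase_subset _ _).trans hT.1, not_lt.1 hcon⟩
    exact absurd (Finset.card_erase_lt_of_mem ha) (not_lt.2 this)
  have h1 := hv.union_le (T.erase a ∪ {a}) (S \ T)
  have h2 := hv.union_le (T.erase a) {a}
  have h3 : T.erase a ∪ {a} = T := by
    rw [Finset.union_comm, ← Finset.insert_eq, Finset.insert_erase ha]
  rw [h3, Finset.union_sdiff_of_subset hT.1] at h1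
  rw [h3] at h2
  have := hm a (hT.1 ha)
  linarith

/-- At least half of the ways of sampling a set leave a fraction of its value on both sides. -/
theorem IsValuation.card_balanced_samples (hv : IsValuation v) (S : Finset (Fin n)) {m : ℚ}
    (hm0 : 0 ≤ m) (hm : ∀ i ∈ S, v {i} ≤ m) :
    ∃ G : Finset (Finset (Fin n)), Fintype.card (Finset (Fin n)) ≤ 2 * G.card ∧
      ∀ R ∈ G, (∃ X ⊆ S ∩ R, (v S - m) / 4 ≤ v X) ∧ ∃ Y ⊆ S \ R, (v S - m) / 4 ≤ v Y := by
  classical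
  obtain ⟨T, hTS, hT, hT'⟩ := hv.exists_balanced_partition S hm0 hm
  set q := (v S - m) / 4 with hq
  set G : Finset (Finset (Fin n)) := Finset.univ.filter (fun R =>
    (∃ X ⊆ S ∩ R, q ≤ v X) ∧ ∃ Y ⊆ S \ R, q ≤ v Y) with hG
  have hhalf : ∀ T' : Finset (Fin n), (v S - m) / 2 ≤ v T' → ∀ R, q ≤ v (T' ∩ R) ∨ q ≤ v (T' \ R) := by
    intro T' h R
    by_contra! hcon
    have := hv.union_le (T' ∩ R) (T' \ R)
    rw [Finset.union_comm, Finset.sdiff_union_inter] at this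
    linarith [hcon.1, hcon.2]
  -- Replacing `R` by `R ∆ T` exchanges the two sides on `T` and keeps them on `S \ T`. If the heavy
  -- halves of `T` and `S \ T` are on the same side of `R`, they are on opposite sides of `R ∆ T`.
  have hflip : ∀ R, R ∈ G ∨ symmDiff R T ∈ G := by
    intro R
    simp only [hG, Finset.mem_filter, Finset.mem_univ, true_and]
    rcases hhalf T hT R with h1 | h1 <;> rcases hhalf (S \ T) hT' R with h2 | h2
    · right
      refine ⟨⟨_, ?_, h2⟩, _, ?_, h1⟩
      all_goals
        intro a ha
        have := @hTS a
        simp only [Finset.mem_inter, Finset.mem_sdiff, Finset.mem_symmDiff] at ha ⊢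
        tauto
    · left
      refine ⟨⟨_, ?_, h1⟩, _, ?_, h2⟩
      all_goals
        intro a ha
        have := @hTS a
        simp only [Finset.mem_inter, Finset.mem_sdiff] at ha ⊢
        tauto
    · left
      refine ⟨⟨_, ?_, h2⟩, _, ?_, h1⟩
      all_goals
        intro a ha
        have := @hTS a
        simp only [Finset.mem_inter, Finset.mem_sdiff] at ha ⊢
        tauto
    · right
      refine ⟨⟨_, ?_, h1⟩, _, ?_, h2⟩
      all_goals
        intro a ha
        have := @hTS a
        simp only [Finset.mem_inter, Finset.mem_sdiff, Finset.mem_symmDiff] at ha ⊢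
        tauto
  refine ⟨G, ?_, fun R hR => by simpa [hG] using hR⟩
  -- The flip is an involution, so `G` and its image cover all samples and `G` contains at least
  -- half of them.
  have hcover : (Finset.univ : Finset (Finset (Fin n))) ⊆ G ∪ G.image (fun R => symmDiff R T) := by
    intro R _
    rw [Finset.mem_union, Finset.mem_image]
    exact (hflip R).imp_right fun h => ⟨_, h, by rw [symmDiff_symmDiff_cancel_right]⟩
  have h1 := Finset.card_le_card hcover
  have h2 := Finset.card_union_le G (G.image (fun R => symmDiff R T))
  have h3 := Finset.card_image_le (s := G) (f := fun R => symmDiff R T)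
  rw [Finset.card_univ] at h1
  omega

end Submodular

/-! ## Optimal values -/

section Opt

variable {n : ℕ} {v : Finset (Fin n) → ℚ} {c : Fin n → ℝ} {B : ℝ} {D : Finset (Fin n)}

theorem finite_opt_values (D : Finset (Fin n)) (v : Finset (Fin n) → ℚ) (c : Fin n → ℝ) (B : ℝ) :
    {y : ℝ | ∃ S : Finset (Fin n), S ⊆ D ∧ ∑ i ∈ S, c i ≤ B ∧ y = (v S : ℝ)}.Finite :=
  (Set.finite_range fun S : Finset (Fin n) => (v S : ℝ)).subset
    (by rintro _ ⟨S, -, -, rfl⟩; exact ⟨S, rfl⟩)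

theorem le_opt {S : Finset (Fin n)} (hS : S ⊆ D) (hc : ∑ i ∈ S, c i ≤ B) :
    (v S : ℝ) ≤ opt D v c B :=
  le_csSup (finite_opt_values D v c B).bddAbove ⟨S, hS, hc, rfl⟩

theorem exists_opt_eq (D : Finset (Fin n)) (v : Finset (Fin n) → ℚ) (c : Fin n → ℝ) (hB : 0 ≤ B) :
    ∃ S ⊆ D, ∑ i ∈ S, c i ≤ B ∧ opt D v c B = v S := by
  obtain ⟨S, h1, h2, h3⟩ := Set.Nonempty.csSup_mem
    (s := {y : ℝ | ∃ S : Finset (Fin n), S ⊆ D ∧ ∑ i ∈ S, c i ≤ B ∧ y = (v S : ℝ)})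
    ⟨v ∅, ∅, by simp, by simpa using hB, rfl⟩ (finite_opt_values D v c B)
  exact ⟨S, h1, h2, h3⟩

theorem sum_proj {S : Finset (Fin n)} (hS : S ⊆ D) : ∑ i ∈ S, proj D c i = ∑ i ∈ S, c i :=
  Finset.sum_congr rfl fun i hi => by simp [proj, hS hi]

end Opt

/-! ## The value of Simultaneous Greedy -/

section GreedyValue

variable {n : ℕ} {v : Finset (Fin n) → ℚ} {c : Fin n → ℝ} {B x : ℝ} {D : Finset (Fin n)}

theorem pricedStep_of_stuck {p : GreedyState n × (Fin n → ℝ)}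
    (h : ∀ i ∈ p.1.rest, ∀ j, marginal v (p.1.sol j) i ≤ 0) : pricedStep v c B x p = p := by
  rcases h' : nextPair v p.1 with _ | ⟨i, j⟩
  · exact pricedStep_none h'
  · exact pricedStep_nonpos h' (not_lt.2 (h i (nextPair_mem h') j))

/-- A step that is not idle removes an agent from `rest`, so as many iterations as there are agents
in `rest` bring the loop to its end. -/
theorem iterate_pricedStep_stuck (k : ℕ) {p : GreedyState n × (Fin n → ℝ)}
    (hk : p.1.rest.card ≤ k) :
    ∀ i ∈ ((pricedStep v c B x)^[k] p).1.rest, ∀ j,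
      marginal v (((pricedStep v c B x)^[k] p).1.sol j) i ≤ 0 := by
  induction k generalizing p with
  | zero =>
    have : p.1.rest = ∅ := by simpa using hk
    simp [this]
  | succ k ih =>
    by_cases hs : ∀ i ∈ p.1.rest, ∀ j, marginal v (p.1.sol j) i ≤ 0
    · rw [iterate_fixed (pricedStep_of_stuck hs)]
      exact hs
    · rw [iterate_succ_apply]
      apply ih
      refine pricedStep_induction (v := v) (c := c) (B := B) (x := x)
        (motive := fun q => q.1.rest.card ≤ k) p (fun h => absurd h hs) ?_ ?_
      all_goals
        intro i j h _ _
        have := Finset.card_erase_lt_of_mem (nextPair_mem h)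
        simp only [acceptState]
        omega

/-- Surplus iterations are idle. The program can therefore run `n` iterations instead of `D.card`.
-/
theorem iterate_pricedStep_eq {k : ℕ} {p : GreedyState n × (Fin n → ℝ)}
    (hk : p.1.rest.card ≤ k) :
    (pricedStep v c B x)^[k] p = (pricedStep v c B x)^[p.1.rest.card] p := by
  obtain ⟨r, rfl⟩ := Nat.exists_eq_add_of_le' hk
  rw [iterate_add_apply, iterate_fixed (pricedStep_of_stuck (iterate_pricedStep_stuck _ le_rfl))]

/-- The properties of the states of Simultaneous Greedy that bound the value of the solutions. -/
structure ValueInvariant (v : Finset (Fin n) → ℚ) (c : Fin n → ℝ) (B x : ℝ) (D : Finset (Fin n))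
    (p : GreedyState n × (Fin n → ℝ)) : Prop where
  cross : ∀ j j', j ≠ j' → ∑ i ∈ p.1.sol j, max 0 (marginal v (p.1.sol j') i) ≤ v (p.1.sol j)
  excluded : ∀ i ∈ D, i ∉ p.1.rest → (∀ j, i ∉ p.1.sol j) →
    (∀ j, (marginal v (p.1.sol j) i : ℝ) ≤ x / (beta * B) * c i) ∨
      ∃ j, x / beta - v {i} ≤ v (p.1.sol j)

/-- Both properties survive because solutions only grow, so marginals of outside agents shrink, and
only agents with positive marginal are accepted, so values rise. A refusal has one of two causes. If
the price is below the cost, the marginal is below `x c_i / (β B)`, for both solutions since the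
examined pair is a maximizer. If the price exceeds the remaining budget, the solution is already
worth nearly `x / β`. -/
theorem ValueInvariant.step {p : GreedyState n × (Fin n → ℝ)} (hv : IsValuation v) (hB : 0 < B)
    (hx : 0 < x) (hb : BudgetInvariant v B x D p) (hp : ValueInvariant v c B x D p) :
    ValueInvariant v c B x D (pricedStep v c B x p) := by
  have hβ := beta_pos
  refine pricedStep_induction (motive := ValueInvariant v c B x D) p (fun _ => hp) ?_ ?_
  · intro i j h hm ha
    have hi := nextPair_mem h
    have hnot : ∀ j', i ∉ p.1.sol j' := fun j' hj' =>
      Finset.disjoint_left.1 (hb.disjoint_rest j') hj' hi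
    constructor
    · intro j₁ j₂ hj
      simp only [acceptState]
      have h0 := hp.cross j₁ j₂ hj
      rcases eq_or_ne j₁ j with rfl | h1
      · rw [update_self, update_of_ne hj.symm, Finset.sum_insert (hnot _)]
        -- The greedy choice: the gain of `v (S_{j₁})` is at least what the agent would have
        -- contributed to `S_{j₂}`, so the new summand is paid for.
        have := max_le hm.le (nextPair_max h hi j₂)
        simp only [marginal] at this h0 ⊢
        linarith
      · obtain rfl : j₂ = j := by omega
        rw [update_self, update_of_ne h1]
        refine (Finset.sum_le_sum fun k hk => max_le_max le_rfl ?_).trans h0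
        refine hv.submodular _ _ (Finset.subset_insert _ _) k ?_
        rw [Finset.mem_insert, not_or]
        refine ⟨?_, Finset.disjoint_left.1 (hb.disjoint_sol _ _ hj) hk⟩
        rintro rfl
        exact hnot _ hk
    · intro k hkD hkr hks
      simp only [acceptState] at hkr hks ⊢
      have hki : k ≠ i := by
        rintro rfl
        exact hks j (by simp)
      have hks' : ∀ j', k ∉ p.1.sol j' := fun j' hj' => hks j' ((mem_update_insert hki).2 hj')
      rcases hp.excluded k hkD (fun h' => hkr (Finset.mem_erase.2 ⟨hki, h'⟩)) hks' with h1 | ⟨j', h1⟩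
      · left
        intro j'
        refine le_trans ?_ (h1 j')
        rcases eq_or_ne j' j with rfl | hj
        · rw [update_self]
          exact_mod_cast hv.submodular _ _ (Finset.subset_insert _ _) k (by simp [hki, hks'])
        · rw [update_of_ne hj]
      · right
        refine ⟨j', h1.trans ?_⟩
        rcases eq_or_ne j' j with rfl | hj
        · rw [update_self]
          simp only [marginal] at hm
          exact_mod_cast (sub_pos.1 hm).le
        · rw [update_of_ne hj]
  · intro i j h hm ha
    have hi := nextPair_mem h
    refine ⟨hp.cross, fun k hkD hkr hks => ?_⟩
    rcases eq_or_ne k i with rfl | hki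
    · rw [Accepts, not_and, not_and_or, not_le, not_le] at ha
      rcases ha hx with h1 | h1
      · left
        intro j'
        have h2 : (marginal v (p.1.sol j') k : ℝ) ≤ marginal v (p.1.sol j) k := by
          exact_mod_cast nextPair_max h hi j'
        refine h2.trans ?_
        have h3 : (marginal v (p.1.sol j) k : ℝ) = x / (beta * B) * offer v B x p.1 k j := by
          rw [offer]
          field_simp
        rw [h3]
        exact mul_le_mul_of_nonneg_left h1.le (by positivity)
      · right
        refine ⟨j, ?_⟩
        -- The refusal says that the price exceeds `B - β B v(S_j) / x`. Cancelling `β B / x` gives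
        -- `x / β < v(S_j) + v(k | S_j)`, and the marginal is at most `v {k}`.
        rw [hb.budget_eq, offer] at h1
        have h2 : (marginal v (p.1.sol j) k : ℝ) ≤ v {k} := by
          rw [← marginal_empty hv]
          exact_mod_cast hv.submodular _ _ (Finset.empty_subset _) k (hks j)
        have h3 : B < beta * B / x * (marginal v (p.1.sol j) k + v (p.1.sol j)) := by linarith
        have h4 : x / beta < marginal v (p.1.sol j) k + v (p.1.sol j) := by
          rw [div_lt_iff₀ hβ]
          have h5 : beta * B / x * (marginal v (p.1.sol j) k + v (p.1.sol j)) =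
              B * ((marginal v (p.1.sol j) k + v (p.1.sol j)) * beta / x) := by ring
          rw [h5] at h3
          have h6 : 1 < (marginal v (p.1.sol j) k + v (p.1.sol j)) * beta / x := by
            by_contra hcon
            exact absurd h3 (not_lt.2 (mul_le_of_le_one_right hB.le (not_lt.1 hcon)))
          rwa [one_lt_div hx] at h6
        linarith
    · exact hp.excluded k hkD (fun h' => hkr (Finset.mem_erase.2 ⟨hki, h'⟩)) hks

theorem valueInvariant_greedyRun (hv : IsValuation v) (hB : 0 < B) (hx : 0 < x) :
    ValueInvariant v c B x D (greedyRun D v c B x) := by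
  have : ∀ k, ValueInvariant v c B x D ((pricedStep v c B x)^[k] (greedyInit D B)) := by
    intro k
    induction k with
    | zero => exact ⟨by simp [greedyInit, hv.normalized], fun i hi hi' => absurd hi hi'⟩
    | succ k ih =>
      rw [iterate_succ_apply']
      exact ih.step hv hB hx (BudgetInvariant.iterate hv hB k)
  exact this _

/-- The first alternative covers a refusal for lack of budget. In the second, every agent of `O` is
accounted for by membership, by a nonpositive marginal or by a cost above its offer. This bounds `v
(S_j ∪ O)` by `2 w + x / β` for both `j`, and uncrossing the two unions recovers `O`. -/
theorem greedyRun_value (hv : IsValuation v) (hc : ∀ i, 0 ≤ c i) (hB : 0 < B) (hx : 0 < x)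
    {O : Finset (Fin n)} (hO : O ⊆ D) (hOB : ∑ i ∈ O, c i ≤ B) {m w : ℝ}
    (hm : ∀ i ∈ D, (v {i} : ℝ) ≤ m) (hw : ∀ j, (v ((greedyRun D v c B x).1.sol j) : ℝ) ≤ w) :
    x / beta - m ≤ w ∨ (v O : ℝ) ≤ 4 * w + 2 * (x / beta) := by
  have hβ := beta_pos
  have hinv : ValueInvariant v c B x D (greedyRun D v c B x) := valueInvariant_greedyRun hv hB hx
  have hbud : BudgetInvariant v B x D (greedyRun D v c B x) := BudgetInvariant.iterate hv hB _
  have hstuck := iterate_pricedStep_stuck (v := v) (c := c) (B := B) (x := x) D.card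
    (p := greedyInit D B) le_rfl
  change ∀ i ∈ (greedyRun D v c B x).1.rest, ∀ j,
    marginal v ((greedyRun D v c B x).1.sol j) i ≤ 0 at hstuck
  generalize greedyRun D v c B x = p at *
  by_cases hbig : ∃ i ∈ D, ∃ j, x / beta - v {i} ≤ v (p.1.sol j)
  · obtain ⟨i, hi, j, hj⟩ := hbig
    left
    linarith [hm i hi, hw j]
  right
  -- Agents in the other solution keep their marginal, to be charged through `cross`. Members of
  -- `S_j` have marginal zero, unexamined agents a nonpositive one, and refused agents at most `x
  -- c_i / (β B)`.
  have hpoint : ∀ j j', j ≠ j' → ∀ i ∈ O, (max 0 (marginal v (p.1.sol j) i) : ℝ) ≤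
      (if i ∈ p.1.sol j' then (max 0 (marginal v (p.1.sol j) i) : ℝ) else 0) +
        x / (beta * B) * c i := by
    intro j j' hj i hi
    have h0 : 0 ≤ x / (beta * B) * c i := mul_nonneg (by positivity) (hc i)
    split_ifs with h1
    · linarith
    rw [zero_add]
    refine max_le h0 ?_
    by_cases h2 : i ∈ p.1.sol j
    · simpa [marginal_of_mem h2] using h0
    by_cases h3 : i ∈ p.1.rest
    · refine le_trans ?_ h0
      exact_mod_cast hstuck i h3 j
    have h4 : ∀ j'', i ∉ p.1.sol j'' := by
      intro j''
      rcases eq_or_ne j'' j with rfl | h5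
      · exact h2
      · obtain rfl : j'' = j' := by omega
        exact h1
    rcases hinv.excluded i (hO hi) h3 h4 with h5 | ⟨j'', h5⟩
    · exact h5 j
    · exact absurd ⟨i, hO hi, j'', h5⟩ hbig
  have hunion : ∀ j j', j ≠ j' → (v (p.1.sol j ∪ O) : ℝ) ≤ 2 * w + x / beta := by
    intro j j' hj
    have h1 : (v (p.1.sol j ∪ O) : ℝ) ≤
        v (p.1.sol j) + ∑ i ∈ O, (max 0 (marginal v (p.1.sol j) i) : ℝ) := by
      exact_mod_cast hv.union_le_sum (p.1.sol j) O
    have h2 := Finset.sum_le_sum (hpoint j j' hj)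
    rw [Finset.sum_add_distrib, ← Finset.mul_sum, Finset.sum_ite_mem] at h2
    have h3 : ∑ i ∈ O ∩ p.1.sol j', (max 0 (marginal v (p.1.sol j) i) : ℝ) ≤
        ∑ i ∈ p.1.sol j', (max 0 (marginal v (p.1.sol j) i) : ℝ) :=
      Finset.sum_le_sum_of_subset_of_nonneg Finset.inter_subset_right
        fun _ _ _ => le_max_left _ _
    have h4 : ∑ i ∈ p.1.sol j', (max 0 (marginal v (p.1.sol j) i) : ℝ) ≤ v (p.1.sol j') := by
      exact_mod_cast hinv.cross j' j hj.symm
    have h5 : x / (beta * B) * ∑ i ∈ O, c i ≤ x / beta := by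
      calc x / (beta * B) * ∑ i ∈ O, c i ≤ x / (beta * B) * B :=
            mul_le_mul_of_nonneg_left hOB (by positivity)
        _ = x / beta := by field_simp
    linarith [hw j, hw j']
  have h1 := hunion 0 1 (by decide)
  have h2 := hunion 1 0 (by decide)
  -- Since the solutions are disjoint, the two unions meet exactly in `O`; nonnegativity of their
  -- union takes the place of monotonicity.
  have h3 := hv.union_add_inter_le (p.1.sol 0 ∪ O) (p.1.sol 1 ∪ O)
  have h4 : (p.1.sol 0 ∪ O) ∩ (p.1.sol 1 ∪ O) = O := by
    rw [← Finset.inter_union_distrib_right,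
      Finset.disjoint_iff_inter_eq_empty.1 (hbud.disjoint_sol 0 1 (by decide)), Finset.empty_union]
  rw [h4] at h3
  have h5 := hv.nonneg (p.1.sol 0 ∪ O ∪ (p.1.sol 1 ∪ O))
  have h6 : (v O : ℝ) ≤ v (p.1.sol 0 ∪ O) + v (p.1.sol 1 ∪ O) := by
    exact_mod_cast (by linarith : v O ≤ v (p.1.sol 0 ∪ O) + v (p.1.sol 1 ∪ O))
  linarith

end GreedyValue

/-! ## The approximation guarantee -/

section Approximation

variable {n : ℕ} {v : Finset (Fin n) → ℚ} {B : ℝ} {alg₁ : KnapsackAlg} {alg₂ : UnconstrainedAlg}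

theorem le_bestSingleton {A : Finset (Fin n)} {i : Fin n} (hi : i ∈ A) :
    v {i} ≤ v ((bestSingleton v A).elim ∅ fun i => {i}) := by
  have hmem : i ∈ (List.finRange n).filter (· ∈ A) := by simpa using hi
  rcases h : bestSingleton v A with _ | k
  · rw [bestSingleton, List.argmax_eq_none] at h
    simp [h] at hmem
  · exact List.le_of_mem_argmax (f := fun i => v {i}) hmem (Option.mem_def.2 h)

/-- The value of the greedy branch when the sample is balanced and the knapsack algorithm
succeeds. -/
theorem greedy_branch_value (hv : IsValuation v) (hB : 0 < B)
    {c : Fin n → ℝ} (hc : ∀ i, 0 ≤ c i) {ω : Seed n (alg₁.bits n)} (hω : ¬ ω.1.val < 201)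
    {q m κ : ℝ} (hq : 0 < q) (hκ : 0 < κ) (hm : ∀ i ∈ eligible B c, (v {i} : ℝ) ≤ m)
    {Y : Finset (Fin n)} (hY : Y ⊆ eligible B c \ ω.2.1) (hYB : ∑ i ∈ Y, c i ≤ B)
    (hYq : q ≤ v Y) (hx : κ * q ≤ sampleValue alg₁ v B ω c)
    {V : ℝ} (hxV : (sampleValue alg₁ v B ω c : ℝ) ≤ V) :
    min (κ * q / beta - m) ((q - 2 * (V / beta)) / 4) ≤
      v (genSmOutcome alg₁ alg₂ v B ω c) := by
  have hβ := beta_pos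
  rw [genSmOutcome_mainRun hω]
  have hx0 : (0 : ℝ) < sampleValue alg₁ v B ω c := (mul_pos hκ hq).trans_le hx
  have key := greedyRun_value (c := proj (eligible B c \ ω.2.1) c) hv
    (fun i => by unfold proj; split_ifs <;> simp [hc i]) hB hx0 hY
    (by rwa [sum_proj hY]) (m := m)
    (w := (v (bestOfFour alg₂ v (mainRun alg₁ v B ω c).1.sol) : ℝ))
    (fun i hi => hm i (Finset.mem_sdiff.1 hi).1)
    (fun j => by exact_mod_cast le_bestOfFour alg₂ _ j)
  rcases key with h | h
  · refine (min_le_left _ _).trans (le_trans ?_ h)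
    have := div_le_div_of_nonneg_right hx hβ.le
    linarith
  · refine (min_le_right _ _).trans ?_
    have := div_le_div_of_nonneg_right hxV hβ.le
    linarith

/-- Here `m` is the best eligible singleton value and `w` any value guaranteed on a balanced sample
with successful coins. These have probability at least `(1 - ε) / 2` within the greedy branch, hence
the coefficient `799 / 2000 * (1 - ε)`; all other seeds of that branch count as zero. The conditions
are imposed only for `0 < w`, so that `w = 0` leaves the lottery alone. -/
theorem expectedValue_ge (hv : IsValuation v) (hB : 0 < B) {ε : ℝ} (hε : ε < 1 / 3)
    (hε0 : 0 < ε)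
    (h₁ : alg₁.IsApprox ε) {c : Fin n → ℝ} (hc : ∀ i, 0 ≤ c i) :
    ∃ m : ℝ, 0 ≤ m ∧ ∀ w : ℝ, 0 ≤ w → (0 < w → m < opt Finset.univ v c B ∧
        w ≤ (1 / Real.exp 1 - ε) * ((opt Finset.univ v c B - m) / 4) / beta - m ∧
        w ≤ ((opt Finset.univ v c B - m) / 4 - 2 * (opt Finset.univ v c B / beta)) / 4) →
      201 / 1000 * m + 799 / 2000 * (1 - ε) * w ≤ (genSmMain alg₁ alg₂ v B).expectedValue v c := by
  classical
  set A := eligible B c with hA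
  set mq : ℚ := v ((bestSingleton v A).elim ∅ fun i => {i}) with hmq
  have hm : ∀ i ∈ A, v {i} ≤ mq := fun i hi => le_bestSingleton hi
  obtain ⟨S, -, hSB, hS⟩ := exists_opt_eq Finset.univ v c hB.le
  have hSA : S ⊆ A := by
    intro i hi
    rw [hA, mem_eligible]
    exact (Finset.single_le_sum (fun k _ => hc k) hi).trans hSB
  have hfeas : ∀ X ⊆ S, ∑ i ∈ X, c i ≤ B := fun X hX =>
    (Finset.sum_le_sum_of_subset_of_nonneg hX fun k _ _ => hc k).trans hSB
  obtain ⟨G, hG, hGood⟩ := hv.card_balanced_samples S (hv.nonneg _) fun i hi => hm i (hSA hi)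
  refine ⟨mq, by exact_mod_cast hv.nonneg _, fun w hw hwm => ?_⟩
  set κ := 1 / Real.exp 1 - ε with hκ
  have hκ0 : 0 < κ := by
    have h1 : (1 : ℝ) / 3 < 1 / Real.exp 1 :=
      one_div_lt_one_div_of_lt (Real.exp_pos 1) (Real.exp_one_lt_d9.trans (by norm_num))
    linarith
  have hout : ∀ ω b, ((genSmMain alg₁ alg₂ v B) ω).outcome b = genSmOutcome alg₁ alg₂ v B ω b :=
    fun _ _ => rfl
  set M := Fintype.card (Fin (alg₁.bits n) → Bool) with hM
  set N := Fintype.card (Finset (Fin n)) with hN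
  have hlottery : ∀ u : Fin 1000, u.val < 201 →
      (N * M * mq : ℝ) ≤ ∑ y : Finset (Fin n) × (Fin (alg₁.bits n) → Bool),
        (v (genSmOutcome alg₁ alg₂ v B (u, y) c) : ℝ) := by
    intro u hu
    have : ∀ y, v (genSmOutcome alg₁ alg₂ v B (u, y) c) = mq := by
      intro y
      rw [genSmOutcome_lottery hu]
    simp [this, hN, hM]
  have hgreedy : ∀ u : Fin 1000, ¬ u.val < 201 →
      (N / 2 * ((1 - ε) * M) * w : ℝ) ≤ ∑ y : Finset (Fin n) × (Fin (alg₁.bits n) → Bool),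
        (v (genSmOutcome alg₁ alg₂ v B (u, y) c) : ℝ) := by
    intro u hu
    have hnn : ∀ y, (0 : ℝ) ≤ v (genSmOutcome alg₁ alg₂ v B (u, y) c) := fun y => by
      exact_mod_cast hv.nonneg _
    rcases hw.eq_or_lt with rfl | hwpos
    · rw [mul_zero]
      exact Finset.sum_nonneg fun y _ => hnn y
    obtain ⟨hmV, hw1, hw2⟩ := hwm hwpos
    rw [Fintype.sum_prod_type]
    have hR : ∀ R ∈ G, (1 - ε) * M * w ≤
        ∑ r, (v (genSmOutcome alg₁ alg₂ v B (u, R, r) c) : ℝ) := by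
      intro R hRG
      obtain ⟨⟨X, hX, hXq⟩, Y, hY, hYq⟩ := hGood R hRG
      obtain ⟨hrun, hcard⟩ := h₁ n v (A ∩ R) (proj (A ∩ R) c) B hv
        (fun i => by unfold proj; split_ifs <;> simp [hc i]) hB
      have hXA : X ⊆ A ∩ R := hX.trans (Finset.inter_subset_inter_right hSA)
      have hXo : (v X : ℝ) ≤ opt (A ∩ R) v (proj (A ∩ R) c) B :=
        le_opt hXA (by rw [sum_proj hXA]; exact hfeas X (hX.trans Finset.inter_subset_left))
      have hq : 0 < ((opt Finset.univ v c B - mq) / 4 : ℝ) := by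
        linarith
      have hXq' : ((opt Finset.univ v c B - mq) / 4 : ℝ) ≤ v X := by
        rw [hS]; exact_mod_cast hXq
      have hYq' : ((opt Finset.univ v c B - mq) / 4 : ℝ) ≤ v Y := by
        rw [hS]; exact_mod_cast hYq
      have hsample : ∀ r, sampleValue alg₁ v B (u, R, r) c =
          v (alg₁.run v (A ∩ R) (proj (A ∩ R) c) B r) := fun r => rfl
      set good := Finset.univ.filter (fun r => (1 / Real.exp 1 - ε) *
        opt (A ∩ R) v (proj (A ∩ R) c) B ≤
          (v (alg₁.run v (A ∩ R) (proj (A ∩ R) c) B r) : ℝ)) with hgood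
      rw [Nat.card_eq_fintype_card, Fintype.card_subtype] at hcard
      have hval : ∀ r ∈ good, w ≤ v (genSmOutcome alg₁ alg₂ v B (u, R, r) c) := by
        intro r hr
        have hr' := (Finset.mem_filter.1 hr).2
        refine le_trans (le_min hw1 hw2) (greedy_branch_value hv hB hc (ω := (u, R, r)) hu hq
          hκ0 (fun i hi => by exact_mod_cast hm i hi) (Y := Y) ?_
          (hfeas Y (hY.trans Finset.sdiff_subset)) hYq' ?_ ?_)
        · exact hY.trans (Finset.sdiff_subset_sdiff hSA subset_rfl)
        · rw [hsample]
          exact le_trans (mul_le_mul_of_nonneg_left (hXq'.trans hXo) hκ0.le) hr'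
        · rw [hsample]
          -- The output of `ALG₁` is feasible for the whole instance, so the sample value cannot
          -- exceed the optimum.
          refine le_opt (Finset.subset_univ _) ?_
          rw [← sum_proj (hrun r).1]
          exact (hrun r).2
      calc (1 - ε) * M * w ≤ good.card * w := mul_le_mul_of_nonneg_right hcard hw
        _ = ∑ _r ∈ good, w := by simp
        _ ≤ ∑ r ∈ good, (v (genSmOutcome alg₁ alg₂ v B (u, R, r) c) : ℝ) :=
          Finset.sum_le_sum hval
        _ ≤ _ := Finset.sum_le_sum_of_subset_of_nonneg (Finset.subset_univ _)
          fun r _ _ => hnn (R, r)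
    have hG' : (N / 2 : ℝ) ≤ G.card := by
      have : (N : ℝ) ≤ 2 * G.card := by exact_mod_cast hG
      linarith
    have hnn' : 0 ≤ (1 - ε) * M * w := by
      have : 0 ≤ 1 - ε := by linarith
      positivity
    calc (N / 2 * ((1 - ε) * M) * w : ℝ) = N / 2 * ((1 - ε) * M * w) := by ring
      _ ≤ G.card * ((1 - ε) * M * w) := mul_le_mul_of_nonneg_right hG' hnn'
      _ = ∑ _R ∈ G, (1 - ε) * M * w := by simp
      _ ≤ ∑ R ∈ G, ∑ r, (v (genSmOutcome alg₁ alg₂ v B (u, R, r) c) : ℝ) :=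
        Finset.sum_le_sum hR
      _ ≤ _ := Finset.sum_le_sum_of_subset_of_nonneg (Finset.subset_univ _)
          fun R _ _ => Finset.sum_nonneg fun r _ => hnn (R, r)
  have hN0 : (0 : ℝ) < N := by exact_mod_cast Fintype.card_pos
  have hM0 : (0 : ℝ) < M := by exact_mod_cast Fintype.card_pos
  rw [RandomizedMechanism.expectedValue]
  simp only [hout]
  have hcardΩ : (Fintype.card (Seed n (alg₁.bits n)) : ℝ) = 1000 * (N * M) := by
    rw [Fintype.card_prod, Fintype.card_prod, Fintype.card_fin]
    push_cast
    rfl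
  rw [hcardΩ, le_div_iff₀ (by positivity), Fintype.sum_prod_type]
  have hsplit : ∀ u : Fin 1000, (if u.val < 201 then (N * M * mq : ℝ)
      else N / 2 * ((1 - ε) * M) * w) ≤ ∑ y : Finset (Fin n) × (Fin (alg₁.bits n) → Bool),
        (v (genSmOutcome alg₁ alg₂ v B (u, y) c) : ℝ) := by
    intro u
    split_ifs with hu
    · exact hlottery u hu
    · exact hgreedy u hu
  refine le_trans (le_of_eq ?_) (Finset.sum_le_sum fun u _ => hsplit u)
  rw [Fin.sum_univ_eq_sum_range
    (fun u => if u < 201 then (N * M * mq : ℝ) else N / 2 * ((1 - ε) * M) * w) 1000,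
    Finset.sum_ite, Finset.sum_const, Finset.sum_const]
  have e1 : ((Finset.range 1000).filter (· < 201)).card = 201 := by
    have : (Finset.range 1000).filter (· < 201) = Finset.range 201 := by ext; simp; omega
    rw [this, Finset.card_range]
  have e2 : ((Finset.range 1000).filter (¬ · < 201)).card = 799 := by
    have h1 := Finset.card_filter_add_card_filter_not (s := Finset.range 1000) (· < 201)
    rw [e1, Finset.card_range] at h1
    omega
  rw [e1, e2]
  simp only [nsmul_eq_mul]
  push_cast
  ring

/-- The two guarantees of the greedy branch are `a ≈ 0.01001 (V - m) - m` and `b ≈ 0.00806 V -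
0.0625 m`. If `a ≤ 0`, then `m ≥ 0.0099 V` and the lottery alone yields more than `V / 503`. If `a >
0`, then `m` is so small that `b > 0`. The bound with `w = a` decreases in `m`, so its worst case is
again `a = 0`; the bound with `w = b` increases in `m` and exceeds `V / 311` already at `m = 0`. -/
theorem genSmMain_approximation (hv : IsValuation v) (hB : 0 < B)
    (h₁ : alg₁.IsApprox (1 / 10000)) {c : Fin n → ℝ} (hc : ∀ i, 0 ≤ c i) :
    opt Finset.univ v c B ≤ 505 * (genSmMain alg₁ alg₂ v B).expectedValue v c := by
  obtain ⟨m, hm0, hm⟩ := expectedValue_ge (alg₂ := alg₂) hv hB (by norm_num) (by norm_num) h₁ hc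
  set V := opt Finset.univ v c B with hV
  have hV0 : 0 ≤ V := by
    have := le_opt (v := v) (c := c) (B := B) (D := Finset.univ) (S := ∅) (by simp)
      (by simpa using hB.le)
    rwa [hv.normalized, Rat.cast_zero] at this
  -- The slack `ε = 1/10000` costs one unit in the last digit of `0.3678 < 1/e`.
  have he : (0.3677 : ℝ) ≤ 1 / Real.exp 1 - 1 / 10000 := by
    have : (0.3678 : ℝ) ≤ 1 / Real.exp 1 := by
      rw [le_div_iff₀ (Real.exp_pos 1)]
      nlinarith [Real.exp_one_lt_d9]
    linarith
  set a : ℝ := 0.3677 * ((V - m) / 4) / beta - m with ha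
  set b : ℝ := ((V - m) / 4 - 2 * (V / beta)) / 4 with hb
  have ha' : a = 3677 / 367400 * (V - m) - m := by
    rw [ha, beta]; ring
  have hb' : b = ((V - m) / 4 - 400 / 1837 * V) / 4 := by
    rw [hb, beta]; ring
  by_cases hcase : a ≤ 0
  · have h := hm 0 le_rfl fun h => absurd h (lt_irrefl _)
    rw [ha'] at hcase
    linarith
  · rw [not_le] at hcase
    have hVm : m < V := by
      rw [ha'] at hcase
      linarith
    have hb0 : 0 < b := by
      rw [ha'] at hcase
      rw [hb']
      linarith
    have h := hm (min a b) (le_min hcase.le hb0.le) fun _ =>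
      ⟨hVm, (min_le_left a b).trans ?_, min_le_right a b⟩
    · rcases min_choice a b with h' | h' <;> rw [h'] at h
      · rw [ha'] at h hcase
        linarith
      · rw [hb'] at h
        rw [ha'] at hcase
        linarith
    · have h1 : 0 ≤ (V - m) / 4 := by linarith
      have := div_le_div_of_nonneg_right (mul_le_mul_of_nonneg_right he h1) beta_pos.le
      linarith

end Approximation

end GenSm

/-! ### Running time: bit lengths, cost of programs and polynomial-time triples. -/

namespace GenSm

open Function

/-! ## Bit lengths -/

section BitSize

theorem size_mul_le (a b : ℕ) : Nat.size (a * b) ≤ Nat.size a + Nat.size b := by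
  rw [Nat.size_le, pow_add]
  exact Nat.mul_lt_mul'' (Nat.lt_size_self a) (Nat.lt_size_self b)

theorem size_add_le (a b : ℕ) : Nat.size (a + b) ≤ Nat.size a + Nat.size b + 1 := by
  rw [Nat.size_le, pow_succ]
  have h1 := (Nat.lt_size_self a).trans_le
    (Nat.pow_le_pow_right two_pos (Nat.le_add_right a.size b.size))
  have h2 := (Nat.lt_size_self b).trans_le
    (Nat.pow_le_pow_right two_pos (Nat.le_add_left b.size a.size))
  omega

theorem size_le_self (a : ℕ) : Nat.size a ≤ a := Nat.size_le.2 Nat.lt_two_pow_self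

theorem bitSize_zero : bitSize 0 = 1 := by simp [bitSize]

theorem bitSize_one : bitSize 1 = 2 := by simp [bitSize]

theorem bitSize_natCast (k : ℕ) : bitSize (k : ℚ) ≤ k + 1 := by
  have := size_le_self k
  simp only [bitSize, Rat.num_natCast, Int.natAbs_natCast, Rat.den_natCast, Nat.size_one]
  omega

/-- Reduction to lowest terms only shortens a fraction, because the reduced numerator and
denominator divide the given ones. The numerator zero is separate, since divisibility then bounds
nothing. All bounds for the arithmetic operations follow from their unreduced formulas. -/
theorem bitSize_divInt_le (a : ℤ) {b : ℤ} (hb : b ≠ 0) :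
    bitSize (Rat.divInt a b) ≤ Nat.size a.natAbs + Nat.size b.natAbs := by
  unfold bitSize
  have h2 := Int.natAbs_dvd_natAbs.2 (Rat.den_dvd a b)
  rw [Int.natAbs_natCast] at h2
  have h3 := Nat.size_le_size (Nat.le_of_dvd (Int.natAbs_pos.2 hb) h2)
  rcases eq_or_ne a 0 with rfl | ha
  · simpa [Nat.succ_le_iff] using Nat.size_pos.2 (Int.natAbs_pos.2 hb)
  · have h1 := Int.natAbs_dvd_natAbs.2 (Rat.num_dvd a hb)
    have h4 := Nat.size_le_size (Nat.le_of_dvd (Int.natAbs_pos.2 ha) h1)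
    omega

theorem bitSize_neg (q : ℚ) : bitSize (-q) = bitSize q := by simp [bitSize]

theorem bitSize_add_le (q r : ℚ) : bitSize (q + r) ≤ 2 * bitSize q + 2 * bitSize r + 2 := by
  rw [Rat.add_num_den]
  refine (bitSize_divInt_le _ (by simp)).trans ?_
  have h1 := Nat.size_le_size (Int.natAbs_add_le (q.num * r.den) (q.den * r.num))
  have h2 := size_add_le (q.num * r.den).natAbs (q.den * r.num).natAbs
  have h3 := size_mul_le q.num.natAbs r.den
  have h4 := size_mul_le q.den r.num.natAbs
  have h5 := size_mul_le q.den r.den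
  simp only [Int.natAbs_mul, Int.natAbs_natCast] at h1 h2 ⊢
  unfold bitSize
  omega

theorem bitSize_sub_le (q r : ℚ) : bitSize (q - r) ≤ 2 * bitSize q + 2 * bitSize r + 2 := by
  rw [sub_eq_add_neg, ← bitSize_neg r]
  exact bitSize_add_le q (-r)

theorem bitSize_mul_le (q r : ℚ) : bitSize (q * r) ≤ 2 * bitSize q + 2 * bitSize r + 2 := by
  rw [Rat.mul_eq_mkRat, Rat.mkRat_eq_divInt]
  refine (bitSize_divInt_le _ (by simp)).trans ?_
  have h3 := size_mul_le q.num.natAbs r.num.natAbs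
  have h5 := size_mul_le q.den r.den
  simp only [Int.natAbs_mul, Int.natAbs_natCast]
  unfold bitSize
  omega

theorem bitSize_inv_le (q : ℚ) : bitSize q⁻¹ ≤ bitSize q := by
  rcases eq_or_ne q 0 with rfl | hq
  · simp
  · rw [Rat.inv_def]
    refine (bitSize_divInt_le _ (by simpa using hq)).trans ?_
    simp only [Int.natAbs_natCast]
    unfold bitSize
    omega

theorem bitSize_div_le (q r : ℚ) : bitSize (q / r) ≤ 2 * bitSize q + 2 * bitSize r + 2 := by
  have h1 := bitSize_mul_le q r⁻¹
  have h2 := bitSize_inv_le r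
  rw [div_eq_mul_inv]
  omega

theorem bitSize_le_valueSize {n : ℕ} (v : Finset (Fin n) → ℚ) (S : Finset (Fin n)) :
    bitSize (v S) ≤ valueSize v :=
  Finset.le_sup (f := fun S => bitSize (v S)) (Finset.mem_univ S)

end BitSize

/-! ## Bounds on the memory -/

section Memory

/-- All the entries of the memory have bit length at most `M`. -/
def Small (M : ℕ) (σ : Memory) : Prop := ∀ a k, bitSize (σ a k) ≤ M

theorem Small.mono {M M' : ℕ} {σ : Memory} (h : Small M σ) (hM : M ≤ M') : Small M' σ :=
  fun a k => (h a k).trans hM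

theorem Small.write {M : ℕ} {σ : Memory} (h : Small M σ) {q : ℚ} (hq : bitSize q ≤ M) (a k : ℕ) :
    Small M (σ.write a k q) := by
  intro a' k'
  unfold Memory.write
  rcases eq_or_ne a' a with rfl | ha
  · rw [update_self]
    rcases eq_or_ne k' k with rfl | hk
    · rwa [update_self]
    · rw [update_of_ne hk]
      exact h _ _
  · rw [update_of_ne ha]
    exact h _ _

theorem Small.update {M : ℕ} {σ : Memory} (h : Small M σ) {f : ℕ → ℚ} (hf : ∀ k, bitSize (f k) ≤ M)
    (a : ℕ) : Small M (update σ a f) := by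
  intro a' k'
  rcases eq_or_ne a' a with rfl | ha
  · rw [update_self]
    exact hf k'
  · rw [update_of_ne ha]
    exact h _ _

theorem small_memoryOf {M : ℕ} (hM : 1 ≤ M) {l : List (ℕ → ℚ)}
    (hl : ∀ f ∈ l, ∀ k, bitSize (f k) ≤ M) : Small M (memoryOf l) := by
  intro a k
  unfold memoryOf
  rcases lt_or_ge a l.length with h | h
  · rw [List.getD_eq_getElem _ _ h]
    exact hl _ (List.getElem_mem h) k
  · rw [List.getD_eq_default _ _ h, bitSize_zero]
    exact hM

theorem Small.memoryOf_map {M : ℕ} {σ : Memory} (hM : 1 ≤ M) (h : Small M σ) (args : List ℕ) :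
    Small M (memoryOf (args.map σ)) := by
  refine small_memoryOf hM fun f hf k => ?_
  obtain ⟨a, -, rfl⟩ := List.mem_map.1 hf
  exact h a k

end Memory

/-! ## The cost of loop-free programs -/

section Straight

theorem bitSize_eval_le_cost (n : ℕ) (σ : Memory) (e : Expr) :
    bitSize (e.eval n σ) ≤ e.cost n σ := by
  cases e <;> simp only [Expr.cost, Expr.eval] <;> omega

/-- A bound for the cost of an expression, relative to the size of the memory. -/
def Expr.weight : Expr → ℕ
  | lit q => 1 + bitSize q
  | numAgents => 1
  | get _ e => 1 + e.weight
  | plus e₁ e₂ => 3 + 3 * e₁.weight + 3 * e₂.weight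
  | minus e₁ e₂ => 3 + 3 * e₁.weight + 3 * e₂.weight
  | times e₁ e₂ => 3 + 3 * e₁.weight + 3 * e₂.weight
  | quot e₁ e₂ => 3 + 3 * e₁.weight + 3 * e₂.weight

theorem Expr.cost_le {n M : ℕ} {σ : Memory} (hn : n + 1 ≤ M) (h : Small M σ) (e : Expr) :
    e.cost n σ ≤ e.weight * (M + 1) := by
  induction e with
  | lit q =>
    simp only [cost, weight]
    exact Nat.le_mul_of_pos_right _ (by omega)
  | numAgents =>
    have := bitSize_natCast n
    simp only [cost, weight]
    omega
  | get a e ih =>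
    have := h a ⌊e.eval n σ⌋₊
    simp only [cost, weight, eval, add_mul]
    omega
  | plus e₁ e₂ ih₁ ih₂ =>
    -- One unit for the node, at most `2 c₁ + 2 c₂ + 2` bits for the value, and `c₁ + c₂` for the
    -- operands: together `3 + 3 c₁ + 3 c₂`, which is the recursion of `weight`.
    have := bitSize_add_le (e₁.eval n σ) (e₂.eval n σ)
    have := bitSize_eval_le_cost n σ e₁
    have := bitSize_eval_le_cost n σ e₂
    simp only [cost, weight, eval, add_mul, mul_assoc]
    omega
  | minus e₁ e₂ ih₁ ih₂ =>
    have := bitSize_sub_le (e₁.eval n σ) (e₂.eval n σ)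
    have := bitSize_eval_le_cost n σ e₁
    have := bitSize_eval_le_cost n σ e₂
    simp only [cost, weight, eval, add_mul, mul_assoc]
    omega
  | times e₁ e₂ ih₁ ih₂ =>
    have := bitSize_mul_le (e₁.eval n σ) (e₂.eval n σ)
    have := bitSize_eval_le_cost n σ e₁
    have := bitSize_eval_le_cost n σ e₂
    simp only [cost, weight, eval, add_mul, mul_assoc]
    omega
  | quot e₁ e₂ ih₁ ih₂ =>
    have := bitSize_div_le (e₁.eval n σ) (e₂.eval n σ)
    have := bitSize_eval_le_cost n σ e₁
    have := bitSize_eval_le_cost n σ e₂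
    simp only [cost, weight, eval, add_mul, mul_assoc]
    omega

/-- A program cannot write numbers that are longer than its running time. -/
theorem Exec.small {n : ℕ} {v : Finset (Fin n) → ℚ} {P : Program} {σ σ' : Memory} {t : ℕ}
    (h : Exec v P σ σ' t) {M : ℕ} (hM : 1 ≤ M) (hσ : Small M σ) : Small (M + t) σ' := by
  induction h generalizing M with
  | skip σ => exact hσ.mono (by omega)
  | assign σ a k e =>
    have := bitSize_eval_le_cost n σ e
    exact (hσ.mono (by omega)).write (by omega) _ _
  | query σ a k s => exact (hσ.mono (by omega)).write (by omega) _ _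
  | seq _ _ ih₁ ih₂ => exact (ih₂ (by omega) (ih₁ hM hσ)).mono (by omega)
  | branchTrue _ _ ih => exact (ih hM hσ).mono (by omega)
  | branchFalse _ _ ih => exact (ih hM hσ).mono (by omega)
  | loopTrue _ _ _ ih₁ ih₂ => exact (ih₂ (by omega) (ih₁ hM hσ)).mono (by omega)
  | loopFalse _ => exact hσ.mono (by omega)
  | @call P args out σ σ' t _ ih =>
    refine (hσ.mono (by omega)).update (fun k => ?_) _
    exact (ih hM (hσ.memoryOf_map hM args) 0 k).trans (by omega)

/-- The final memory of a program without loops. -/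
noncomputable def Program.denote {n : ℕ} (v : Finset (Fin n) → ℚ) : Program → Memory → Memory
  | skip, σ => σ
  | assign a k e, σ => σ.write a ⌊k.eval n σ⌋₊ (e.eval n σ)
  | query a k s, σ => σ.write a ⌊k.eval n σ⌋₊ (v (toSet n (σ s)))
  | seq P Q, σ => Q.denote v (P.denote v σ)
  | branch e₁ e₂ P Q, σ => if e₁.eval n σ ≤ e₂.eval n σ then P.denote v σ else Q.denote v σ
  | loop _ _ _, σ => σ
  | call P args out, σ => update σ out (P.denote v (memoryOf (args.map σ)) 0)

/-- Programs without loops. -/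
def Program.Straight : Program → Prop
  | skip => True
  | assign _ _ _ => True
  | query _ _ _ => True
  | seq P Q => P.Straight ∧ Q.Straight
  | branch _ _ P Q => P.Straight ∧ Q.Straight
  | loop _ _ _ => False
  | call P _ _ => P.Straight

-- By `Exec.small` the entries grow by at most the running time, so in a sequence the second bound
-- is evaluated at `X + p`. The degree depends on the program, not on the input.
open Polynomial in
theorem Program.Straight.exec {P : Program} (hP : P.Straight) :
    ∃ p : ℕ[X], ∀ (n : ℕ) (v : Finset (Fin n) → ℚ) (M : ℕ) (σ : Memory), n + 1 ≤ M →
      valueSize v ≤ M → Small M σ → ∃ t ≤ p.eval M, Exec v P σ (P.denote v σ) t := by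
  induction P with
  | skip => exact ⟨C 1, fun n v M σ _ _ _ => ⟨1, by simp, Exec.skip σ⟩⟩
  | assign a k e =>
    refine ⟨C 1 + C (k.weight + e.weight) * (X + C 1), fun n v M σ hn _ hσ =>
      ⟨_, ?_, Exec.assign σ a k e⟩⟩
    have := k.cost_le hn hσ
    have := e.cost_le hn hσ
    simp only [eval_add, eval_mul, eval_C, eval_X, add_mul]
    omega
  | query a k s =>
    refine ⟨C 1 + C k.weight * (X + C 1) + C 2 * X, fun n v M σ hn hv hσ =>
      ⟨_, ?_, Exec.query σ a k s⟩⟩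
    have := k.cost_le hn hσ
    have := bitSize_le_valueSize v (toSet n (σ s))
    simp only [eval_add, eval_mul, eval_C, eval_X]
    omega
  | seq P Q ihP ihQ =>
    obtain ⟨p, hp⟩ := ihP hP.1
    obtain ⟨q, hq⟩ := ihQ hP.2
    refine ⟨C 1 + p + q.comp (X + p), fun n v M σ hn hv hσ => ?_⟩
    obtain ⟨t, ht, h⟩ := hp n v M σ hn hv hσ
    obtain ⟨t', ht', h'⟩ := hq n v (M + p.eval M) _ (by omega) (by omega)
      ((h.small (by omega) hσ).mono (by omega))
    refine ⟨_, ?_, Exec.seq h h'⟩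
    simp only [eval_add, eval_comp, eval_C, eval_X]
    omega
  | branch e₁ e₂ P Q ihP ihQ =>
    obtain ⟨p, hp⟩ := ihP hP.1
    obtain ⟨q, hq⟩ := ihQ hP.2
    refine ⟨C 1 + C (e₁.weight + e₂.weight) * (X + C 1) + p + q, fun n v M σ hn hv hσ => ?_⟩
    have := e₁.cost_le hn hσ
    have := e₂.cost_le hn hσ
    simp only [eval_add, eval_mul, eval_C, eval_X, add_mul, denote]
    split_ifs with hc
    · obtain ⟨t, ht, h⟩ := hp n v M σ hn hv hσ
      exact ⟨_, by omega, Exec.branchTrue hc h⟩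
    · obtain ⟨t, ht, h⟩ := hq n v M σ hn hv hσ
      exact ⟨_, by omega, Exec.branchFalse hc h⟩
  | loop e₁ e₂ P _ => exact hP.elim
  | call P args out ih =>
    obtain ⟨p, hp⟩ := ih hP
    refine ⟨C 1 + C args.length + p, fun n v M σ hn hv hσ => ?_⟩
    obtain ⟨t, ht, h⟩ := hp n v M _ hn hv (hσ.memoryOf_map (by omega) args)
    refine ⟨_, ?_, Exec.call h⟩
    simp only [eval_add, eval_C]
    omega

end Straight

/-! ## Polynomial-time Hoare triples -/

section Triples

open Polynomial

/-- A value oracle and a bound for the number of agents and for the bit length of the values. -/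
structure Oracle where
  n : ℕ
  v : Finset (Fin n) → ℚ
  M : ℕ
  n_lt : n + 1 ≤ M
  size_le : valueSize v ≤ M

/-- Started in a polynomially bounded memory with the property `Pre`, the program `P` halts after
polynomial time in a memory with the property `Post`. -/
def PolyTriple {ι : Type} (J : ι → Oracle) (P : Program) (Pre Post : ι → Memory → Prop) : Prop :=
  ∀ q : ℕ[X], ∃ p : ℕ[X], ∀ i σ, Small (q.eval (J i).M) σ → Pre i σ →
    ∃ σ' t, Exec (J i).v P σ σ' t ∧ t ≤ p.eval (J i).M ∧ Post i σ'

variable {ι : Type} {J : ι → Oracle} {P Q : Program} {Pre Mid Post : ι → Memory → Prop}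

theorem PolyTriple.conseq {Pre' Post' : ι → Memory → Prop} (h : PolyTriple J P Pre Post)
    (h1 : ∀ i σ, Pre' i σ → Pre i σ) (h2 : ∀ i σ, Post i σ → Post' i σ) :
    PolyTriple J P Pre' Post' := by
  intro q
  obtain ⟨p, hp⟩ := h q
  refine ⟨p, fun i σ hσ hpre => ?_⟩
  obtain ⟨σ', t, h3, h4, h5⟩ := hp i σ hσ (h1 i σ hpre)
  exact ⟨σ', t, h3, h4, h2 i σ' h5⟩

/-- Triples quantify over all polynomial bounds on the initial memory precisely for this rule: the
second program is started with the bound `q + X + p` that the first one leaves behind. -/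
theorem PolyTriple.seq (hP : PolyTriple J P Pre Mid) (hQ : PolyTriple J Q Mid Post) :
    PolyTriple J (.seq P Q) Pre Post := by
  intro q
  obtain ⟨p, hp⟩ := hP q
  obtain ⟨p', hp'⟩ := hQ (q + X + p)
  refine ⟨C 1 + p + p', fun i σ hσ hpre => ?_⟩
  have hM := (J i).n_lt
  obtain ⟨σ', t, h, ht, hmid⟩ := hp i σ hσ hpre
  obtain ⟨σ'', t', h', ht', hpost⟩ := hp' i σ' (by
    refine (h.small (M := q.eval (J i).M + (J i).M) (by omega) (hσ.mono (by omega))).mono ?_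
    simp only [eval_add, eval_X]
    omega) hmid
  refine ⟨σ'', _, Exec.seq h h', ?_, hpost⟩
  simp only [eval_add, eval_C]
  omega

theorem PolyTriple.straight (hP : P.Straight)
    (h : ∀ i σ, Pre i σ → Post i (P.denote (J i).v σ)) : PolyTriple J P Pre Post := by
  intro q
  obtain ⟨p, hp⟩ := hP.exec
  refine ⟨p.comp (q + X), fun i σ hσ hpre => ?_⟩
  have hM := (J i).n_lt
  have hV := (J i).size_le
  obtain ⟨t, ht, he⟩ := hp (J i).n (J i).v (q.eval (J i).M + (J i).M) σ (by omega) (by omega)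
    (hσ.mono (by omega))
  exact ⟨_, t, he, by simpa using ht, h i σ hpre⟩

theorem PolyTriple.branch {e₁ e₂ : Expr}
    (hP : PolyTriple J P (fun i σ => Pre i σ ∧ e₁.eval (J i).n σ ≤ e₂.eval (J i).n σ) Post)
    (hQ : PolyTriple J Q (fun i σ => Pre i σ ∧ ¬ e₁.eval (J i).n σ ≤ e₂.eval (J i).n σ) Post) :
    PolyTriple J (.branch e₁ e₂ P Q) Pre Post := by
  intro q
  obtain ⟨p, hp⟩ := hP q
  obtain ⟨p', hp'⟩ := hQ q
  refine ⟨C 1 + C (e₁.weight + e₂.weight) * (q + X + C 1) + p + p', fun i σ hσ hpre => ?_⟩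
  have hM := (J i).n_lt
  have hσ' : Small (q.eval (J i).M + (J i).M) σ := hσ.mono (by omega)
  have := e₁.cost_le (n := (J i).n) (by omega) hσ'
  have := e₂.cost_le (n := (J i).n) (by omega) hσ'
  simp only [eval_add, eval_mul, eval_C, eval_X, add_mul]
  by_cases hc : e₁.eval (J i).n σ ≤ e₂.eval (J i).n σ
  · obtain ⟨σ', t, h, ht, hpost⟩ := hp i σ hσ ⟨hpre, hc⟩
    exact ⟨σ', _, Exec.branchTrue hc h, by omega, hpost⟩
  · obtain ⟨σ', t, h, ht, hpost⟩ := hp' i σ hσ ⟨hpre, hc⟩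
    exact ⟨σ', _, Exec.branchFalse hc h, by omega, hpost⟩

/-- On arguments with the property `Dom`, the subroutine `P` returns an array with the property `R`
in polynomial time. -/
def Computes (P : Program)
    (Dom : (n : ℕ) → (Finset (Fin n) → ℚ) → List (ℕ → ℚ) → Prop)
    (R : (n : ℕ) → (Finset (Fin n) → ℚ) → List (ℕ → ℚ) → (ℕ → ℚ) → Prop) : Prop :=
  ∃ p : ℕ[X], ∀ (n : ℕ) (v : Finset (Fin n) → ℚ) (M : ℕ) (l : List (ℕ → ℚ)), n + 1 ≤ M →
    valueSize v ≤ M → (∀ f ∈ l, ∀ k, bitSize (f k) ≤ M) → Dom n v l →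
      ∃ σ t, Exec v P (memoryOf l) σ t ∧ t ≤ p.eval M ∧ R n v l (σ 0)

theorem PolyTriple.call
    {Dom : (n : ℕ) → (Finset (Fin n) → ℚ) → List (ℕ → ℚ) → Prop}
    {R : (n : ℕ) → (Finset (Fin n) → ℚ) → List (ℕ → ℚ) → (ℕ → ℚ) → Prop}
    (hP : Computes P Dom R) {args : List ℕ} {out : ℕ}
    (hdom : ∀ i σ, Pre i σ → Dom (J i).n (J i).v (args.map σ))
    (hR : ∀ i σ o, Pre i σ → R (J i).n (J i).v (args.map σ) o → Post i (update σ out o)) :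
    PolyTriple J (.call P args out) Pre Post := by
  intro q
  obtain ⟨p, hp⟩ := hP
  refine ⟨C 1 + C args.length + p.comp (q + X), fun i σ hσ hpre => ?_⟩
  have hM := (J i).n_lt
  have hV := (J i).size_le
  obtain ⟨σ', t, h, ht, hr⟩ := hp (J i).n (J i).v (q.eval (J i).M + (J i).M) (args.map σ)
    (by omega) (by omega) (fun f hf k => by
      obtain ⟨a, -, rfl⟩ := List.mem_map.1 hf
      exact (hσ a k).trans (by omega)) (hdom i σ hpre)
  refine ⟨_, _, Exec.call h, ?_, hR i σ _ hpre hr⟩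
  simp only [eval_add, eval_C, eval_comp, eval_X]
  omega

/-- Repeat `P` for the values `0, …, n - 1` of the counter, which is the array `ctr`. -/
def forLoop (ctr : ℕ) (P : Program) : Program :=
  .seq (.assign ctr (.lit 0) (.lit 0))
    (.loop (.plus (.get ctr (.lit 0)) (.lit 1)) .numAgents
      (.seq P (.assign ctr (.lit 0) (.plus (.get ctr (.lit 0)) (.lit 1)))))

/-- The invariant is stated after the increment of the counter, and the test is `k + 1 ≤ n` because
only non-strict comparisons are available. Counter values have at most linear bit length, so the
overhead per round is absorbed by `10 * n + 100`. -/
theorem exec_forLoop {n : ℕ} {v : Finset (Fin n) → ℚ} {ctr T : ℕ} {I : ℕ → Memory → Prop}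
    (hctr : ∀ k σ, I k σ → σ ctr 0 = k)
    (hbody : ∀ k σ, k < n → I k σ → ∃ σ' t, Exec v P σ σ' t ∧ t ≤ T ∧ σ' ctr 0 = k ∧
      I (k + 1) (σ'.write ctr 0 ((k : ℚ) + 1)))
    {σ : Memory} (hσ : I 0 (σ.write ctr 0 0)) :
    ∃ σ' t, Exec v (forLoop ctr P) σ σ' t ∧ t ≤ (n + 1) * (T + 10 * n + 100) ∧ I n σ' := by
  have hcost : ∀ (k : ℕ) (σ : Memory), k ≤ n → σ ctr 0 = k →
      (Expr.plus (.get ctr (.lit 0)) (.lit 1)).cost n σ ≤ 4 * n + 20 := by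
    intro k σ hk h
    have h1 := bitSize_natCast k
    have h2 := bitSize_natCast (k + 1)
    push_cast at h2
    simp only [Expr.cost, Expr.eval, Nat.floor_zero, h, bitSize_zero, bitSize_one]
    omega
  have hnum : ∀ σ : Memory, Expr.numAgents.cost n σ ≤ n + 2 := by
    intro σ
    have := bitSize_natCast n
    simp only [Expr.cost]
    omega
  have hloop : ∀ r k σ, k + r = n → I k σ → ∃ σ' t,
      Exec v (.loop (.plus (.get ctr (.lit 0)) (.lit 1)) .numAgents
        (.seq P (.assign ctr (.lit 0) (.plus (.get ctr (.lit 0)) (.lit 1))))) σ σ' t ∧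
        t ≤ (r + 1) * (T + 10 * n + 60) ∧ I n σ' := by
    intro r
    induction r with
    | zero =>
      intro k σ hk hI
      obtain rfl : k = n := by omega
      have h1 := hcost k σ le_rfl (hctr k σ hI)
      have h2 := hnum σ
      refine ⟨σ, _, Exec.loopFalse ?_, ?_, hI⟩
      · simp [Expr.eval, hctr k σ hI]
      · omega
    | succ r ih =>
      intro k σ hk hI
      have h0 := hctr k σ hI
      have h1 := hcost k σ (by omega) h0
      have h2 := hnum σ
      obtain ⟨σ₁, t₁, he₁, ht₁, hc₁, hI₁⟩ := hbody k σ (by omega) hI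
      have h3 := hcost k σ₁ (by omega) hc₁
      obtain ⟨σ₂, t₂, he₂, ht₂, hI₂⟩ := ih (k + 1) _ (by omega) hI₁
      have hassign := Exec.assign (v := v) σ₁ ctr (.lit 0) (.plus (.get ctr (.lit 0)) (.lit 1))
      have hval : σ₁.write ctr ⌊(Expr.lit 0).eval n σ₁⌋₊
          ((Expr.plus (.get ctr (.lit 0)) (.lit 1)).eval n σ₁) =
          σ₁.write ctr 0 ((k : ℚ) + 1) := by
        simp [Expr.eval, hc₁]
      rw [hval] at hassign
      refine ⟨σ₂, _, Exec.loopTrue ?_ (Exec.seq he₁ hassign) he₂, ?_, hI₂⟩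
      · simp only [Expr.eval, Nat.floor_zero, h0]
        exact_mod_cast (by omega : k + 1 ≤ n)
      · have h4 : (Expr.lit 0).cost n σ₁ = 2 := by simp [Expr.cost, bitSize_zero]
        rw [h4, add_mul (r + 1) 1]
        omega
  obtain ⟨σ', t, he, ht, hI⟩ := hloop n 0 _ (by omega) hσ
  have hassign := Exec.assign (v := v) σ ctr (.lit 0) (.lit 0)
  have hval : σ.write ctr ⌊(Expr.lit 0).eval n σ⌋₊ ((Expr.lit 0).eval n σ) = σ.write ctr 0 0 := by
    simp [Expr.eval]
  rw [hval] at hassign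
  refine ⟨σ', _, Exec.seq hassign he, ?_, hI⟩
  simp only [Expr.cost, bitSize_zero]
  have : (n + 1) * (T + 10 * n + 100) = (n + 1) * (T + 10 * n + 60) + (n + 1) * 40 := by ring
  omega

/-- The rule for loops. The body has to preserve the property `I` and every bound for the memory that
is at least the polynomial bound `r`. -/
theorem PolyTriple.forLoop {ctr : ℕ} {I : ι → ℕ → Memory → Prop} (r : ℕ[X])
    (hctr : ∀ i k σ, I i k σ → σ ctr 0 = k)
    (hbody : ∀ q : ℕ[X], ∃ p : ℕ[X], ∀ i k σ M, M = (q + r + X + C 1).eval (J i).M → k < (J i).n →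
      Small M σ → I i k σ → ∃ σ' t, Exec (J i).v P σ σ' t ∧ t ≤ p.eval (J i).M ∧ Small M σ' ∧
        σ' ctr 0 = k ∧ I i (k + 1) (σ'.write ctr 0 ((k : ℚ) + 1))) :
    PolyTriple J (GenSm.forLoop ctr P) (fun i σ => I i 0 (σ.write ctr 0 0))
      (fun i σ => I i (J i).n σ) := by
  intro q
  obtain ⟨p, hp⟩ := hbody q
  refine ⟨(X + C 1) * (p + C 10 * X + C 100), fun i σ hσ hpre => ?_⟩
  have hn := (J i).n_lt
  -- One bound for all `n` rounds; a bound multiplied by a constant in every round would become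
  -- exponential. The summand `X + 1` makes room for the counter.
  set M := (q + r + X + C 1).eval (J i).M with hM
  have hMle : q.eval (J i).M + (J i).M + 1 ≤ M := by
    simp only [hM, eval_add, eval_X, eval_C]
    omega
  obtain ⟨σ', t, he, ht, hI⟩ := exec_forLoop (v := (J i).v) (P := P) (ctr := ctr)
    (T := p.eval (J i).M) (I := fun k σ => I i k σ ∧ Small M σ)
    (fun k σ h => hctr i k σ h.1)
    (fun k σ hk h => by
      obtain ⟨σ', t, he, ht, hs, hc, hI⟩ := hp i k σ M rfl hk h.2 h.1
      refine ⟨σ', t, he, ht, hc, hI, hs.write ?_ _ _⟩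
      have := bitSize_natCast (k + 1)
      push_cast at this
      omega)
    (σ := σ) ⟨hpre, (hσ.mono (by omega)).write (by rw [bitSize_zero]; omega) _ _⟩
  refine ⟨σ', t, he, ht.trans ?_, hI.1⟩
  simp only [eval_add, eval_mul, eval_X, eval_C]
  exact Nat.mul_le_mul (by omega) (by omega)

/-- The rule for loops with a loop-free body. -/
theorem PolyTriple.forLoop_straight {ctr : ℕ} {I : ι → ℕ → Memory → Prop} (r : ℕ[X])
    (hP : P.Straight) (hctr : ∀ i k σ, I i k σ → σ ctr 0 = k)
    (hsmall : ∀ i k σ M, k < (J i).n → r.eval (J i).M + (J i).M + 1 ≤ M → Small M σ → I i k σ →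
      Small M (P.denote (J i).v σ))
    (hbody : ∀ i k σ, k < (J i).n → I i k σ → P.denote (J i).v σ ctr 0 = k ∧
      I i (k + 1) ((P.denote (J i).v σ).write ctr 0 ((k : ℚ) + 1))) :
    PolyTriple J (GenSm.forLoop ctr P) (fun i σ => I i 0 (σ.write ctr 0 0))
      (fun i σ => I i (J i).n σ) := by
  refine PolyTriple.forLoop r hctr fun q => ?_
  obtain ⟨p, hp⟩ := hP.exec
  refine ⟨p.comp (q + r + X + C 1), fun i k σ M hM hk hσ hI => ?_⟩
  have hMle : q.eval (J i).M + r.eval (J i).M + (J i).M + 1 = M := by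
    simp only [hM, eval_add, eval_X, eval_C]
  have hn := (J i).n_lt
  have hV := (J i).size_le
  obtain ⟨t, ht, he⟩ := hp (J i).n (J i).v M σ (by omega) (by omega) hσ
  obtain ⟨hc, hI'⟩ := hbody i k σ hk hI
  refine ⟨_, t, he, ?_, hsmall i k σ M hk (by omega) hσ hI, hc, hI'⟩
  rwa [eval_comp, ← hM]

theorem eval_mono (p : ℕ[X]) {a b : ℕ} (h : a ≤ b) : p.eval a ≤ p.eval b := by
  rw [eval_eq_sum_range, eval_eq_sum_range]
  gcongr

end Triples

end GenSm

/-! ### Concrete programs: encodings of the data and verified subroutines. -/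

namespace GenSm

open Function

/-! ## Arrays -/

section Arrays

variable {n : ℕ}

theorem ofVector_apply (c : Fin n → ℚ) (i : Fin n) : ofVector c i = c i := by
  simp [ofVector]

theorem ofVector_injective : Injective (ofVector : (Fin n → ℚ) → ℕ → ℚ) := by
  intro c c' h
  funext i
  rw [← ofVector_apply c, h, ofVector_apply]

theorem ofSet_apply (S : Finset (Fin n)) (i : Fin n) : ofSet S i = if i ∈ S then 1 else 0 :=
  ofVector_apply _ i

theorem toSet_ofSet (S : Finset (Fin n)) : toSet n (ofSet S) = S := by
  ext i
  simp [toSet, ofSet_apply]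

theorem ofSet_injective : Injective (ofSet : Finset (Fin n) → ℕ → ℚ) :=
  LeftInverse.injective toSet_ofSet

theorem ofBits_injective : Injective (ofBits : (Fin n → Bool) → ℕ → ℚ) := by
  intro r r' h
  funext i
  have := congrFun h i
  rw [ofBits, ofBits, ofVector_apply, ofVector_apply] at this
  cases h1 : r i <;> cases h2 : r' i <;> simp_all

theorem ofNumber_zero (q : ℚ) : ofNumber q 0 = q := rfl

theorem ofNumber_injective : Injective ofNumber := fun _ _ h => congrFun h 0

theorem update_ofNumber (q q' : ℚ) : update (ofNumber q) 0 q' = ofNumber q' := by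
  funext k
  rcases eq_or_ne k 0 with rfl | hk
  · simp [ofNumber]
  · simp [ofNumber, hk]

theorem update_zero_eq_ofNumber (q : ℚ) : update (fun _ => 0) 0 q = ofNumber q := by
  funext k
  rcases eq_or_ne k 0 with rfl | hk
  · simp [ofNumber]
  · simp [ofNumber, hk]

theorem ofSet_empty : ofSet (∅ : Finset (Fin n)) = fun _ => 0 := by
  funext k
  simp [ofSet, ofVector]

theorem update_ofVector (c : Fin n → ℚ) (i : Fin n) (q : ℚ) :
    update (ofVector c) i q = ofVector (update c i q) := by
  funext k
  rcases eq_or_ne k i with rfl | hk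
  · rw [update_self, ofVector_apply, update_self]
  · rw [update_of_ne hk]
    unfold ofVector
    split_ifs with h
    · rw [update_of_ne]
      rintro rfl
      exact hk rfl
    · rfl

theorem update_ofSet_one (S : Finset (Fin n)) (i : Fin n) :
    update (ofSet S) i 1 = ofSet (insert i S) := by
  rw [ofSet, update_ofVector, ofSet]
  congr 1
  funext k
  rcases eq_or_ne k i with rfl | hk
  · simp
  · simp [hk]

theorem update_ofSet_zero (S : Finset (Fin n)) (i : Fin n) :
    update (ofSet S) i 0 = ofSet (S.erase i) := by
  rw [ofSet, update_ofVector, ofSet]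
  congr 1
  funext k
  rcases eq_or_ne k i with rfl | hk
  · simp
  · simp [hk]

/-- The array with the entries of `f` whose index is less than `k`. -/
def upTo (k : ℕ) (f : ℕ → ℚ) : ℕ → ℚ := fun a => if a < k then f a else 0

theorem upTo_zero (f : ℕ → ℚ) : upTo 0 f = fun _ => 0 := by
  funext a
  simp [upTo]

theorem upTo_succ (k : ℕ) (f : ℕ → ℚ) : upTo (k + 1) f = update (upTo k f) k (f k) := by
  funext a
  rcases eq_or_ne a k with rfl | ha
  · simp [upTo]
  · rw [update_of_ne ha]
    have : a < k + 1 ↔ a < k := by omega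
    simp [upTo, this]

theorem upTo_succ_of_eq_zero {k : ℕ} {f : ℕ → ℚ} (h : f k = 0) : upTo (k + 1) f = upTo k f := by
  rw [upTo_succ, h]
  funext a
  rcases eq_or_ne a k with rfl | ha
  · simp [upTo]
  · rw [update_of_ne ha]

theorem upTo_ofVector (c : Fin n → ℚ) : upTo n (ofVector c) = ofVector c := by
  funext a
  unfold upTo ofVector
  split_ifs <;> rfl

theorem upTo_ofSet (S : Finset (Fin n)) : upTo n (ofSet S) = ofSet S := upTo_ofVector _

theorem bitSize_ofNumber_le {M : ℕ} (hM : 1 ≤ M) {q : ℚ} (hq : bitSize q ≤ M) (k : ℕ) :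
    bitSize (ofNumber q k) ≤ M := by
  unfold ofNumber
  split_ifs
  · exact hq
  · rwa [bitSize_zero]

theorem bitSize_ofVector_le {M : ℕ} (hM : 1 ≤ M) {c : Fin n → ℚ} (hc : ∀ i, bitSize (c i) ≤ M)
    (k : ℕ) : bitSize (ofVector c k) ≤ M := by
  unfold ofVector
  split_ifs
  · exact hc _
  · rwa [bitSize_zero]

theorem bitSize_ofSet_le {M : ℕ} (hM : 2 ≤ M) (S : Finset (Fin n)) (k : ℕ) :
    bitSize (ofSet S k) ≤ M := by
  refine bitSize_ofVector_le (by omega) (fun i => ?_) k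
  split_ifs
  · rwa [bitSize_one]
  · rw [bitSize_zero]
    omega

theorem write_same (σ : Memory) (a k : ℕ) (q : ℚ) : σ.write a k q a = update (σ a) k q := by
  simp [Memory.write]

theorem write_of_ne (σ : Memory) {a a' : ℕ} (h : a' ≠ a) (k : ℕ) (q : ℚ) :
    σ.write a k q a' = σ a' := by
  simp [Memory.write, h]

theorem bitSize_marginal_le {v : Finset (Fin n) → ℚ} {M : ℕ} (hv : valueSize v ≤ M)
    (S : Finset (Fin n)) (i : Fin n) : bitSize (marginal v S i) ≤ 4 * M + 2 := by
  have h1 := bitSize_sub_le (v (insert i S)) (v S)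
  have h2 := bitSize_le_valueSize v (insert i S)
  have h3 := bitSize_le_valueSize v S
  unfold marginal
  omega

end Arrays

/-! ## Subroutines -/

section Subroutines

/-- The inputs of a subroutine. -/
structure CallInput (Dom : (n : ℕ) → (Finset (Fin n) → ℚ) → List (ℕ → ℚ) → Prop)
    extends Oracle where
  args : List (ℕ → ℚ)
  dom : Dom n v args

theorem Computes.of_polyTriple {P : Program}
    {Dom : (n : ℕ) → (Finset (Fin n) → ℚ) → List (ℕ → ℚ) → Prop}
    {R : (n : ℕ) → (Finset (Fin n) → ℚ) → List (ℕ → ℚ) → (ℕ → ℚ) → Prop}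
    (h : PolyTriple (fun i : CallInput Dom => i.toOracle) P (fun i σ => σ = memoryOf i.args)
      (fun i σ => R i.n i.v i.args (σ 0))) : Computes P Dom R := by
  obtain ⟨p, hp⟩ := h Polynomial.X
  refine ⟨p, fun n v M l hn hv hl hd => ?_⟩
  exact hp ⟨⟨n, v, M, hn, hv⟩, l, hd⟩ _
    (by simpa using small_memoryOf (by omega) hl) rfl

/-- The encodings are injective, so the argument arrays determine the instance and the specification
can quantify over all of its decodings. With `n` costs of at most `M` bits, `3 X + X * X` dominates
the instance size. -/
theorem Computes.knapsack {alg : KnapsackAlg} (h : alg.PolyTime) :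
    ∃ P, Computes P
      (fun n v l => IsValuation v ∧ ∃ (D : Finset (Fin n)) (c : Fin n → ℚ) (B : ℚ)
        (r : Fin (alg.bits n) → Bool), (∀ i, 0 ≤ c i) ∧ 0 < B ∧
          l = [ofNumber B, ofVector c, ofSet D, ofBits r])
      (fun n v l o => ∀ (D : Finset (Fin n)) (c : Fin n → ℚ) (B : ℚ)
        (r : Fin (alg.bits n) → Bool), l = [ofNumber B, ofVector c, ofSet D, ofBits r] →
          toSet n o = alg.run v D (fun i => (c i : ℝ)) B r) := by
  obtain ⟨P, p, hp⟩ := h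
  refine ⟨P, p.comp (3 * Polynomial.X + Polynomial.X * Polynomial.X),
    fun n v M l hn hV hl hd => ?_⟩
  obtain ⟨hv, D, c, B, r, hc, hB, rfl⟩ := hd
  obtain ⟨σ, t, he, hs, ht⟩ := hp n v D c B r hv hc hB
  refine ⟨σ, t, he, ht.trans ?_, ?_⟩
  · rw [Polynomial.eval_comp]
    refine eval_mono p ?_
    have h1 : bitSize B ≤ M := hl (ofNumber B) (by simp) 0
    have h2 : ∑ i, bitSize (c i) ≤ ∑ _i : Fin n, M := Finset.sum_le_sum fun i _ => by
      rw [← ofVector_apply c i]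
      exact hl (ofVector c) (by simp) i
    have h3 : n * M ≤ M * M := Nat.mul_le_mul_right M (by omega)
    simp only [Finset.sum_const, Finset.card_univ, Fintype.card_fin, smul_eq_mul] at h2
    simp only [instanceSize, Polynomial.eval_add, Polynomial.eval_mul, Polynomial.eval_X,
      Polynomial.eval_ofNat]
    omega
  · intro D' c' B' r' h
    simp only [List.cons.injEq, and_true] at h
    obtain rfl := ofNumber_injective h.1
    obtain rfl := ofVector_injective h.2.1
    obtain rfl := ofSet_injective h.2.2.1
    obtain rfl := ofBits_injective h.2.2.2
    exact hs

theorem Computes.unconstrained {alg : UnconstrainedAlg} (h : alg.PolyTime) :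
    ∃ P, Computes P (fun n v l => IsValuation v ∧ ∃ D : Finset (Fin n), l = [ofSet D])
      (fun n v l o => ∀ D : Finset (Fin n), l = [ofSet D] → toSet n o = alg.run v D) := by
  obtain ⟨P, p, hp⟩ := h
  refine ⟨P, p.comp (2 * Polynomial.X), fun n v M l hn hV hl hd => ?_⟩
  obtain ⟨hv, D, rfl⟩ := hd
  obtain ⟨σ, t, he, hs, ht⟩ := hp n v D hv
  refine ⟨σ, t, he, ht.trans ?_, ?_⟩
  · rw [Polynomial.eval_comp]
    refine eval_mono p ?_
    simp only [Polynomial.eval_mul, Polynomial.eval_X, Polynomial.eval_ofNat]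
    omega
  · intro D' h
    obtain rfl := ofSet_injective (List.cons.inj h).1
    exact hs

/-- The marginal value of an agent (the number in array `2`) with respect to a set (array `1`). -/
def marginalProgram : Program :=
  .seq (.query 3 (.lit 0) 1) <| .seq (.assign 1 (.get 2 (.lit 0)) (.lit 1)) <|
    .seq (.query 4 (.lit 0) 1) (.assign 0 (.lit 0) (.minus (.get 4 (.lit 0)) (.get 3 (.lit 0))))

/-- The first argument is blank because the whole array `0` is returned, while only its entry `0` is
written. -/
theorem denote_marginalProgram {n : ℕ} (v : Finset (Fin n) → ℚ) (S : Finset (Fin n)) (i : Fin n) :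
    marginalProgram.denote v (memoryOf [fun _ => 0, ofSet S, ofNumber (i : ℕ)]) 0 =
      ofNumber (marginal v S i) := by
  simp [marginalProgram, Program.denote, Expr.eval, Memory.write, memoryOf, ofNumber_zero,
    toSet_ofSet, update_ofSet_one, update_zero_eq_ofNumber, marginal]

/-- Make the pair of the current agent and the solution `j` the best pair. -/
def recordPair (j : ℕ) : Program :=
  .seq (.assign 0 (.lit 0) (.plus (.get 4 (.lit 0)) (.lit 1))) <|
    .seq (.assign 0 (.lit 1) (.lit j)) (.assign 0 (.lit 2) (.get 5 (.lit 0)))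

/-- Compare the pair of the current agent and the solution `j`, which is stored in the array `s`,
with the best pair so far. -/
def considerPair (s j : ℕ) : Program :=
  .seq (.call marginalProgram [9, s, 4] 5) <|
    .branch (.get 0 (.lit 0)) (.lit 0) (recordPair j) <|
      .branch (.get 5 (.lit 0)) (.get 0 (.lit 2)) .skip (recordPair j)

/-- The search for the first pair with the largest marginal value. -/
def pickProgram : Program :=
  forLoop 4 <| .branch (.lit 1) (.get 1 (.get 4 (.lit 0)))
    (.seq (considerPair 2 0) (considerPair 3 1)) .skip

/-- The encoding of a pair and its value. -/
def encodePair {n : ℕ} (g : Fin n × Fin 2 → ℚ) : Option (Fin n × Fin 2) → ℕ → ℚ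
  | none => fun _ => 0
  | some q => fun k => if k = 0 then (q.1 : ℕ) + 1 else if k = 1 then (q.2 : ℕ) else
      if k = 2 then g q else 0

/-- The result of the search. -/
def pickResult {n : ℕ} (v : Finset (Fin n) → ℚ) (U : Finset (Fin n))
    (S : Fin 2 → Finset (Fin n)) : ℕ → ℚ :=
  encodePair (fun q => marginal v (S q.2) q.1)
    ((candidates U).argmax fun q => marginal v (S q.2) q.1)

theorem bitSize_encodePair_le {n M : ℕ} (hn : n + 2 ≤ M) (hM : 3 ≤ M) {g : Fin n × Fin 2 → ℚ}
    (hg : ∀ q, bitSize (g q) ≤ M) (o : Option (Fin n × Fin 2)) (k : ℕ) :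
    bitSize (encodePair g o k) ≤ M := by
  rcases o with _ | q
  · simp only [encodePair, bitSize_zero]
    omega
  · have h1 := bitSize_natCast (q.1 + 1)
    have h2 := bitSize_natCast q.2
    have := q.1.isLt
    have := q.2.isLt
    push_cast at h1
    simp only [encodePair]
    split_ifs
    · omega
    · omega
    · exact hg q
    · rw [bitSize_zero]
      omega

/-- The scan follows `List.argmax_concat`: a later pair replaces the best one only if it is strictly
better. This reproduces the lexicographic tie-breaking. -/
theorem denote_considerPair {n : ℕ} {v : Finset (Fin n) → ℚ} {S : Fin 2 → Finset (Fin n)}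
    {σ : Memory} {s : ℕ} {i : Fin n} {j : Fin 2} {l : List (Fin n × Fin 2)}
    (hs : σ s = ofSet (S j)) (h4 : σ 4 = ofNumber (i : ℕ)) (h9 : σ 9 = fun _ => 0)
    (h0 : σ 0 = encodePair (fun q => marginal v (S q.2) q.1)
      (l.argmax fun q => marginal v (S q.2) q.1)) :
    (considerPair s j).denote v σ = update (update σ 5 (ofNumber (marginal v (S j) i))) 0
      (encodePair (fun q => marginal v (S q.2) q.1)
        ((l ++ [(i, j)]).argmax fun q => marginal v (S q.2) q.1)) := by
  have hrec : ∀ σ' : Memory, (∀ k, 3 ≤ k → σ' 0 k = 0) → σ' 4 = ofNumber (i : ℕ) →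
      σ' 5 = ofNumber (marginal v (S j) i) →
      (recordPair j).denote v σ' =
        update σ' 0 (encodePair (fun q => marginal v (S q.2) q.1) (some (i, j))) := by
    intro σ' h0' h4' h5'
    funext a k
    rcases eq_or_ne a 0 with rfl | ha
    · rcases k with _ | _ | _ | k
      · simp [recordPair, Program.denote, Expr.eval, Memory.write, h4', encodePair, ofNumber_zero]
      · simp [recordPair, Program.denote, Expr.eval, Memory.write, encodePair]
      · simp [recordPair, Program.denote, Expr.eval, Memory.write, h5', encodePair, ofNumber_zero]
      · simp [recordPair, Program.denote, Expr.eval, Memory.write, encodePair, h0']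
    · simp [recordPair, Program.denote, Expr.eval, Memory.write, ha]
  have hcall : (Program.call marginalProgram [9, s, 4] 5).denote v σ =
      update σ 5 (ofNumber (marginal v (S j) i)) := by
    rw [Program.denote]
    simp only [List.map, hs, h4, h9, denote_marginalProgram]
  rw [considerPair, Program.denote, hcall]
  set σ₁ := update σ 5 (ofNumber (marginal v (S j) i)) with hσ₁
  have h10 : σ₁ 0 = σ 0 := by simp [hσ₁]
  have h14 : σ₁ 4 = ofNumber (i : ℕ) := by simp [hσ₁, h4]
  have h15 : σ₁ 5 = ofNumber (marginal v (S j) i) := by simp [hσ₁]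
  have htail : ∀ k, 3 ≤ k → σ₁ 0 k = 0 := by
    intro k hk
    rw [h10, h0]
    rcases List.argmax _ l with _ | q
    · rfl
    · simp only [encodePair]
      rw [if_neg (by omega), if_neg (by omega), if_neg (by omega)]
  have hconcat := List.argmax_concat (fun q : Fin n × Fin 2 => marginal v (S q.2) q.1) (i, j) l
  rcases hq : List.argmax (fun q => marginal v (S q.2) q.1) l with _ | q
  · rw [hq] at h0 hconcat
    -- Entry `0` stores the agent's index plus one, so a blank array means that no pair has been
    -- found yet.
    have h00 : σ₁ 0 0 ≤ 0 := by simp [h10, h0, encodePair]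
    simp only at hconcat
    simp only [Program.denote, Expr.eval, Nat.floor_zero, if_pos h00, hconcat]
    exact hrec σ₁ htail h14 h15
  · rw [hq] at h0 hconcat
    have h00 : ¬ σ₁ 0 0 ≤ 0 := by
      have : (0 : ℚ) < (q.1 : ℕ) + 1 := by positivity
      simpa [h10, h0, encodePair] using this
    have h02 : σ₁ 0 2 = marginal v (S q.2) q.1 := by simp [h10, h0, encodePair]
    have hfloor : ⌊(2 : ℚ)⌋₊ = 2 := Nat.floor_ofNat 2
    simp only at hconcat
    simp only [Program.denote, Expr.eval, Nat.floor_zero, hfloor, if_neg h00, h02, h15,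
      ofNumber_zero, hconcat]
    by_cases hlt : marginal v (S q.2) q.1 < marginal v (S j) i
    · rw [if_neg (not_le.2 hlt), if_pos hlt]
      exact hrec σ₁ htail h14 h15
    · rw [if_pos (not_lt.1 hlt), if_neg hlt]
      funext a
      rcases eq_or_ne a 0 with rfl | ha
      · rw [update_self, h10, h0]
      · rw [update_of_ne ha]

/-- The candidate pairs of the first `k` agents. -/
def firstCandidates {n : ℕ} (U : Finset (Fin n)) (k : ℕ) : List (Fin n × Fin 2) :=
  (((List.finRange n).take k).filter (· ∈ U)) ×ˢ [0, 1]

theorem product_concat {α : Type} (l : List α) (a : α) :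
    (l ++ [a]) ×ˢ ([0, 1] : List (Fin 2)) = (l ×ˢ [0, 1] ++ [(a, 0)]) ++ [(a, 1)] := by
  simp [SProd.sprod, List.product]

theorem take_succ_finRange {n : ℕ} (i : Fin n) :
    (List.finRange n).take (i + 1) = (List.finRange n).take i ++ [i] := by
  rw [List.take_add_one]
  simp

theorem firstCandidates_succ_of_mem {n : ℕ} {U : Finset (Fin n)} {i : Fin n} (hi : i ∈ U) :
    firstCandidates U (i + 1) = (firstCandidates U i ++ [(i, 0)]) ++ [(i, 1)] := by
  rw [firstCandidates, take_succ_finRange, List.filter_append, List.filter_singleton]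
  simp only [hi, decide_true, cond_true, product_concat]
  rfl

theorem firstCandidates_succ_of_notMem {n : ℕ} {U : Finset (Fin n)} {i : Fin n} (hi : i ∉ U) :
    firstCandidates U (i + 1) = firstCandidates U i := by
  rw [firstCandidates, take_succ_finRange, List.filter_append, List.filter_singleton]
  simp [hi, firstCandidates]

theorem firstCandidates_zero {n : ℕ} (U : Finset (Fin n)) : firstCandidates U 0 = [] := by
  simp [firstCandidates, SProd.sprod, List.product]

theorem firstCandidates_self {n : ℕ} (U : Finset (Fin n)) : firstCandidates U n = candidates U := by
  rw [firstCandidates, List.take_of_length_le (by simp), candidates]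

theorem straight_considerPair (s j : ℕ) : (considerPair s j).Straight := by
  simp [considerPair, recordPair, marginalProgram, Program.Straight]

/-- The memory during the search. -/
structure PickMemory {n : ℕ} (v : Finset (Fin n) → ℚ) (U : Finset (Fin n))
    (S : Fin 2 → Finset (Fin n)) (k : ℕ) (σ : Memory) : Prop where
  best : σ 0 = encodePair (fun q => marginal v (S q.2) q.1)
      ((firstCandidates U k).argmax fun q => marginal v (S q.2) q.1)
  agents : σ 1 = ofSet U
  sol_zero : σ 2 = ofSet (S 0)
  sol_one : σ 3 = ofSet (S 1)
  counter : σ 4 = ofNumber k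
  zero : σ 9 = fun _ => 0

theorem denote_pickBody {n : ℕ} {v : Finset (Fin n) → ℚ} {U : Finset (Fin n)}
    {S : Fin 2 → Finset (Fin n)} {i : Fin n} {σ : Memory} (h : PickMemory v U S i σ) :
    ∃ f : ℕ → ℚ, (f = σ 5 ∨ ∃ m, f = ofNumber (marginal v (S m) i)) ∧
    (Program.branch (.lit 1) (.get 1 (.get 4 (.lit 0)))
      (.seq (considerPair 2 0) (considerPair 3 1)) .skip).denote v σ =
        update (update σ 5 f) 0 (encodePair (fun q => marginal v (S q.2) q.1)
          ((firstCandidates U (i + 1)).argmax fun q => marginal v (S q.2) q.1)) := by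
  simp only [Program.denote, Expr.eval, Nat.floor_zero, h.counter, ofNumber_zero,
    Nat.floor_natCast, h.agents, ofSet_apply]
  by_cases hi : i ∈ U
  · refine ⟨_, Or.inr ⟨1, rfl⟩, ?_⟩
    rw [if_pos hi, if_pos le_rfl, firstCandidates_succ_of_mem hi]
    have h1 := denote_considerPair (v := v) (S := S) (j := 0) h.sol_zero h.counter h.zero h.best
    have h2 := denote_considerPair (v := v) (S := S) (s := 3) (i := i) (j := 1)
      (l := firstCandidates U i ++ [(i, 0)])
      (σ := (considerPair 2 0).denote v σ) (by rw [← h.sol_one]; simpa using congrFun h1 3)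
      (by rw [← h.counter]; simpa using congrFun h1 4)
      (by rw [← h.zero]; simpa using congrFun h1 9) (by simpa using congrFun h1 0)
    refine h2.trans ?_
    have h1' : (considerPair 2 0).denote v σ = _ := h1
    rw [h1']
    funext a
    rcases eq_or_ne a 0 with rfl | ha0
    · simp
    · rcases eq_or_ne a 5 with rfl | ha5
      · simp
      · simp [ha0, ha5]
  · refine ⟨σ 5, Or.inl rfl, ?_⟩
    rw [if_neg hi, if_neg (by norm_num), firstCandidates_succ_of_notMem hi, update_eq_self,
      ← h.best, update_eq_self]

theorem computes_pickProgram :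
    Computes pickProgram
      (fun n _ l => ∃ (U : Finset (Fin n)) (S : Fin 2 → Finset (Fin n)),
        l = [fun _ => 0, ofSet U, ofSet (S 0), ofSet (S 1)])
      (fun n v l o => o = pickResult v (toSet n (l.getD 1 0))
        (fun j => toSet n (l.getD (j + 2) 0))) := by
  refine Computes.of_polyTriple ?_
  refine (PolyTriple.forLoop_straight (ctr := 4) (I := fun i k σ =>
    PickMemory i.v (toSet i.n (i.args.getD 1 0)) (fun j => toSet i.n (i.args.getD (j + 2) 0)) k σ)
    -- The bound of `bitSize_marginal_le`; apart from marginals, the search writes only indices and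
    -- blanks.
    (Polynomial.C 4 * Polynomial.X + Polynomial.C 2) ?_ ?_ ?_ ?_).conseq ?_ ?_
  · simp [Program.Straight, straight_considerPair]
  · intro i k σ h
    rw [h.counter, ofNumber_zero]
  · intro i k σ M hk hM hσ h
    obtain ⟨f, hf, heq⟩ := denote_pickBody (i := ⟨k, hk⟩) h
    have hn := i.n_lt
    simp only [Polynomial.eval_add, Polynomial.eval_mul, Polynomial.eval_C,
      Polynomial.eval_X] at hM
    have hmarg : ∀ S j, bitSize (marginal i.v S j) ≤ M := fun S j => by
      have := bitSize_marginal_le i.size_le S j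
      omega
    rw [heq]
    refine (hσ.update (fun a => ?_) _).update (fun a => ?_) _
    · rcases hf with rfl | ⟨m, rfl⟩
      · exact hσ 5 a
      · exact bitSize_ofNumber_le (by omega) (hmarg _ _) a
    · exact bitSize_encodePair_le (by omega) (by omega) (fun q => hmarg _ _) _ a
  · intro i k σ hk h
    obtain ⟨f, -, heq⟩ := denote_pickBody (i := ⟨k, hk⟩) h
    rw [heq]
    refine ⟨by simp [h.counter, ofNumber_zero], ?_⟩
    constructor
    · simp [Memory.write]
    · simp [Memory.write, h.agents]
    · simp [Memory.write, h.sol_zero]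
    · simp [Memory.write, h.sol_one]
    · simp [Memory.write, h.counter, update_ofNumber]
    · simp [Memory.write, h.zero]
  · rintro i σ rfl
    obtain ⟨U, S, hl⟩ := i.dom
    constructor
    · simp [Memory.write, hl, memoryOf, firstCandidates_zero, encodePair]
    · simp [Memory.write, hl, memoryOf, toSet_ofSet]
    · simp [Memory.write, hl, memoryOf, toSet_ofSet]
    · simp [Memory.write, hl, memoryOf, toSet_ofSet]
    · simp [Memory.write, hl, memoryOf, ← update_zero_eq_ofNumber]
    · simp [Memory.write, hl, memoryOf]
  · intro i σ h
    rw [h.best, pickResult, firstCandidates_self]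

end Subroutines

end GenSm

namespace GenSm

open Function

/-! ## The program for the mechanism -/

section MainProgram

/-- The instances of the mechanism. -/
structure MainInput (bits : ℕ → ℕ) where
  n : ℕ
  v : Finset (Fin n) → ℚ
  b : Fin n → ℚ
  B : ℚ
  ω : Seed n (bits n)
  isValuation : IsValuation v
  cost_nonneg : ∀ i, 0 ≤ b i
  budget_pos : 0 < B

/-- The value oracle of an instance, with a bound for all the numbers in the instance. -/
def MainInput.oracle {bits : ℕ → ℕ} (i : MainInput bits) : Oracle where
  n := i.n
  v := i.v
  M := instanceSize i.v i.b i.B + 1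
  n_lt := by
    unfold instanceSize
    omega
  size_le := by
    unfold instanceSize
    omega

/-- The declared costs as real numbers. -/
def MainInput.cost {bits : ℕ → ℕ} (i : MainInput bits) : Fin i.n → ℝ := fun k => (i.b k : ℝ)

/-- The agents whose declared cost is at most the budget. -/
noncomputable def MainInput.agents {bits : ℕ → ℕ} (i : MainInput bits) : Finset (Fin i.n) :=
  eligible (i.B : ℝ) i.cost

variable {bits : ℕ → ℕ}

theorem MainInput.mem_agents {i : MainInput bits} {k : Fin i.n} : k ∈ i.agents ↔ i.b k ≤ i.B := by
  simp [agents, mem_eligible, cost]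

theorem proj_ratCast {n : ℕ} (D : Finset (Fin n)) (b : Fin n → ℚ) :
    proj D (fun i => (b i : ℝ)) = fun i => ((proj D b i : ℚ) : ℝ) := by
  funext i
  unfold proj
  split_ifs <;> simp

/-! ### Preprocessing -/

/-- Compute the eligible agents, the sample, its costs and the remaining eligible agents. -/
def prepareBody : Program :=
  .branch (.get 1 (.get 11 (.lit 0))) (.get 0 (.lit 0))
    (.seq (.assign 5 (.get 11 (.lit 0)) (.lit 1)) <|
      .branch (.lit 1) (.get 3 (.get 11 (.lit 0)))
        (.seq (.assign 6 (.get 11 (.lit 0)) (.lit 1))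
          (.assign 8 (.get 11 (.lit 0)) (.get 1 (.get 11 (.lit 0)))))
        (.assign 7 (.get 11 (.lit 0)) (.lit 1)))
    .skip

/-- The memory during the preprocessing. -/
structure PrepareMemory (i : MainInput bits) (k : ℕ) (σ : Memory) : Prop where
  budget : σ 0 = ofNumber i.B
  costs : σ 1 = ofVector i.b
  lottery : σ 2 = ofNumber i.ω.1.val
  part : σ 3 = ofSet i.ω.2.1
  coins : σ 4 = ofBits i.ω.2.2
  agents : σ 5 = upTo k (ofSet i.agents)
  sample : σ 6 = upTo k (ofSet (i.agents ∩ i.ω.2.1))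
  rest : σ 7 = upTo k (ofSet (i.agents \ i.ω.2.1))
  sampleCosts : σ 8 = upTo k (ofVector (proj (i.agents ∩ i.ω.2.1) i.b))
  counter : σ 11 0 = k
  zero : ∀ a, 9 ≤ a → a ≠ 11 → σ a = fun _ => 0

theorem upTo_succ_of_mem {n : ℕ} {S : Finset (Fin n)} {i : Fin n} (hi : i ∈ S) :
    upTo (i + 1) (ofSet S) = update (upTo i (ofSet S)) i 1 := by
  rw [upTo_succ, ofSet_apply, if_pos hi]

theorem upTo_succ_of_notMem {n : ℕ} {S : Finset (Fin n)} {i : Fin n} (hi : i ∉ S) :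
    upTo (i + 1) (ofSet S) = upTo i (ofSet S) :=
  upTo_succ_of_eq_zero (by rw [ofSet_apply, if_neg hi])

theorem denote_prepareBody {i : MainInput bits} {k : Fin i.n} {σ : Memory}
    (h : PrepareMemory i k σ) :
    prepareBody.denote i.v σ =
      if i.b k ≤ i.B then
        if k ∈ i.ω.2.1 then ((σ.write 5 k 1).write 6 k 1).write 8 k (i.b k)
        else (σ.write 5 k 1).write 7 k 1
      else σ := by
  have hk : k ∈ i.ω.2.1 ∨ k ∉ i.ω.2.1 := em _
  rcases hk with hk | hk <;>
    simp [prepareBody, Program.denote, Expr.eval, h.counter, h.costs, h.budget, h.part,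
      ofNumber_zero, ofVector_apply, ofSet_apply, Memory.write, hk,
      (by norm_num : ¬ (1 : ℚ) ≤ 0)]

theorem prepare_polyTriple :
    PolyTriple (MainInput.oracle (bits := bits)) (forLoop 11 prepareBody)
      (fun i σ => σ = memoryOf
        [ofNumber i.B, ofVector i.b, ofNumber i.ω.1.val, ofSet i.ω.2.1, ofBits i.ω.2.2])
      (fun i σ => PrepareMemory i i.n σ) := by
  refine (PolyTriple.forLoop_straight (ctr := 11) (I := fun i k σ => PrepareMemory i k σ)
    (Polynomial.C 1) ?_ ?_ ?_ ?_).conseq ?_ ?_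
  · simp [prepareBody, Program.Straight]
  · exact fun i k σ h => h.counter
  · intro i k σ M hk hM hσ h
    have hb : bitSize (i.b ⟨k, hk⟩) ≤ M := by
      have := hσ 1 k
      rw [h.costs] at this
      rwa [← ofVector_apply i.b]
    have h1 : bitSize 1 ≤ M := by
      have := i.oracle.n_lt
      rw [bitSize_one]
      rw [Polynomial.eval_C] at hM
      omega
    have heq : prepareBody.denote i.v σ = _ := denote_prepareBody (k := ⟨k, hk⟩) h
    change Small M (prepareBody.denote i.v σ)
    rw [heq]
    split_ifs
    · exact ((hσ.write h1 _ _).write h1 _ _).write hb _ _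
    · exact (hσ.write h1 _ _).write h1 _ _
    · exact hσ
  · intro i k σ hk h
    have heq : prepareBody.denote i.v σ = _ := denote_prepareBody (k := ⟨k, hk⟩) h
    change prepareBody.denote i.v σ 11 0 = k ∧
      PrepareMemory i (k + 1) ((prepareBody.denote i.v σ).write 11 0 ((k : ℚ) + 1))
    rw [heq]
    have hA : (⟨k, hk⟩ : Fin i.n) ∈ i.agents ↔ i.b ⟨k, hk⟩ ≤ i.B := MainInput.mem_agents
    have hmem : ∀ S : Finset (Fin i.n), ⟨k, hk⟩ ∈ S →
        upTo (k + 1) (ofSet S) = update (upTo k (ofSet S)) k 1 :=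
      fun S hS => upTo_succ_of_mem (i := ⟨k, hk⟩) hS
    have hnot : ∀ S : Finset (Fin i.n), ⟨k, hk⟩ ∉ S → upTo (k + 1) (ofSet S) = upTo k (ofSet S) :=
      fun S hS => upTo_succ_of_notMem (i := ⟨k, hk⟩) hS
    have hproj : ofVector (proj (i.agents ∩ i.ω.2.1) i.b) k =
        proj (i.agents ∩ i.ω.2.1) i.b ⟨k, hk⟩ := ofVector_apply _ ⟨k, hk⟩
    split_ifs with h1 h2
    · rw [← hA] at h1
      refine ⟨by simp [Memory.write, h.counter], ?_⟩
      constructor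
      · simp [Memory.write, h.budget]
      · simp [Memory.write, h.costs]
      · simp [Memory.write, h.lottery]
      · simp [Memory.write, h.part]
      · simp [Memory.write, h.coins]
      · simp [Memory.write, h.agents, hmem _ h1]
      · simp [Memory.write, h.sample, hmem (i.agents ∩ i.ω.2.1) (by simp [h1, h2])]
      · simp [Memory.write, h.rest, hnot (i.agents \ i.ω.2.1) (by simp [h2])]
      · rw [upTo_succ, hproj]
        simp [Memory.write, h.sampleCosts, proj, h1, h2]
      · simp [Memory.write]
      · intro a ha ha'
        rw [write_of_ne _ ha', write_of_ne _ (by omega), write_of_ne _ (by omega),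
          write_of_ne _ (by omega), h.zero a ha ha']
    · rw [← hA] at h1
      refine ⟨by simp [Memory.write, h.counter], ?_⟩
      constructor
      · simp [Memory.write, h.budget]
      · simp [Memory.write, h.costs]
      · simp [Memory.write, h.lottery]
      · simp [Memory.write, h.part]
      · simp [Memory.write, h.coins]
      · simp [Memory.write, h.agents, hmem _ h1]
      · simp [Memory.write, h.sample, hnot (i.agents ∩ i.ω.2.1) (by simp [h2])]
      · simp [Memory.write, h.rest, hmem (i.agents \ i.ω.2.1) (by simp [h1, h2])]
      · rw [upTo_succ_of_eq_zero (by rw [hproj]; simp [proj, h2])]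
        simp [Memory.write, h.sampleCosts]
      · simp [Memory.write]
      · intro a ha ha'
        rw [write_of_ne _ ha', write_of_ne _ (by omega), write_of_ne _ (by omega),
          h.zero a ha ha']
    · rw [← hA] at h1
      refine ⟨h.counter, ?_⟩
      constructor
      · simp [Memory.write, h.budget]
      · simp [Memory.write, h.costs]
      · simp [Memory.write, h.lottery]
      · simp [Memory.write, h.part]
      · simp [Memory.write, h.coins]
      · simp [Memory.write, h.agents, hnot _ h1]
      · simp [Memory.write, h.sample, hnot (i.agents ∩ i.ω.2.1) (by simp [h1])]
      · simp [Memory.write, h.rest, hnot (i.agents \ i.ω.2.1) (by simp [h1])]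
      · rw [upTo_succ_of_eq_zero (by rw [hproj]; simp [proj, h1])]
        simp [Memory.write, h.sampleCosts]
      · simp [Memory.write]
      · intro a ha ha'
        rw [write_of_ne _ ha', h.zero a ha ha']
  · rintro i σ rfl
    constructor <;> try simp [Memory.write, memoryOf, upTo_zero]
    intro a ha ha'
    rw [update_of_ne ha']
    exact List.getD_eq_default _ _ (by simpa using by omega)
  · exact fun i σ h => h

/-! ### Lottery -/

/-- Select the agent with the most valuable singleton and pay the budget. -/
def lotteryProgram : Program :=
  .seq (.call pickProgram [30, 5, 30, 30] 12) <|
    .seq (.branch (.lit 1) (.get 12 (.lit 0))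
      (.seq (.assign 14 (.minus (.get 12 (.lit 0)) (.lit 1)) (.lit 1))
        (.assign 13 (.minus (.get 12 (.lit 0)) (.lit 1)) (.get 0 (.lit 0)))) .skip) <|
      .seq (.call .skip [13] 1) (.call .skip [14] 0)

theorem argmax_product_fst {α : Type} (h : α → ℚ) (l : List α) :
    (l ×ˢ ([0, 1] : List (Fin 2))).argmax (fun q => h q.1) =
      (l.argmax h).map fun a => (a, 0) := by
  induction l using List.reverseRecOn with
  | nil => rfl
  | append_singleton l a ih =>
    rw [product_concat, List.argmax_concat, List.argmax_concat, ih, List.argmax_concat]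
    rcases List.argmax h l with _ | b
    · simp
    · by_cases hlt : h b < h a <;> simp [hlt]

/-- With empty solutions the two pairs of an agent tie and the first one wins, so the search for
pairs also finds the best singleton for the lottery. -/
theorem pickResult_empty {n : ℕ} {v : Finset (Fin n) → ℚ} (hv : IsValuation v)
    (A : Finset (Fin n)) :
    pickResult v A (fun _ => ∅) = encodePair (fun q => v {q.1})
      ((bestSingleton v A).map fun i => (i, 0)) := by
  unfold pickResult bestSingleton
  simp only [marginal_empty hv, candidates]
  rw [argmax_product_fst (fun i => v {i})]

theorem lottery_polyTriple (alg₁ : KnapsackAlg) (alg₂ : UnconstrainedAlg) :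
    PolyTriple (MainInput.oracle (bits := alg₁.bits)) lotteryProgram
      (fun i σ => PrepareMemory i i.n σ ∧ i.ω.1.val < 201)
      (fun i σ => toSet i.n (σ 0) = (genSmMain alg₁ alg₂ i.v i.B i.ω).outcome i.cost ∧
        ∀ k : Fin i.n, (σ 1 k : ℝ) = (genSmMain alg₁ alg₂ i.v i.B i.ω).payment i.cost k) := by
  have h1 : PolyTriple (MainInput.oracle (bits := alg₁.bits))
      (.call pickProgram [30, 5, 30, 30] 12)
      (fun i σ => PrepareMemory i i.n σ ∧ i.ω.1.val < 201)
      (fun i σ => (σ 0 = ofNumber i.B ∧ i.ω.1.val < 201 ∧ (σ 13 = fun _ => 0) ∧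
        σ 14 = fun _ => 0) ∧ σ 12 = encodePair (fun q => i.v {q.1})
          ((bestSingleton i.v i.agents).map fun k => (k, 0))) := by
    refine PolyTriple.call computes_pickProgram ?_ ?_
    · rintro i σ ⟨h, -⟩
      refine ⟨i.agents, fun _ => ∅, ?_⟩
      simp only [List.map_cons, List.map_nil, h.zero 30 (by norm_num) (by norm_num), h.agents,
        ofSet_empty, upTo_ofSet]
      rfl
    · rintro i σ o ⟨h, hω⟩ rfl
      refine ⟨⟨?_, hω, ?_, ?_⟩, ?_⟩
      · simp [h.budget]
      · simp [h.zero 13]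
      · simp [h.zero 14]
      · rw [update_self, ← pickResult_empty i.isValuation]
        have e1 : toSet i.n (σ 5) = i.agents := by rw [h.agents, upTo_ofSet, toSet_ofSet]
        have e2 : toSet i.n (σ 30) = ∅ := by
          rw [h.zero 30 (by norm_num) (by norm_num), ← ofSet_empty (n := i.n), toSet_ofSet]
        change pickResult i.v (toSet i.n (σ 5)) _ = _
        rw [e1]
        congr 1
        funext j
        have hj : j = 0 ∨ j = 1 := by omega
        rcases hj with rfl | rfl <;> exact e2
  refine h1.seq (PolyTriple.straight ?_ ?_)
  · simp [Program.Straight]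
  · rintro i σ ⟨⟨h0, hω, h13, h14⟩, h12⟩
    simp only [genSmMain, lottery_payment hω, genSmOutcome_lottery hω]
    change _ = (bestSingleton i.v i.agents).elim _ _ ∧ ∀ k : Fin i.n,
      _ = if _ ∈ (bestSingleton i.v i.agents).elim _ _ then _ else _
    generalize bestSingleton i.v i.agents = best at h12 ⊢
    rcases best with _ | k
    · have h00 : ¬ (1 : ℚ) ≤ 0 := by norm_num
      simp [Program.denote, Expr.eval, h12, encodePair, h00, memoryOf, h13, h14, toSet]
    · have h01 : (1 : ℚ) ≤ (k : ℕ) + 1 := by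
        have : (0 : ℚ) ≤ (k : ℕ) := by positivity
        linarith
      have e1 : update (fun _ => (0 : ℚ)) (k : ℕ) 1 = ofSet {k} := by
        rw [← ofSet_empty (n := i.n), update_ofSet_one, insert_empty_eq]
      have e2 : update (fun _ => (0 : ℚ)) (k : ℕ) i.B = ofVector (update (fun _ => 0) k i.B) := by
        rw [← update_ofVector]
        congr 1
        funext a
        simp [ofVector]
      simp [Program.denote, Expr.eval, h12, encodePair, h01, memoryOf, h13, h14, h0, Memory.write,
        ofNumber_zero, e1, e2, toSet_ofSet, ofVector_apply, update_apply]
      intro a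
      split_ifs <;> simp

end MainProgram

end GenSm

namespace GenSm

open Function

/-! ### The iterations of Simultaneous Greedy -/

section GreedyProgram

variable {n : ℕ} {v : Finset (Fin n) → ℚ}

/-- Offer the price to the examined agent, and add the agent to the solution in the array `s` if the
tests are passed. -/
def offerProgram (s : ℕ) : Program :=
  .seq (.query 19 (.lit 0) s) <|
    .branch (.get 10 (.lit 0)) (.lit 0) .skip <|
      .branch (.times (.get 1 (.minus (.get 12 (.lit 0)) (.lit 1))) (.get 10 (.lit 0)))
        (.times (.times (.lit (1837 / 200)) (.get 0 (.lit 0))) (.get 12 (.lit 2)))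
        (.branch (.times (.lit (1837 / 200)) (.plus (.get 19 (.lit 0)) (.get 12 (.lit 2))))
          (.get 10 (.lit 0))
          (.seq (.assign 13 (.minus (.get 12 (.lit 0)) (.lit 1))
              (.times (.quot (.times (.lit (1837 / 200)) (.get 0 (.lit 0))) (.get 10 (.lit 0)))
                (.get 12 (.lit 2))))
            (.assign s (.minus (.get 12 (.lit 0)) (.lit 1)) (.lit 1)))
          .skip) .skip

/-- Examine the pair that has been found by the search. -/
def examineProgram : Program :=
  .branch (.lit 1) (.get 12 (.lit 0))
    (.branch (.get 12 (.lit 2)) (.lit 0) .skip <|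
      .seq (.assign 7 (.minus (.get 12 (.lit 0)) (.lit 1)) (.lit 0)) <|
        .branch (.get 12 (.lit 1)) (.lit 0) (offerProgram 14) (offerProgram 15))
    .skip

/-- The body of the loop of Simultaneous Greedy. -/
def greedyBody : Program :=
  .seq (.call pickProgram [30, 7, 14, 15] 12) examineProgram

/-- The memory during the run of Simultaneous Greedy. -/
structure GreedyMemory (b : Fin n → ℚ) (B x : ℚ) (p : GreedyState n × (Fin n → ℝ)) (k : ℕ)
    (σ : Memory) : Prop where
  budget : σ 0 = ofNumber B
  costs : σ 1 = ofVector b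
  rest : σ 7 = ofSet p.1.rest
  sample : σ 10 0 = x
  prices : ∀ i : Fin n, (σ 13 i : ℝ) = p.2 i
  sol_zero : σ 14 = ofSet (p.1.sol 0)
  sol_one : σ 15 = ofSet (p.1.sol 1)
  counter : σ 16 0 = k
  zero : ∀ a, 20 ≤ a → σ a = fun _ => 0

theorem denote_offerProgram {b : Fin n → ℚ} {B x : ℚ} {S : Finset (Fin n)} {i : Fin n} {m : ℚ}
    {σ : Memory} {s : ℕ} (h0 : σ 0 = ofNumber B) (h1 : σ 1 = ofVector b)
    (h10 : σ 10 0 = x) (hS : σ s = ofSet S) (hi : σ 12 0 = (i : ℕ) + 1) (hm : σ 12 2 = m) :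
    (offerProgram s).denote v σ =
      if 0 < x ∧ b i * x ≤ 1837 / 200 * B * m ∧ 1837 / 200 * (v S + m) ≤ x then
        ((σ.write 19 0 (v S)).write 13 i (1837 / 200 * B / x * m)).write s i 1
      else σ.write 19 0 (v S) := by
  by_cases c1 : x ≤ 0
  · rw [if_neg fun h => absurd h.1 (not_lt.2 c1)]
    simp [offerProgram, Program.denote, Expr.eval, Memory.write, hS, toSet_ofSet, h10, c1]
  by_cases c2 : b i * x ≤ 1837 / 200 * B * m
  swap
  · rw [if_neg fun h => c2 h.2.1]
    simp [offerProgram, Program.denote, Expr.eval, Memory.write, hS, toSet_ofSet, h10, c1, hi,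
      h0, h1, hm, ofNumber_zero, ofVector_apply, c2]
  by_cases c3 : 1837 / 200 * (v S + m) ≤ x
  swap
  · rw [if_neg fun h => c3 h.2.2]
    simp [offerProgram, Program.denote, Expr.eval, Memory.write, hS, toSet_ofSet, h10, c1, hi,
      h0, h1, hm, ofNumber_zero, ofVector_apply, c2, c3]
  rw [if_pos ⟨not_le.1 c1, c2, c3⟩]
  simp [offerProgram, Program.denote, Expr.eval, Memory.write, hS, toSet_ofSet, h10, c1, hi,
    h0, h1, hm, ofNumber_zero, ofVector_apply, c2, c3]

/-- Substitute `B_j = B - β B v(S_j) / x` and clear denominators, which is allowed for `0 < x`. The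
remaining budgets disappear, so the program need not store numbers that accumulate over the
iterations. -/
theorem accepts_iff {c : Fin n → ℝ} {b : Fin n → ℚ} {B x : ℚ} {s : GreedyState n} {i : Fin n}
    {j : Fin 2} (hB : 0 < B) (hc : c i = b i)
    (hbud : s.budget j = B - beta * B / x * v (s.sol j)) :
    Accepts v c B x s i j ↔ 0 < x ∧ b i * x ≤ 1837 / 200 * B * marginal v (s.sol j) i ∧
      1837 / 200 * (v (s.sol j) + marginal v (s.sol j) i) ≤ x := by
  unfold Accepts offer
  rw [hbud, hc]
  have hβ : beta = ((1837 / 200 : ℚ) : ℝ) := by norm_num [beta]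
  rw [hβ]
  by_cases hx : 0 < x
  · have e1 : ((b i : ℝ) ≤ ((1837 / 200 : ℚ) : ℝ) * B / x * marginal v (s.sol j) i) ↔
        b i * x ≤ 1837 / 200 * B * marginal v (s.sol j) i := by
      rw [← le_div_iff₀ hx, div_mul_eq_mul_div]
      norm_cast
    have e2 : (((1837 / 200 : ℚ) : ℝ) * B / x * marginal v (s.sol j) i ≤
        B - ((1837 / 200 : ℚ) : ℝ) * B / x * v (s.sol j)) ↔
        1837 / 200 * (v (s.sol j) + marginal v (s.sol j) i) ≤ x := by
      norm_cast
      rw [le_sub_iff_add_le, ← mul_add, add_comm (marginal v (s.sol j) i), div_mul_eq_mul_div,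
        div_le_iff₀ hx, mul_right_comm, mul_comm B x]
      exact mul_le_mul_iff_left₀ hB
    rw [e1, e2]
    norm_cast
  · simp [hx]

/-- One iteration of the program: the new memory represents the next state, and the memory stays
small. -/
theorem denote_examineProgram {b : Fin n → ℚ} {B x : ℚ} {p : GreedyState n × (Fin n → ℝ)} {k : ℕ}
    {c : Fin n → ℝ} {σ : Memory} (hB : 0 < B) (h : GreedyMemory b B x p k σ)
    (hpick : σ 12 = pickResult v p.1.rest p.1.sol)
    (hc : ∀ i ∈ p.1.rest, c i = b i)
    (hbud : ∀ j, p.1.budget j = B - beta * B / x * v (p.1.sol j)) {M : ℕ} (hM : 2 ≤ M)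
    (hV : valueSize v ≤ M)
    (hprice : ∀ S i, bitSize (1837 / 200 * B / x * marginal v S i) ≤ M) (hσ : Small M σ) :
    GreedyMemory b B x (pricedStep v c B x p) k (examineProgram.denote v σ) ∧
      Small M (examineProgram.denote v σ) := by
  unfold pickResult at hpick
  change σ 12 = encodePair _ (nextPair v p.1) at hpick
  rcases hnext : nextPair v p.1 with _ | ⟨i, j⟩
  · rw [hnext] at hpick
    have : examineProgram.denote v σ = σ := by
      simp [examineProgram, Program.denote, Expr.eval, hpick, encodePair,
        (by norm_num : ¬ (1 : ℚ) ≤ 0)]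
    rw [this, pricedStep_none hnext]
    exact ⟨h, hσ⟩
  rw [hnext] at hpick
  have h120 : σ 12 0 = (i : ℕ) + 1 := by simp [hpick, encodePair]
  have h121 : σ 12 1 = (j : ℕ) := by simp [hpick, encodePair]
  have h122 : σ 12 2 = marginal v (p.1.sol j) i := by simp [hpick, encodePair]
  have h01 : (1 : ℚ) ≤ (i : ℕ) + 1 := by
    have : (0 : ℚ) ≤ (i : ℕ) := by positivity
    linarith
  by_cases hm : 0 < marginal v (p.1.sol j) i
  swap
  · have : examineProgram.denote v σ = σ := by
      simp [examineProgram, Program.denote, Expr.eval, h120, h122, h01, not_lt.1 hm]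
    rw [this, pricedStep_nonpos hnext hm]
    exact ⟨h, hσ⟩
  have hs : σ (14 + j) = ofSet (p.1.sol j) := by
    have hj : j = 0 ∨ j = 1 := by omega
    rcases hj with rfl | rfl
    · exact h.sol_zero
    · exact h.sol_one
  have hden : examineProgram.denote v σ =
      (offerProgram (14 + j)).denote v (σ.write 7 i 0) := by
    have hj : j = 0 ∨ j = 1 := by omega
    have hw : (σ.write 7 i 0) 12 = σ 12 := write_of_ne _ (by norm_num) _ _
    rcases hj with rfl | rfl
    · simp [examineProgram, Program.denote, Expr.eval, h120, h121, h122, h01, not_le.2 hm, hw]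
    · simp [examineProgram, Program.denote, Expr.eval, h120, h121, h122, h01, not_le.2 hm, hw,
        (by norm_num : ¬ (1 : ℚ) ≤ 0)]
  have hoffer := denote_offerProgram (v := v) (b := b) (B := B) (x := x) (S := p.1.sol j) (i := i)
    (m := marginal v (p.1.sol j) i) (σ := σ.write 7 i 0) (s := 14 + j)
    (by rw [write_of_ne _ (by norm_num), h.budget])
    (by rw [write_of_ne _ (by norm_num), h.costs])
    (by rw [write_of_ne _ (by norm_num), h.sample])
    (by rw [write_of_ne _ (by omega), hs])
    (by rw [write_of_ne _ (by norm_num), h120])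
    (by rw [write_of_ne _ (by norm_num), h122])
  have hacc := accepts_iff (v := v) (x := x) (s := p.1) (j := j) hB
    (hc i (nextPair_mem hnext)) (hbud j)
  have hvS := (bitSize_le_valueSize v (p.1.sol j)).trans hV
  have hsmall : Small M ((σ.write 7 i 0).write 19 0 (v (p.1.sol j))) :=
    (hσ.write (by rw [bitSize_zero]; omega) _ _).write hvS _ _
  rw [hden, hoffer]
  by_cases ha : Accepts v c B x p.1 i j
  · rw [if_pos (hacc.1 ha), pricedStep_accept hnext hm ha]
    refine ⟨?_, (hsmall.write (hprice _ _) _ _).write (by rw [bitSize_one]; omega) _ _⟩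
    have hj2 := j.isLt
    constructor
    · rw [write_of_ne _ (by omega), write_of_ne _ (by omega), write_of_ne _ (by omega),
        write_of_ne _ (by omega), h.budget]
    · rw [write_of_ne _ (by omega), write_of_ne _ (by omega), write_of_ne _ (by omega),
        write_of_ne _ (by omega), h.costs]
    · rw [write_of_ne _ (by omega), write_of_ne _ (by omega), write_of_ne _ (by omega),
        write_same, h.rest, update_ofSet_zero]
      rfl
    · rw [write_of_ne _ (by omega), write_of_ne _ (by omega), write_of_ne _ (by omega),
        write_of_ne _ (by omega), h.sample]
    · intro a
      rw [write_of_ne _ (by omega), write_same, write_of_ne _ (by omega), write_of_ne _ (by omega)]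
      change _ = update p.2 i (offer v B x p.1 i j) a
      rcases eq_or_ne a i with rfl | hne
      · rw [update_self, update_self, offer]
        push_cast
        norm_num [beta]
      · rw [update_of_ne hne, update_of_ne (fun h' => hne (Fin.ext h')), h.prices]
    · have hj : j = 0 ∨ j = 1 := by omega
      rcases hj with rfl | rfl
      · simp [Memory.write, h.sol_zero, acceptState, update_ofSet_one]
      · simp [Memory.write, h.sol_zero, acceptState]
    · have hj : j = 0 ∨ j = 1 := by omega
      rcases hj with rfl | rfl
      · simp [Memory.write, h.sol_one, acceptState]
      · simp [Memory.write, h.sol_one, acceptState, update_ofSet_one]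
    · rw [write_of_ne _ (by omega), write_of_ne _ (by omega), write_of_ne _ (by omega),
        write_of_ne _ (by omega), h.counter]
    · intro a ha
      rw [write_of_ne _ (by omega), write_of_ne _ (by omega), write_of_ne _ (by omega),
        write_of_ne _ (by omega), h.zero a ha]
  · rw [if_neg (mt hacc.2 ha), pricedStep_reject hnext hm ha]
    refine ⟨?_, hsmall⟩
    constructor
    · rw [write_of_ne _ (by omega), write_of_ne _ (by omega), h.budget]
    · rw [write_of_ne _ (by omega), write_of_ne _ (by omega), h.costs]
    · rw [write_of_ne _ (by omega), write_same, h.rest, update_ofSet_zero]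
    · rw [write_of_ne _ (by omega), write_of_ne _ (by omega), h.sample]
    · intro a
      rw [write_of_ne _ (by omega), write_of_ne _ (by omega), h.prices]
    · rw [write_of_ne _ (by omega), write_of_ne _ (by omega), h.sol_zero]
    · rw [write_of_ne _ (by omega), write_of_ne _ (by omega), h.sol_one]
    · rw [write_of_ne _ (by omega), write_of_ne _ (by omega), h.counter]
    · intro a ha
      rw [write_of_ne _ (by omega), write_of_ne _ (by omega), h.zero a ha]

theorem straight_examineProgram : examineProgram.Straight := by
  simp [examineProgram, offerProgram, Program.Straight]

theorem GreedyMemory.write_counter {b : Fin n → ℚ} {B x : ℚ} {p : GreedyState n × (Fin n → ℝ)}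
    {k : ℕ} {σ : Memory} (h : GreedyMemory b B x p k σ) (k' : ℕ) :
    GreedyMemory b B x p k' (σ.write 16 0 (k' : ℚ)) where
  budget := by rw [write_of_ne _ (by norm_num), h.budget]
  costs := by rw [write_of_ne _ (by norm_num), h.costs]
  rest := by rw [write_of_ne _ (by norm_num), h.rest]
  sample := by rw [write_of_ne _ (by norm_num), h.sample]
  prices i := by rw [write_of_ne _ (by norm_num), h.prices]
  sol_zero := by rw [write_of_ne _ (by norm_num), h.sol_zero]
  sol_one := by rw [write_of_ne _ (by norm_num), h.sol_one]
  counter := by rw [write_same, update_self]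
  zero a ha := by rw [write_of_ne _ (by omega), h.zero a ha]

end GreedyProgram

end GenSm

namespace GenSm

open Function

section Auction

/-! ### The greedy branch of the mechanism -/

variable {alg₁ : KnapsackAlg} {alg₂ : UnconstrainedAlg}

/-- The value of the sample. -/
noncomputable def MainInput.x (i : MainInput alg₁.bits) : ℚ := sampleValue alg₁ i.v i.B i.ω i.cost

/-- The state of Simultaneous Greedy after `k` iterations. -/
noncomputable def MainInput.state (i : MainInput alg₁.bits) (k : ℕ) :
    GreedyState i.n × (Fin i.n → ℝ) :=
  (pricedStep i.v (proj (i.agents \ i.ω.2.1) i.cost) i.B i.x)^[k]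
    (greedyInit (i.agents \ i.ω.2.1) i.B)

/-- The final state of Simultaneous Greedy. -/
noncomputable def MainInput.run (i : MainInput alg₁.bits) : GreedyState i.n × (Fin i.n → ℝ) :=
  mainRun alg₁ i.v i.B i.ω i.cost

theorem MainInput.state_n (i : MainInput alg₁.bits) : i.state i.n = i.run :=
  iterate_pricedStep_eq (p := greedyInit (i.agents \ i.ω.2.1) i.B)
    ((Finset.card_le_univ _).trans_eq (Fintype.card_fin _))

theorem MainInput.invariant (i : MainInput alg₁.bits) (k : ℕ) :
    BudgetInvariant i.v i.B i.x (i.agents \ i.ω.2.1) (i.state k) :=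
  BudgetInvariant.iterate i.isValuation (by exact_mod_cast i.budget_pos) k

/-- The bound does not depend on the iteration: a price is computed afresh from `B`, `x` and a
marginal value. -/
theorem bitSize_price_le {n M : ℕ} {v : Finset (Fin n) → ℚ} {B x : ℚ} (hB : bitSize B ≤ M)
    (hx : bitSize x ≤ M) (hv : valueSize v ≤ M) (S : Finset (Fin n)) (i : Fin n) :
    bitSize (1837 / 200 * B / x * marginal v S i) ≤
      8 * bitSize (1837 / 200) + 18 + 20 * M := by
  have h1 := bitSize_mul_le (1837 / 200 * B / x) (marginal v S i)
  have h2 := bitSize_div_le (1837 / 200 * B) x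
  have h3 := bitSize_mul_le (1837 / 200) B
  have h4 := bitSize_marginal_le hv S i
  omega

-- The body calls the search, which contains a loop, so its time is assembled from the search and
-- the loop-free examination. The polynomial required by the loop rule is the bound for the prices,
-- which also covers marginals and indices.
open Polynomial in
theorem greedyLoop_polyTriple :
    PolyTriple (MainInput.oracle (bits := alg₁.bits)) (forLoop 16 greedyBody)
      (fun i σ => GreedyMemory i.b i.B i.x (i.state 0) 0 (σ.write 16 0 0))
      (fun i σ => GreedyMemory i.b i.B i.x i.run i.n σ) := by
  refine (PolyTriple.forLoop (ctr := 16)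
    (I := fun i k σ => GreedyMemory i.b i.B i.x (i.state k) k σ)
    (C (8 * bitSize (1837 / 200) + 18) + C 20 * X) (fun i k σ h => h.counter) fun q => ?_).conseq
    (fun i σ h => h) ?_
  · obtain ⟨p₁, hp₁⟩ := computes_pickProgram
    obtain ⟨p₂, hp₂⟩ := straight_examineProgram.exec
    refine ⟨(C 6 + p₁ + p₂).comp (q + (C (8 * bitSize (1837 / 200) + 18) + C 20 * X) + X + C 1),
      fun i k σ M hM hk hσ h => ?_⟩
    rw [eval_comp, ← hM]
    have hn := i.oracle.n_lt
    have hV := i.oracle.size_le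
    simp only [eval_add, eval_mul, eval_C, eval_X] at hM
    have hBM : bitSize i.B ≤ i.oracle.M := by
      change _ ≤ instanceSize i.v i.b i.B + 1
      unfold instanceSize
      omega
    have hxM : bitSize i.x ≤ i.oracle.M := (bitSize_le_valueSize i.v _).trans hV
    obtain ⟨τ, t, he, ht, hτ⟩ := hp₁ i.n i.v M ([30, 7, 14, 15].map σ)
      (by change i.oracle.n + 1 ≤ M; omega) (by change valueSize i.oracle.v ≤ M; omega)
      (fun f hf a => by
        obtain ⟨a', -, rfl⟩ := List.mem_map.1 hf
        exact hσ a' a)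
      ⟨(i.state k).1.rest, (i.state k).1.sol, by
        simp only [List.map_cons, List.map_nil, h.rest, h.sol_zero, h.sol_one,
          h.zero 30 (by norm_num)]⟩
    have hτ' : τ 0 = pickResult i.v (i.state k).1.rest (i.state k).1.sol := by
      rw [hτ]
      change pickResult i.v (toSet i.n (σ 7)) _ = _
      rw [h.rest, toSet_ofSet]
      congr 1
      funext j
      have hj : j = 0 ∨ j = 1 := by omega
      rcases hj with rfl | rfl
      · change toSet i.n (σ 14) = _
        rw [h.sol_zero, toSet_ofSet]
      · change toSet i.n (σ 15) = _
        rw [h.sol_one, toSet_ofSet]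
    have hσ₁ : Small M (update σ 12 (τ 0)) := by
      refine hσ.update (fun a => ?_) 12
      rw [hτ']
      refine bitSize_encodePair_le ?_ (by omega) (fun q => ?_) _ a
      · change i.oracle.n + 2 ≤ M
        omega
      · have := bitSize_marginal_le hV ((i.state k).1.sol q.2) q.1
        change bitSize (marginal i.oracle.v _ _) ≤ M
        omega
    have hmem : GreedyMemory i.b i.B i.x (i.state k) k (update σ 12 (τ 0)) := by
      constructor
      · simp [h.budget]
      · simp [h.costs]
      · simp [h.rest]
      · simp [h.sample]
      · simp [h.prices]
      · simp [h.sol_zero]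
      · simp [h.sol_one]
      · simp [h.counter]
      · exact fun a ha => by rw [update_of_ne (by omega), h.zero a ha]
    obtain ⟨t₂, ht₂, he₂⟩ := hp₂ i.n i.v M _ (by change i.oracle.n + 1 ≤ M; omega)
      (by change valueSize i.oracle.v ≤ M; omega) hσ₁
    have hinv := i.invariant k
    obtain ⟨hfin, hsmall⟩ := denote_examineProgram (v := i.v)
      (c := proj (i.agents \ i.ω.2.1) i.cost) (M := M) i.budget_pos hmem
      (by rw [update_self, hτ'])
      (fun a ha => by simp only [proj, if_pos (hinv.rest_subset ha)]; rfl)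
      hinv.budget_eq (by omega) (by change valueSize i.oracle.v ≤ M; omega)
      (fun S a => (bitSize_price_le hBM hxM hV S a).trans (by omega)) hσ₁
    refine ⟨_, _, Exec.seq (Exec.call he) he₂, ?_, hsmall, hfin.counter, ?_⟩
    · simp only [eval_add, eval_C, List.length_cons, List.length_nil]
      omega
    · have hstep : i.state (k + 1) = pricedStep i.v (proj (i.agents \ i.ω.2.1) i.cost) i.B i.x
          (i.state k) := iterate_succ_apply' _ _ _
      rw [hstep]
      have := hfin.write_counter (k + 1)
      push_cast at this
      exact this
  · intro i σ h
    rw [← i.state_n]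
    exact h

/-- Replace the best set (array `20`) by the set in the array `s` if that is more valuable. -/
def improveProgram (s : ℕ) : Program :=
  .seq (.query 19 (.lit 0) 20) <| .seq (.query 19 (.lit 1) s) <|
    .branch (.get 19 (.lit 1)) (.get 19 (.lit 0)) .skip (.call .skip [s] 20)

/-- As in the search for pairs, the stored set changes only on strict improvement, in agreement with
`List.argmax_concat`. Array `19` is scratch and must not hold the competing set. -/
theorem denote_improveProgram {n : ℕ} {v : Finset (Fin n) → ℚ} {σ : Memory} {s : ℕ}
    {l : List (Finset (Fin n))} (hs : s ≠ 19) (hl : l.argmax v = some (toSet n (σ 20))) :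
    (l ++ [toSet n (σ s)]).argmax v = some (toSet n ((improveProgram s).denote v σ 20)) ∧
      ∀ a, a ≠ 19 → a ≠ 20 → (improveProgram s).denote v σ a = σ a := by
  have hden : (improveProgram s).denote v σ =
      if v (toSet n (σ s)) ≤ v (toSet n (σ 20)) then
        (σ.write 19 0 (v (toSet n (σ 20)))).write 19 1 (v (toSet n (σ s)))
      else update ((σ.write 19 0 (v (toSet n (σ 20)))).write 19 1 (v (toSet n (σ s)))) 20 (σ s) := by
    simp [improveProgram, Program.denote, Expr.eval, Memory.write, hs, memoryOf]
  have hconcat := List.argmax_concat v (toSet n (σ s)) l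
  rw [hl] at hconcat
  simp only at hconcat
  rw [hconcat, hden]
  split_ifs with h1 h2 h2
  · exact absurd h1 (not_lt.2 h2)
  · refine ⟨by rw [update_self], fun a ha ha' => ?_⟩
    rw [update_of_ne ha', write_of_ne _ ha, write_of_ne _ ha]
  · exact ⟨by rw [write_of_ne _ (by norm_num), write_of_ne _ (by norm_num)],
      fun a ha _ => by rw [write_of_ne _ ha, write_of_ne _ ha]⟩
  · exact absurd (not_le.1 h2) h1

/-- Select the best of the four sets. -/
def selectProgram : Program :=
  .seq (.call .skip [14] 20) <| .seq (improveProgram 15) <|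
    .seq (improveProgram 17) (improveProgram 18)

theorem denote_selectProgram {n : ℕ} {v : Finset (Fin n) → ℚ} {σ : Memory} :
    List.argmax v [toSet n (σ 14), toSet n (σ 15), toSet n (σ 17), toSet n (σ 18)] =
        some (toSet n (selectProgram.denote v σ 20)) ∧
      ∀ a, a ≠ 19 → a ≠ 20 → selectProgram.denote v σ a = σ a := by
  have h0 : (Program.call .skip [14] 20).denote v σ = update σ 20 (σ 14) := by
    simp [Program.denote, memoryOf]
  set σ₁ := (Program.call .skip [14] 20).denote v σ
  have e0 : ∀ a, a ≠ 20 → σ₁ a = σ a := fun a ha => by rw [h0, update_of_ne ha]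
  obtain ⟨h1, e1⟩ := denote_improveProgram (v := v) (σ := σ₁) (s := 15) (l := [toSet n (σ 14)])
    (by norm_num) (by rw [h0, update_self]; rfl)
  obtain ⟨h2, e2⟩ := denote_improveProgram (s := 17) (by norm_num) h1
  obtain ⟨h3, e3⟩ := denote_improveProgram (s := 18) (by norm_num) h2
  rw [e2 18 (by norm_num) (by norm_num), e1 18 (by norm_num) (by norm_num), e0 18 (by norm_num),
    e1 17 (by norm_num) (by norm_num), e0 17 (by norm_num), e0 15 (by norm_num)] at h3
  exact ⟨h3, fun a ha ha' => ((e3 a ha ha').trans (e2 a ha ha')).trans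
    ((e1 a ha ha').trans (e0 a ha'))⟩

/-- The body of the loop that computes the payments. -/
def payBody : Program :=
  .branch (.times (.get 20 (.get 21 (.lit 0))) (.get 20 (.get 21 (.lit 0)))) (.lit 0) .skip
    (.assign 22 (.get 21 (.lit 0)) (.get 13 (.get 21 (.lit 0))))

/-- The memory during the computation of the payments. -/
structure PayMemory {n : ℕ} (T : Finset (Fin n)) (π : Fin n → ℝ) (k : ℕ) (σ : Memory) : Prop where
  prices : ∀ a : Fin n, (σ 13 a : ℝ) = π a
  best : toSet n (σ 20) = T
  counter : σ 21 0 = k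
  paid : ∀ a : Fin n, (σ 22 a : ℝ) = if a.val < k ∧ a ∈ T then π a else 0

/-- Membership means a nonzero entry, of either sign, as a subroutine may have left it. With `≤` as
the only test, this is read off from the square. -/
theorem denote_payBody {n : ℕ} (v : Finset (Fin n) → ℚ) {T : Finset (Fin n)} {π : Fin n → ℝ}
    {k : Fin n} {σ : Memory} (h : PayMemory T π k σ) :
    payBody.denote v σ = if k ∈ T then σ.write 22 k (σ 13 k) else σ := by
  have hk : k ∈ T ↔ σ 20 k ≠ 0 := by
    rw [← h.best]
    simp [toSet]
  by_cases hT : k ∈ T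
  · have : ¬ σ 20 k * σ 20 k ≤ 0 := by
      rw [not_le]
      exact mul_self_pos.2 (hk.1 hT)
    simp [payBody, Program.denote, Expr.eval, h.counter, this, hT]
  · have : σ 20 k = 0 := by simpa using mt hk.2 hT
    simp [payBody, Program.denote, Expr.eval, h.counter, this, hT]

theorem payLoop_polyTriple {ι : Type} {J : ι → Oracle} (T : ∀ i, Finset (Fin (J i).n))
    (π : ∀ i, Fin (J i).n → ℝ) :
    PolyTriple J (forLoop 21 payBody)
      (fun i σ => (∀ a : Fin (J i).n, (σ 13 a : ℝ) = π i a) ∧ toSet (J i).n (σ 20) = T i ∧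
        σ 22 = fun _ => 0)
      (fun i σ => toSet (J i).n (σ 20) = T i ∧
        ∀ a : Fin (J i).n, (σ 22 a : ℝ) = if a ∈ T i then π i a else 0) := by
  refine (PolyTriple.forLoop_straight (ctr := 21) (I := fun i k σ => PayMemory (T i) (π i) k σ)
    (Polynomial.C 0) ?_ (fun i k σ h => h.counter) ?_ ?_).conseq ?_ ?_
  · simp [payBody, Program.Straight]
  · intro i k σ M hk hM hσ h
    rw [denote_payBody (k := ⟨k, hk⟩) (J i).v h]
    split_ifs
    · exact hσ.write (hσ _ _) _ _
    · exact hσ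
  · intro i k σ hk h
    rw [denote_payBody (k := ⟨k, hk⟩) (J i).v h]
    have hlt : ∀ a : Fin (J i).n, a ≠ ⟨k, hk⟩ → (a.val < k + 1 ↔ a.val < k) := by
      intro a ha
      have : a.val ≠ k := fun h' => ha (Fin.ext h')
      omega
    split_ifs with hT
    · refine ⟨by rw [write_of_ne _ (by norm_num), h.counter], ?_, ?_, ?_, ?_⟩
      · intro a
        rw [write_of_ne _ (by norm_num), write_of_ne _ (by norm_num), h.prices]
      · rw [write_of_ne _ (by norm_num), write_of_ne _ (by norm_num), h.best]
      · rw [write_same, update_self]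
        push_cast
        rfl
      · intro a
        rw [write_of_ne _ (by norm_num), write_same]
        rcases eq_or_ne a ⟨k, hk⟩ with rfl | ha
        · rw [update_self, h.prices, if_pos ⟨Nat.lt_succ_self k, hT⟩]
        · rw [update_of_ne (fun h' => ha (Fin.ext h')), h.paid]
          simp only [hlt a ha]
    · refine ⟨h.counter, ?_, ?_, ?_, ?_⟩
      · intro a
        rw [write_of_ne _ (by norm_num), h.prices]
      · rw [write_of_ne _ (by norm_num), h.best]
      · rw [write_same, update_self]
        push_cast
        rfl
      · intro a
        rw [write_of_ne _ (by norm_num), h.paid]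
        rcases eq_or_ne a ⟨k, hk⟩ with rfl | ha
        · rw [if_neg (fun h' => hT h'.2), if_neg (fun h' => hT h'.2)]
        · simp only [hlt a ha]
  · rintro i σ ⟨h1, h2, h3⟩
    refine ⟨fun a => ?_, ?_, ?_, fun a => ?_⟩
    · rw [write_of_ne _ (by norm_num), h1]
    · rw [write_of_ne _ (by norm_num), h2]
    · rw [write_same, update_self, Nat.cast_zero]
    · rw [write_of_ne _ (by norm_num), h3]
      simp
  · rintro i σ h
    refine ⟨h.best, fun a => ?_⟩
    rw [h.paid]
    simp

/-- Sample, run Simultaneous Greedy, select the best set and compute the payments. -/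
def auctionProgram (P₁ P₂ : Program) : Program :=
  .seq (.call P₁ [0, 8, 6, 4] 9) <| .seq (.query 10 (.lit 0) 9) <|
    .seq (forLoop 16 greedyBody) <| .seq (.call P₂ [14] 17) <| .seq (.call P₂ [15] 18) <|
      .seq selectProgram <| .seq (forLoop 21 payBody) <|
        .seq (.call .skip [22] 1) (.call .skip [20] 0)

theorem GreedyMemory.update {n : ℕ} {b : Fin n → ℚ} {B x : ℚ}
    {p : GreedyState n × (Fin n → ℝ)} {k : ℕ} {σ : Memory} (h : GreedyMemory b B x p k σ)
    {a : ℕ} (ha : a = 17 ∨ a = 18) (f : ℕ → ℚ) : GreedyMemory b B x p k (update σ a f) where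
  budget := by rw [update_of_ne (by omega), h.budget]
  costs := by rw [update_of_ne (by omega), h.costs]
  rest := by rw [update_of_ne (by omega), h.rest]
  sample := by rw [update_of_ne (by omega), h.sample]
  prices i := by rw [update_of_ne (by omega), h.prices]
  sol_zero := by rw [update_of_ne (by omega), h.sol_zero]
  sol_one := by rw [update_of_ne (by omega), h.sol_one]
  counter := by rw [update_of_ne (by omega), h.counter]
  zero a ha := by rw [update_of_ne (by omega), h.zero a ha]

theorem auction_polyTriple (h₁ : alg₁.PolyTime) (h₂ : alg₂.PolyTime)
    (h₂' : alg₂.IsTwoApprox) : ∃ P₁ P₂,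
    PolyTriple (MainInput.oracle (bits := alg₁.bits)) (auctionProgram P₁ P₂)
      (fun i σ => PrepareMemory i i.n σ ∧ ¬ i.ω.1.val < 201)
      (fun i σ => toSet i.n (σ 0) = (genSmMain alg₁ alg₂ i.v i.B i.ω).outcome i.cost ∧
        ∀ k : Fin i.n, (σ 1 k : ℝ) = (genSmMain alg₁ alg₂ i.v i.B i.ω).payment i.cost k) := by
  obtain ⟨P₁, hP₁⟩ := Computes.knapsack h₁
  obtain ⟨P₂, hP₂⟩ := Computes.unconstrained h₂
  refine ⟨P₁, P₂, ?_⟩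
  have t1 : PolyTriple (MainInput.oracle (bits := alg₁.bits)) (.call P₁ [0, 8, 6, 4] 9)
      (fun i σ => PrepareMemory i i.n σ ∧ ¬ i.ω.1.val < 201)
      -- Array `9` now holds an arbitrary encoding of the output of `ALG₁`, of which only the value
      -- of the encoded set matters. All other arrays are described by the memory before the call.
      (fun i σ => (∃ f σ', PrepareMemory i i.n σ' ∧ σ = update σ' 9 f) ∧ ¬ i.ω.1.val < 201 ∧
        i.v (toSet i.n (σ 9)) = i.x) := by
    refine PolyTriple.call hP₁ ?_ ?_
    · rintro i σ ⟨h, -⟩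
      refine ⟨i.isValuation, i.agents ∩ i.ω.2.1, proj (i.agents ∩ i.ω.2.1) i.b, i.B, i.ω.2.2,
        fun k => ?_, i.budget_pos, ?_⟩
      · unfold proj
        split_ifs
        · exact i.cost_nonneg k
        · exact le_rfl
      · simp only [List.map_cons, List.map_nil, h.budget, h.sampleCosts, h.sample, h.coins,
          upTo_ofSet, upTo_ofVector]
        rfl
    · rintro i σ o ⟨h, hω⟩ ho
      refine ⟨⟨o, σ, h, rfl⟩, hω, ?_⟩
      rw [update_self]
      have := ho (i.agents ∩ i.ω.2.1) (proj (i.agents ∩ i.ω.2.1) i.b) i.B i.ω.2.2 (by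
        simp only [List.map_cons, List.map_nil, h.budget, h.sampleCosts, h.sample, h.coins,
          upTo_ofSet, upTo_ofVector]
        rfl)
      change toSet i.n o = _ at this
      rw [this]
      change i.v (alg₁.run i.v (i.agents ∩ i.ω.2.1)
        (fun a => ((proj (i.agents ∩ i.ω.2.1) i.b a : ℚ) : ℝ)) i.B i.ω.2.2) = i.x
      rw [← proj_ratCast]
      rfl
  have t2 : PolyTriple (MainInput.oracle (bits := alg₁.bits)) (.query 10 (.lit 0) 9)
      (fun i σ => (∃ f σ', PrepareMemory i i.n σ' ∧ σ = update σ' 9 f) ∧ ¬ i.ω.1.val < 201 ∧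
        i.v (toSet i.n (σ 9)) = i.x)
      (fun i σ => GreedyMemory i.b i.B i.x (i.state 0) 0 (σ.write 16 0 0)) := by
    refine PolyTriple.straight trivial ?_
    rintro i _ ⟨⟨f, σ, h, rfl⟩, hω, hx⟩
    have hden : (Program.query 10 (.lit 0) 9).denote i.v (update σ 9 f) =
        Memory.write (update σ 9 f) 10 0 i.x := by
      simp only [Program.denote, hx, Expr.eval, Nat.floor_zero]
    change GreedyMemory i.b i.B i.x (i.state 0) 0
      (((Program.query 10 (.lit 0) 9).denote i.v (update σ 9 f)).write 16 0 0)
    rw [hden]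
    constructor
    · simp [Memory.write, h.budget]
    · simp [Memory.write, h.costs]
    · simp [Memory.write, h.rest, upTo_ofSet, MainInput.state, greedyInit]
    · simp [Memory.write]
    · simp [Memory.write, h.zero 13, MainInput.state, greedyInit]
    · simp [Memory.write, h.zero 14, MainInput.state, greedyInit, ofSet_empty]
    · simp [Memory.write, h.zero 15, MainInput.state, greedyInit, ofSet_empty]
    · simp [Memory.write]
    · intro a ha
      rw [write_of_ne _ (by omega), write_of_ne _ (by omega), update_of_ne (by omega),
        h.zero a (by omega) (by omega)]
  have t4 : PolyTriple (MainInput.oracle (bits := alg₁.bits)) (.call P₂ [14] 17)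
      (fun i σ => GreedyMemory i.b i.B i.x i.run i.n σ)
      (fun i σ => GreedyMemory i.b i.B i.x i.run i.n σ ∧
        toSet i.n (σ 17) = alg₂.run i.v (i.run.1.sol 0)) := by
    refine PolyTriple.call hP₂ ?_ ?_
    · intro i σ h
      refine ⟨i.isValuation, i.run.1.sol 0, ?_⟩
      simp only [List.map_cons, List.map_nil, h.sol_zero]
      rfl
    · intro i σ o h ho
      refine ⟨h.update (Or.inl rfl) o, ?_⟩
      rw [update_self]
      refine ho (i.run.1.sol 0) ?_
      simp only [List.map_cons, List.map_nil, h.sol_zero]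
      rfl
  have t5 : PolyTriple (MainInput.oracle (bits := alg₁.bits)) (.call P₂ [15] 18)
      (fun i σ => GreedyMemory i.b i.B i.x i.run i.n σ ∧
        toSet i.n (σ 17) = alg₂.run i.v (i.run.1.sol 0))
      (fun i σ => GreedyMemory i.b i.B i.x i.run i.n σ ∧
        toSet i.n (σ 17) = alg₂.run i.v (i.run.1.sol 0) ∧
        toSet i.n (σ 18) = alg₂.run i.v (i.run.1.sol 1)) := by
    refine PolyTriple.call hP₂ ?_ ?_
    · rintro i σ ⟨h, -⟩
      refine ⟨i.isValuation, i.run.1.sol 1, ?_⟩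
      simp only [List.map_cons, List.map_nil, h.sol_one]
      rfl
    · rintro i σ o ⟨h, h17⟩ ho
      refine ⟨h.update (Or.inr rfl) o, by rw [update_of_ne (by norm_num), h17], ?_⟩
      rw [update_self]
      refine ho (i.run.1.sol 1) ?_
      simp only [List.map_cons, List.map_nil, h.sol_one]
      rfl
  have t6 : PolyTriple (MainInput.oracle (bits := alg₁.bits)) selectProgram
      (fun i σ => GreedyMemory i.b i.B i.x i.run i.n σ ∧
        toSet i.n (σ 17) = alg₂.run i.v (i.run.1.sol 0) ∧
        toSet i.n (σ 18) = alg₂.run i.v (i.run.1.sol 1))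
      (fun i σ => (∀ a : Fin i.oracle.n, (σ 13 a : ℝ) = i.run.2 a) ∧
        toSet i.oracle.n (σ 20) = bestOfFour alg₂ i.v i.run.1.sol ∧ σ 22 = fun _ => 0) := by
    refine PolyTriple.straight (by simp [selectProgram, improveProgram, Program.Straight]) ?_
    rintro i σ ⟨h, h17, h18⟩
    obtain ⟨hsel, hother⟩ := denote_selectProgram (v := i.oracle.v) (σ := σ)
    refine ⟨fun a => ?_, ?_, ?_⟩
    · rw [hother 13 (by norm_num) (by norm_num)]
      exact h.prices a
    · have e : List.argmax i.v [i.run.1.sol 0, i.run.1.sol 1, alg₂.run i.v (i.run.1.sol 0),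
          alg₂.run i.v (i.run.1.sol 1)] =
            some (toSet i.n (selectProgram.denote i.v σ 20)) := by
        rw [← h17, ← h18, ← toSet_ofSet (i.run.1.sol 0), ← toSet_ofSet (i.run.1.sol 1),
          ← h.sol_zero, ← h.sol_one]
        exact hsel
      rw [bestOfFour, e]
      rfl
    · rw [hother 22 (by norm_num) (by norm_num), h.zero 22 (by norm_num)]
  have t7 := payLoop_polyTriple (J := MainInput.oracle (bits := alg₁.bits))
    (fun i => bestOfFour alg₂ i.v i.run.1.sol) (fun i => i.run.2)
  have t8 : PolyTriple (MainInput.oracle (bits := alg₁.bits))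
      (.seq (.call .skip [22] 1) (.call .skip [20] 0))
      (fun i σ => toSet i.n (σ 20) = bestOfFour alg₂ i.v i.run.1.sol ∧
        ∀ a : Fin i.n, (σ 22 a : ℝ) =
          if a ∈ bestOfFour alg₂ i.v i.run.1.sol then i.run.2 a else 0)
      (fun i σ => toSet i.n (σ 0) = bestOfFour alg₂ i.v i.run.1.sol ∧
        ∀ a : Fin i.n, (σ 1 a : ℝ) =
          if a ∈ bestOfFour alg₂ i.v i.run.1.sol then i.run.2 a else 0) := by
    refine PolyTriple.straight (by simp [Program.Straight]) ?_
    rintro i σ ⟨h20, h22⟩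
    have hden : (Program.seq (.call .skip [22] 1) (.call .skip [20] 0)).denote i.oracle.v σ =
        update (update σ 1 (σ 22)) 0 (σ 20) := by
      simp [Program.denote, memoryOf]
    rw [hden]
    refine ⟨by rw [update_self]; exact h20, fun a => ?_⟩
    rw [update_of_ne (by norm_num), update_self]
    exact h22 a
  have hω : PolyTriple (MainInput.oracle (bits := alg₁.bits)) (auctionProgram P₁ P₂)
      (fun i σ => PrepareMemory i i.n σ ∧ ¬ i.ω.1.val < 201)
      (fun i σ => toSet i.n (σ 0) = bestOfFour alg₂ i.v i.run.1.sol ∧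
        ∀ a : Fin i.n, (σ 1 a : ℝ) =
          if a ∈ bestOfFour alg₂ i.v i.run.1.sol then i.run.2 a else 0) :=
    t1.seq (t2.seq (greedyLoop_polyTriple.seq (t4.seq (t5.seq (t6.seq (t7.seq t8))))))
  -- The fact that the seed selects the greedy branch is not carried through the chain of triples.
  -- Unfolding the triple makes it available again from the precondition, to translate the outcome
  -- and the payments.
  intro q
  obtain ⟨p, hp⟩ := hω q
  refine ⟨p, fun i σ hσ hpre => ?_⟩
  obtain ⟨σ', t, he, ht, h0, h1⟩ := hp i σ hσ hpre
  refine ⟨σ', t, he, ht, ?_, fun k => ?_⟩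
  · rw [h0]
    exact (genSmOutcome_mainRun hpre.2 i.cost).symm
  · rw [h1]
    simp only [genSmMain]
    rw [greedy_payment h₂' i.isValuation (by exact_mod_cast i.budget_pos) hpre.2,
      genSmOutcome_mainRun hpre.2]
    rfl

theorem genSmMain_polyTime (h₁ : alg₁.PolyTime) (h₂ : alg₂.PolyTime) (h₂' : alg₂.IsTwoApprox) :
    MechanismPolyTime (fun n v B => genSmMain (n := n) alg₁ alg₂ v B) := by
  obtain ⟨P₁, P₂, hauction⟩ := auction_polyTriple h₁ h₂ h₂'
  have hmain := prepare_polyTriple.seq (PolyTriple.branch (e₁ := .lit 201) (e₂ := .get 2 (.lit 0))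
    (hauction.conseq (Pre' := fun i σ => PrepareMemory i i.n σ ∧ _) (fun i σ h => ⟨h.1, by
      have := h.2
      simp only [Expr.eval, Nat.floor_zero, h.1.lottery, ofNumber_zero] at this
      exact not_lt.2 (by exact_mod_cast this)⟩) (fun i σ h => h))
    ((lottery_polyTriple alg₁ alg₂).conseq (Pre' := fun i σ => PrepareMemory i i.n σ ∧ _)
      (fun i σ h => ⟨h.1, by
        have := h.2
        simp only [Expr.eval, Nat.floor_zero, h.1.lottery, ofNumber_zero, not_le] at this
        exact_mod_cast this⟩) (fun i σ h => h)))
  -- The constant leaves room for the lottery number, which is below 1000, and for indicator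
  -- entries. All other input numbers are bounded by the instance size.
  obtain ⟨p, hp⟩ := hmain (Polynomial.X + Polynomial.C 1001)
  refine ⟨.seq (forLoop 11 prepareBody) (.branch (.lit 201) (.get 2 (.lit 0))
    (auctionProgram P₁ P₂) lotteryProgram), p.comp (Polynomial.X + Polynomial.C 1), fun n v b B ω hv hb hB => ?_⟩
  set i : MainInput alg₁.bits := ⟨n, v, b, B, ω, hv, hb, hB⟩ with hi
  have hsmall : Small ((Polynomial.X + Polynomial.C 1001).eval i.oracle.M)
      (memoryOf [ofNumber B, ofVector b, ofNumber ω.1.val, ofSet ω.2.1, ofBits ω.2.2]) := by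
    have hM : i.oracle.M = instanceSize v b B + 1 := rfl
    simp only [Polynomial.eval_add, Polynomial.eval_X, Polynomial.eval_C, hM]
    refine small_memoryOf (by omega) fun f hf k => ?_
    simp only [List.mem_cons, List.not_mem_nil, or_false] at hf
    rcases hf with rfl | rfl | rfl | rfl | rfl
    · refine bitSize_ofNumber_le (by omega) ?_ k
      unfold instanceSize
      omega
    · refine bitSize_ofVector_le (by omega) (fun a => ?_) k
      have := Finset.single_le_sum (f := fun a => bitSize (b a)) (fun _ _ => Nat.zero_le _)
        (Finset.mem_univ a)
      unfold instanceSize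
      omega
    · refine bitSize_ofNumber_le (by omega) ?_ k
      have := bitSize_natCast ω.1.val
      have := ω.1.isLt
      omega
    · exact bitSize_ofSet_le (by omega) _ k
    · refine bitSize_ofVector_le (by omega) (fun a => ?_) k
      split_ifs
      · rw [bitSize_one]
        omega
      · rw [bitSize_zero]
        omega
  obtain ⟨σ, t, he, ht, h0, h1⟩ := hp i _ hsmall rfl
  refine ⟨σ, t, he, h0, h1, ?_⟩
  simp only [Polynomial.eval_comp, Polynomial.eval_add, Polynomial.eval_X, Polynomial.eval_C]
  exact ht

end Auction

end GenSm

theorem theorem1 :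
    ∃ ε : ℝ, 0 < ε ∧
      ∀ (alg₁ : GenSm.KnapsackAlg) (alg₂ : GenSm.UnconstrainedAlg),
        alg₁.IsApprox ε → alg₂.IsTwoApprox →
          (∀ (n : ℕ) (v : Finset (Fin n) → ℚ) (B : ℝ), GenSm.IsValuation v → 0 < B →
            (GenSm.genSmMain alg₁ alg₂ v B).UniversallyTruthful ∧
            (∀ ω, (GenSm.genSmMain alg₁ alg₂ v B ω).IndividuallyRational) ∧
            (∀ ω, (GenSm.genSmMain alg₁ alg₂ v B ω).BudgetFeasible B) ∧
            (∀ c : Fin n → ℝ, (∀ i, 0 ≤ c i) →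
              GenSm.opt Finset.univ v c B ≤
                505 * (GenSm.genSmMain alg₁ alg₂ v B).expectedValue v c)) ∧
          (alg₁.PolyTime → alg₂.PolyTime →
            GenSm.MechanismPolyTime
              (fun n v B => GenSm.genSmMain (n := n) alg₁ alg₂ v B)) := by
  -- This `ε` is small enough to keep `1/e - ε ≥ 0.3677`; the loss of the factor `1 - ε` still
  -- leaves the constant 505.
  refine ⟨1 / 10000, by norm_num, fun alg₁ alg₂ h₁ h₂ => ⟨fun n v B hv hB => ⟨fun ω => ?_,
    fun ω => ?_, fun ω => ?_, fun c hc => ?_⟩, fun hp₁ hp₂ => ?_⟩⟩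
  · exact (GenSm.genSmOutcome_hasThresholds h₂ hv hB ω).truthful
  · exact (GenSm.genSmOutcome_hasThresholds h₂ hv hB ω).individuallyRational
  · exact GenSm.genSmMain_budgetFeasible h₂ hv hB ω
  · exact GenSm.genSmMain_approximation hv hB h₁ hc
  · exact GenSm.genSmMain_polyTime hp₁ hp₂ h₂
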